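/- Let $a>0$, $s>0$ with $s-\frac12\notin\mathbb N_0$, and put $m=\lfloor s-\frac12\rfloor$ and $P_m(w)=\sum_{j=0}^m w^j/j!$, with $P_m=0$ if $s<\frac12$ (when $m=-1$). *Definitions.* The Fourier transform is $\widehat f(\xi)=\frac1{\sqrt{2\pi}}\int_{\mathbb R} f(x)e^{-ix\xi}\,dx$. For a Schwartz function $\varphi$ let $\Delta^{s/2}\varphi=\mathcal F^{-1}(|\cdot|^s\widehat\varphi)$. A tempered distribution $h$ has fractional Laplacian $\Delta^{s/2}h=u\in L^2(\mathbb R)$ if there are Schwartz functions $\varphi_n$ with $\varphi_n\to h$ in $\mathcal S'$ modulo polynomials of degree at most $m$ (that is, tested against the Schwartz functions whose moments of order $\le m$ vanish) and $\Delta^{s/2}\varphi_n\to u$ in $L^2$. Let $E^{s,2}$ be the space of all functions $h$ on $\mathbb R$ with $\Delta^{s/2}h\in L^2$ and, if $s<\frac12$, $h\in L^{p^*}$ with $\frac1{p^*}=\frac12-s$; if $s>\frac12$, $h\in C^m$, $h^{(m)}$ Hölder continuous of exponent $s-\frac12-m$ on $\mathbb R$, and $h(0)=h'(0)=\dots=h^{(m)}(0)=0$.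 An entire function $f$ is of exponential type $a$ if for every $\varepsilon>0$ there is $C_\varepsilon$ with $|f(z)|\le C_\varepsilon e^{(a+\varepsilon)|z|}$ for all $z\in\mathbb C$. Let $PW_a$ (respectively $PW^s_a$) be the space of entire functions $f$ of exponential type $a$ whose restriction $f_0$ to $\mathbb R$ lies in $L^2(\mathbb R)$ (respectively in $E^{s,2}$), and give $PW^s_a$ the inner product $\langle f\,|\,g\rangle=\int_{\mathbb R}\Delta^{s/2}f_0\,\overline{\Delta^{s/2}g_0}\,dx$. **Statement.** This is indeed an inner product on $PW^s_a$, and $PW^s_a$ is a Hilbert space. The functions $$\psi_n(z)=\frac1{2\sqrt{a\pi}}\int_{-a}^a e^{-in\frac\pi a\xi}\big(e^{iz\xi}-P_m(iz\xi)\big)|\xi|^{-s}\,d\xi,\qquad n\in\mathbb Z,$$ form an orthonormal basis of $PW^s_a$; if $0<s<\frac12$, they are the translates $\psi_n=\psi_0(\cdot-n\pi/a)$. Moreover, for every $f\in PW^s_a$ the function $\Delta^{s/2}f_0$ is the restriction to $\mathbb R$ (almost everywhere) of a unique function in $PW_a$, denoted $\Delta^{s/2}f$, and $$f=\sqrt{\frac\pi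 a}\,\sum_{n\in\mathbb Z}\Delta^{s/2}f\Big(\frac{n\pi}a\Big)\,\psi_n,\qquad \|f\|^2_{PW^s_a}=\frac\pi a\sum_{n\in\mathbb Z}\Big|\Delta^{s/2}f\Big(\frac{n\pi}a\Big)\Big|^2,$$ where the first series converges unconditionally, in the norm of $PW^s_a$ and uniformly on compact subsets of $\mathbb C$. -/

import Mathlib

open Filter Topology MeasureTheory
open scoped SchwartzMap FourierTransform ENNReal NNReal ContDiff

/-- The number `m + 1` of Taylor coefficients at the origin, where `m = ⌊s - 1/2⌋`
(so that `m = -1` and there are none when `0 < s < 1/2`). -/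
noncomputable def taylorCount (s : ℝ) : ℕ := ⌊s + 1 / 2⌋₊

/-- The Taylor polynomial `P_m(w) = ∑_{j ≤ m} w ^ j / j!` of `exp`, `m = ⌊s - 1/2⌋`;
it is `0` when `0 < s < 1/2`. -/
noncomputable def taylorExp (s : ℝ) (w : ℂ) : ℂ :=
  ∑ j ∈ Finset.range (taylorCount s), w ^ j / (j.factorial : ℂ)

/-- The fractional Laplacian `Δ^{s/2} φ = 𝓕⁻¹ (|·|^s 𝓕 φ)` of a Schwartz function, where `|·|` is
the modulus of the angular frequency. Mathlib's `𝓕` uses the kernel `exp (-2πixξ)`, so that the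
angular frequency is `2πξ`. -/
noncomputable def schwartzFracLap (s : ℝ) (φ : 𝓢(ℝ, ℂ)) : ℝ → ℂ :=
  𝓕⁻ (fun ξ : ℝ => ((|2 * Real.pi * ξ| ^ s : ℝ) : ℂ) * 𝓕 (φ : ℝ → ℂ) ξ)

/-- The Schwartz functions whose moments of order `k ≤ m = ⌊s - 1/2⌋` vanish: the predual of the
tempered distributions modulo polynomials of degree at most `m`. -/
def VanishingMoments (s : ℝ) (ψ : 𝓢(ℝ, ℂ)) : Prop :=
  ∀ k < taylorCount s, ∫ x : ℝ, (x : ℂ) ^ k * ψ x = 0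

/-- `u ∈ L²` is the fractional Laplacian `Δ^{s/2} f` of the tempered distribution (function) `f`:
there are Schwartz functions `φ n` converging to `f` in the space `𝓢' / 𝓟_m` of tempered
distributions modulo polynomials of degree at most `m = ⌊s - 1/2⌋`, such that `Δ^{s/2} (φ n)`
converges to `u` in `L²`. -/
def IsFracLap (s : ℝ) (f u : ℝ → ℂ) : Prop :=
  MemLp u 2 volume ∧ (∀ ψ : 𝓢(ℝ, ℂ), Integrable (fun x => f x * ψ x)) ∧
  ∃ φ : ℕ → 𝓢(ℝ, ℂ),
    (∀ ψ : 𝓢(ℝ, ℂ), VanishingMoments s ψ →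
      Tendsto (fun n => ∫ x, φ n x * ψ x) atTop (𝓝 (∫ x, f x * ψ x))) ∧
    Tendsto (fun n => eLpNorm (fun x => schwartzFracLap s (φ n) x - u x) 2 volume) atTop (𝓝 0)

/-- The homogeneous Lipschitz space of non-integer order `γ > 0`: with `m = ⌊γ⌋`, the functions
of class `C^m` whose `m`-th derivative is Hölder continuous of exponent `γ - m`. -/
def HomLipschitz (γ : ℝ) (f : ℝ → ℂ) : Prop :=
  ContDiff ℝ ⌊γ⌋₊ f ∧
  ∃ C : ℝ, ∀ x y : ℝ,
    ‖iteratedDeriv ⌊γ⌋₊ f x - iteratedDeriv ⌊γ⌋₊ f y‖ ≤ C * |x - y| ^ (γ - ⌊γ⌋₊)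

/-- The realization space `E^{s,2}` of the homogeneous Sobolev space of order `s`, for `s > 0` and
`s - 1/2` not a natural number. If `s < 1/2`, it consists of the `f ∈ L^{p*}`,
`1/p* = 1/2 - s`, with `Δ^{s/2} f ∈ L²`. If `s > 1/2`, it consists of the `f` in the homogeneous
Lipschitz space of order `s - 1/2` whose Taylor polynomial of order `m = ⌊s - 1/2⌋` at the origin
is zero, with `Δ^{s/2} f ∈ L²`. -/
def RealizationSpace (s : ℝ) (f : ℝ → ℂ) : Prop :=
  (s < 1 / 2 → MemLp f (ENNReal.ofReal (1 / (1 / 2 - s))) volume) ∧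
  (1 / 2 < s → HomLipschitz (s - 1 / 2) f ∧ ∀ k ≤ ⌊s - 1 / 2⌋₊, iteratedDeriv k f 0 = 0) ∧
  ∃ u : ℝ → ℂ, IsFracLap s f u

/-- Entire functions of exponential type `a`. -/
def IsEntireExpType (a : ℝ) (f : ℂ → ℂ) : Prop :=
  Differentiable ℂ f ∧
  ∀ ε : ℝ, 0 < ε → ∃ C : ℝ, ∀ z : ℂ, ‖f z‖ ≤ C * Real.exp ((a + ε) * ‖z‖)

/-- Membership in the classical Paley--Wiener space `PW_a`. -/
def IsPaleyWiener (a : ℝ) (f : ℂ → ℂ) : Prop :=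
  IsEntireExpType a f ∧ MemLp (fun x : ℝ => f x) 2 volume

/-- The entire function `F ∈ PW_a` is the entire extension of `Δ^{s/2} f₀`, where `f₀` is the
restriction of `f` to the real line. -/
def IsFracLapExt (s a : ℝ) (f F : ℂ → ℂ) : Prop :=
  IsPaleyWiener a F ∧ IsFracLap s (fun x : ℝ => f x) (fun x : ℝ => F x)

/-- The functions `ψ_n(z) = (2√(aπ))⁻¹ ∫_{-a}^a e^{-inπξ/a} (e^{izξ} - P_m(izξ)) |ξ|^{-s} dξ`,
`m = ⌊s - 1/2⌋`, where `P_m = 0` if `0 < s < 1/2`. -/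
noncomputable def shannonFun (s a : ℝ) (n : ℤ) (z : ℂ) : ℂ :=
  ((1 / (2 * √(a * Real.pi)) : ℝ) : ℂ) *
    ∫ ξ in (-a)..a, Complex.exp (-(Complex.I * n * (Real.pi / a) * ξ)) *
      (Complex.exp (Complex.I * z * ξ) - taylorExp s (Complex.I * z * ξ)) *
        ((|ξ| ^ (-s) : ℝ) : ℂ)

lemma schwartzFracLap_integrable {s : ℝ} (hs : 0 ≤ s) (φ : 𝓢(ℝ, ℂ)) :
    Integrable (fun ξ : ℝ => ((|2 * Real.pi * ξ| ^ s : ℝ) : ℂ) * 𝓕 (φ : ℝ → ℂ) ξ) := by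
  set χ : 𝓢(ℝ, ℂ) := 𝓕 φ with hχ
  have hχ' : (𝓕 (φ : ℝ → ℂ)) = χ := by rw [hχ, SchwartzMap.fourier_coe]
  rw [hχ']
  have h0 := (χ.integrable_pow_mul volume 0).add (χ.integrable_pow_mul volume ⌈s⌉₊)
  refine Integrable.mono' (h0.const_mul ((2 * Real.pi) ^ s)) ?_ ?_
  · refine Continuous.aestronglyMeasurable ?_
    refine (Complex.continuous_ofReal.comp ?_).mul χ.continuous
    exact ((by fun_prop : Continuous fun ξ : ℝ => |2 * Real.pi * ξ|)).rpow_const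
      (fun _ => Or.inr hs)
  · refine Eventually.of_forall fun ξ => ?_
    have hpi : (0 : ℝ) ≤ 2 * Real.pi := by positivity
    simp only [norm_mul, Complex.norm_real, Real.norm_eq_abs, Pi.add_apply, pow_zero, one_mul]
    rw [abs_of_nonneg (by positivity : (0 : ℝ) ≤ |2 * Real.pi * ξ| ^ s), abs_mul,
      abs_of_nonneg hpi, Real.mul_rpow hpi (abs_nonneg ξ), mul_assoc]
    refine mul_le_mul_of_nonneg_left ?_ (by positivity)
    have key : |ξ| ^ s ≤ 1 + |ξ| ^ ⌈s⌉₊ := by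
      rcases le_total |ξ| 1 with h | h
      · have := Real.rpow_le_one (abs_nonneg ξ) h hs
        have h2 : 0 ≤ |ξ| ^ ⌈s⌉₊ := by positivity
        linarith
      · have := Real.rpow_le_rpow_of_exponent_le h (Nat.le_ceil s)
        rw [Real.rpow_natCast] at this
        linarith
    calc |ξ| ^ s * ‖χ ξ‖ ≤ (1 + |ξ| ^ ⌈s⌉₊) * ‖χ ξ‖ := by gcongr
      _ = _ := by ring

lemma schwartzFracLap_add {s : ℝ} (hs : 0 ≤ s) (φ χ : 𝓢(ℝ, ℂ)) :
    schwartzFracLap s (φ + χ) = schwartzFracLap s φ + schwartzFracLap s χ := by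
  have h1 := schwartzFracLap_integrable hs φ
  have h2 := schwartzFracLap_integrable hs χ
  have h3 : (fun ξ : ℝ => ((|2 * Real.pi * ξ| ^ s : ℝ) : ℂ) * 𝓕 ((φ + χ : 𝓢(ℝ, ℂ)) : ℝ → ℂ) ξ)
      = fun ξ : ℝ => ((|2 * Real.pi * ξ| ^ s : ℝ) : ℂ) * 𝓕 (φ : ℝ → ℂ) ξ
        + ((|2 * Real.pi * ξ| ^ s : ℝ) : ℂ) * 𝓕 (χ : ℝ → ℂ) ξ := by
    funext ξ
    have : 𝓕 ((φ + χ : 𝓢(ℝ, ℂ)) : ℝ → ℂ) ξ = 𝓕 (φ : ℝ → ℂ) ξ + 𝓕 (χ : ℝ → ℂ) ξ := by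
      simp only [← SchwartzMap.fourier_coe, FourierTransform.fourier_add, add_apply]
    rw [this, mul_add]
  funext x
  unfold schwartzFracLap
  rw [h3, Pi.add_apply, Real.fourierInv_eq, Real.fourierInv_eq, Real.fourierInv_eq,
    ← integral_add]
  · simp only [smul_add]
  · exact (Real.fourierIntegral_convergent_iff' (innerSL ℝ) (-x)).2 h1 |>.congr (by
      refine Eventually.of_forall fun v => ?_
      change 𝐞 (-(inner ℝ v (-x))) • _ = 𝐞 (inner ℝ v x) • _
      rw [inner_neg_right, neg_neg])
  · exact (Real.fourierIntegral_convergent_iff' (innerSL ℝ) (-x)).2 h2 |>.congr (by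
      refine Eventually.of_forall fun v => ?_
      change 𝐞 (-(inner ℝ v (-x))) • _ = 𝐞 (inner ℝ v x) • _
      rw [inner_neg_right, neg_neg])

lemma schwartzFracLap_smul (s : ℝ) (c : ℂ) (φ : 𝓢(ℝ, ℂ)) :
    schwartzFracLap s (c • φ) = c • schwartzFracLap s φ := by
  have h3 : (fun ξ : ℝ => ((|2 * Real.pi * ξ| ^ s : ℝ) : ℂ) * 𝓕 ((c • φ : 𝓢(ℝ, ℂ)) : ℝ → ℂ) ξ)
      = fun ξ : ℝ => c • (((|2 * Real.pi * ξ| ^ s : ℝ) : ℂ) * 𝓕 (φ : ℝ → ℂ) ξ) := by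
    funext ξ
    have : 𝓕 ((c • φ : 𝓢(ℝ, ℂ)) : ℝ → ℂ) ξ = c • 𝓕 (φ : ℝ → ℂ) ξ := by
      simp only [← SchwartzMap.fourier_coe, FourierTransform.fourier_smul, smul_apply]
    rw [this, mul_smul_comm]
  funext x
  unfold schwartzFracLap
  rw [h3, Pi.smul_apply, Real.fourierInv_eq, Real.fourierInv_eq, ← integral_smul]
  simp only [smul_comm c]

lemma schwartzFracLap_aestronglyMeasurable {s : ℝ} (hs : 0 ≤ s) (φ : 𝓢(ℝ, ℂ)) :
    AEStronglyMeasurable (schwartzFracLap s φ) volume := by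
  have h1 := schwartzFracLap_integrable hs φ
  refine Continuous.aestronglyMeasurable ?_
  exact VectorFourier.fourierIntegral_continuous Real.continuous_fourierChar
    (by fun_prop) h1

lemma IsFracLap.add {s : ℝ} (hs : 0 ≤ s) {f g u v : ℝ → ℂ} (hf : IsFracLap s f u)
    (hg : IsFracLap s g v) :
    IsFracLap s (fun x => f x + g x) (fun x => u x + v x) := by
  obtain ⟨hu, hfi, φ, hφ, hφu⟩ := hf
  obtain ⟨hv, hgi, χ, hχ, hχv⟩ := hg
  refine ⟨hu.add hv, fun ψ => ?_, fun n => φ n + χ n, fun ψ hψ => ?_, ?_⟩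
  · refine ((hfi ψ).add (hgi ψ)).congr (Eventually.of_forall fun x => ?_)
    simp only [Pi.add_apply, add_mul]
  · have hint : ∀ η : 𝓢(ℝ, ℂ), Integrable (fun x => η x * ψ x) := fun η => by
      refine (ψ.integrable (μ := volume)).bdd_mul η.continuous.aestronglyMeasurable
        (c := (SchwartzMap.seminorm ℝ 0 0) η) ?_
      exact Eventually.of_forall fun x => SchwartzMap.norm_le_seminorm ℝ η x
    have h := (hφ ψ hψ).add (hχ ψ hψ)
    rw [← integral_add (hfi ψ) (hgi ψ)] at h
    simp only [add_mul]
    refine h.congr fun n => ?_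
    rw [← integral_add (hint _) (hint _)]
    simp only [add_apply, add_mul]
  · refine tendsto_of_tendsto_of_tendsto_of_le_of_le tendsto_const_nhds
      (by simpa using hφu.add hχv) (fun n => zero_le) fun n => ?_
    have hm1 := (schwartzFracLap_aestronglyMeasurable hs (φ n)).sub hu.1
    have hm2 := (schwartzFracLap_aestronglyMeasurable hs (χ n)).sub hv.1
    refine le_trans (le_of_eq ?_) (eLpNorm_add_le hm1 hm2 (by norm_num))
    congr 1
    funext x
    rw [schwartzFracLap_add hs]
    simp only [Pi.add_apply]
    ring

lemma IsFracLap.smul {s : ℝ} (c : ℂ) {f u : ℝ → ℂ} (hf : IsFracLap s f u) :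
    IsFracLap s (fun x => c * f x) (fun x => c * u x) := by
  obtain ⟨hu, hfi, φ, hφ, hφu⟩ := hf
  refine ⟨hu.const_mul c, fun ψ => ?_, fun n => c • φ n, fun ψ hψ => ?_, ?_⟩
  · simpa only [mul_assoc] using (hfi ψ).const_mul c
  · simp only [smul_apply, smul_eq_mul, mul_assoc, integral_const_mul]
    exact (hφ ψ hψ).const_mul c
  · have h : ∀ n, eLpNorm (fun x => schwartzFracLap s (c • φ n) x - c * u x) 2 volume
        = ‖c‖ₑ * eLpNorm (fun x => schwartzFracLap s (φ n) x - u x) 2 volume := fun n => by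
      rw [← eLpNorm_const_smul]
      congr 1
      funext x
      rw [schwartzFracLap_smul]
      simp only [Pi.smul_apply, smul_eq_mul, mul_sub]
    simp only [h]
    have := ENNReal.Tendsto.const_mul (a := ‖c‖ₑ) hφu (Or.inr enorm_ne_top)
    simpa using this

lemma isFracLap_zero (s : ℝ) : IsFracLap s (fun _ => 0) (fun _ => 0) := by
  refine ⟨MemLp.zero, fun ψ => by simp, fun _ => 0, fun ψ _ => by simp, ?_⟩
  have h0 : schwartzFracLap s 0 = 0 := by
    have := schwartzFracLap_smul s 0 0
    simpa using this
  simp [h0]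

lemma HomLipschitz.add {γ : ℝ} {f g : ℝ → ℂ} (hf : HomLipschitz γ f) (hg : HomLipschitz γ g) :
    HomLipschitz γ (fun x => f x + g x) := by
  obtain ⟨hf1, C, hC⟩ := hf
  obtain ⟨hg1, D, hD⟩ := hg
  refine ⟨hf1.add hg1, C + D, fun x y => ?_⟩
  have h : ∀ x, iteratedDeriv ⌊γ⌋₊ (fun x => f x + g x) x
      = iteratedDeriv ⌊γ⌋₊ f x + iteratedDeriv ⌊γ⌋₊ g x := fun x =>
    iteratedDeriv_fun_add hf1.contDiffAt hg1.contDiffAt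
  rw [h, h, add_sub_add_comm, add_mul]
  exact (norm_add_le _ _).trans (add_le_add (hC x y) (hD x y))

lemma HomLipschitz.smul {γ : ℝ} (c : ℂ) {f : ℝ → ℂ} (hf : HomLipschitz γ f) :
    HomLipschitz γ (fun x => c * f x) := by
  obtain ⟨hf1, C, hC⟩ := hf
  refine ⟨contDiff_const.mul hf1, ‖c‖ * C, fun x y => ?_⟩
  have h : ∀ x, iteratedDeriv ⌊γ⌋₊ (fun x => c * f x) x = c * iteratedDeriv ⌊γ⌋₊ f x := fun x =>
    iteratedDeriv_const_mul c hf1.contDiffAt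
  rw [h, h, ← mul_sub, norm_mul, mul_assoc]
  exact mul_le_mul_of_nonneg_left (hC x y) (norm_nonneg _)

/-- The fractional Paley--Wiener space `PW^s_a`: the entire functions `f` of exponential type `a`
whose restriction to the real line belongs to the realization space `E^{s,2}`. For `s > 1/2` the
latter contains the condition that the Taylor polynomial of order `⌊s - 1/2⌋` at `0` vanishes. -/
def fracPaleyWiener (s a : ℝ) (hs : 0 < s) : Submodule ℂ (ℂ → ℂ) where
  carrier := {f | IsEntireExpType a f ∧ RealizationSpace s (fun x : ℝ => f x)}
  zero_mem' := by
    refine ⟨⟨differentiable_const _, fun ε _ => ⟨0, fun z => by simp⟩⟩, fun _ => MemLp.zero,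
      fun _ => ⟨⟨contDiff_const, 0, fun x y => ?_⟩, fun k _ => ?_⟩, _, isFracLap_zero s⟩
    · simp
    · simp
  add_mem' := by
    rintro f g ⟨⟨hf, hf1⟩, hf2, hf3, u, hu⟩ ⟨⟨hg, hg1⟩, hg2, hg3, v, hv⟩
    refine ⟨⟨hf.add hg, fun ε hε => ?_⟩, fun h => (hf2 h).add (hg2 h),
      fun h => ⟨(hf3 h).1.add (hg3 h).1, fun k hk => ?_⟩, _, hu.add hs.le hv⟩
    · obtain ⟨C, hC⟩ := hf1 ε hε
      obtain ⟨D, hD⟩ := hg1 ε hε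
      refine ⟨C + D, fun z => ?_⟩
      rw [add_mul]
      exact (norm_add_le _ _).trans (add_le_add (hC z) (hD z))
    · have hk' : ((k : ℕ) : WithTop ℕ∞) ≤ (⌊s - 1 / 2⌋₊ : ℕ) := by exact_mod_cast hk
      have h1 := ((hf3 h).1.1.of_le hk').contDiffAt (x := 0)
      have h2 := ((hg3 h).1.1.of_le hk').contDiffAt (x := 0)
      have := iteratedDeriv_fun_add h1 h2
      simp only [Pi.add_apply]
      rw [this, (hf3 h).2 k hk, (hg3 h).2 k hk, add_zero]
  smul_mem' := by
    rintro c f ⟨⟨hf, hf1⟩, hf2, hf3, u, hu⟩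
    refine ⟨⟨hf.const_smul c, fun ε hε => ?_⟩, fun h => (hf2 h).const_mul c,
      fun h => ⟨(hf3 h).1.smul c, fun k hk => ?_⟩, _, hu.smul c⟩
    · obtain ⟨C, hC⟩ := hf1 ε hε
      refine ⟨‖c‖ * C, fun z => ?_⟩
      rw [Pi.smul_apply, norm_smul, mul_assoc]
      exact mul_le_mul_of_nonneg_left (hC z) (norm_nonneg _)
    · have hk' : ((k : ℕ) : WithTop ℕ∞) ≤ (⌊s - 1 / 2⌋₊ : ℕ) := by exact_mod_cast hk
      have h1 := ((hf3 h).1.1.of_le hk').contDiffAt (x := 0)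
      have := iteratedDeriv_const_mul c h1
      simp only [Pi.smul_apply, smul_eq_mul]
      rw [this, (hf3 h).2 k hk, mul_zero]

/-! The Fourier basis of `L²(-b, b)`, where `a = 2πb`, is carried to `PW^s_a` by a linear bijection.
To `G ∈ L²(-b, b)` corresponds the entire function `fracSynth s b G`, the inverse Fourier integral
of `|2πξ|^{-s} G` with the kernel `exp (2πizξ)` replaced by its Taylor remainder of order `M =
taylorCount s`. This remainder vanishes to order `M > s - 1/2` at `ξ = 0`, which makes its product
with the singular weight square integrable there; it also vanishes to order `M` at `z = 0`, which is
the normalization built into `E^{s,2}`.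

Everything about `Δ^{s/2}` is read off from one identity: if `Δ^{s/2} f = u` and `G` is the
transform of `u`, then `∫ f ψ = ∫ G |2πξ|^{-s} 𝓕⁻ψ` for every Schwartz `ψ` with vanishing moments
(`IsFracLap.integral_mul_eq`). Conversely, for `f` integrable against Schwartz functions, the
identity characterizes `Δ^{s/2} f = u` (`isFracLap_of_integral_mul_eq`). Testing it on `ψ` whose
inverse transform is supported away from `0` determines `u`.

Synthesis lands in `PW^s_a`: for `s < 1/2` by a Sobolev inequality (`memLp_fracSynth`), for `s >
1/2` by Cauchy–Schwarz and scaling (`homLipschitz_fracSynth`). It is injective since `G` is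
recovered as the transform of `Δ^{s/2} f`. It is onto (`exists_eq_fracSynth`): Phragmén–Lindelöf and
Cauchy's theorem confine the spectrum of `Δ^{s/2} f` to `[-b, b]`, so `f` differs from the synthesis
of its own `G` by a polynomial of degree less than `M`, which the normalization at `0` kills.

By Plancherel the prescribed inner product is that of the functions `G`, so `PW^s_a` is complete.
The exponentials go to the `ψ_n` (`fracSynth_trigFun`), and the coefficients of `G` are, up to
`√(π/a)`, the values at `nπ/a` of its inverse transform, which is `Δ^{s/2} f`
(`isFracLapExt_fracSynth_iff`, `sqrt_mul_remTransform_zero`). Point evaluations are bounded locally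
uniformly (`norm_fracSynth_le`), so norm convergence implies uniform convergence on compact sets. -/

/-! ### Plancherel pairs of functions -/

/-- `u, G ∈ L²` and `G` is the (Plancherel) Fourier transform of `u`. -/
def L2FourierPair (u G : ℝ → ℂ) : Prop :=
  ∃ (hu : MemLp u 2 volume) (hG : MemLp G 2 volume),
    𝓕 (hu.toLp u : Lp ℂ 2 (volume : Measure ℝ)) = hG.toLp G

lemma fourierInv_bounded_continuous {h : ℝ → ℂ} (h1 : Integrable h) :
    Continuous (𝓕⁻ h) ∧ ∀ x, ‖𝓕⁻ h x‖ ≤ ∫ ξ, ‖h ξ‖ := by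
  refine ⟨VectorFourier.fourierIntegral_continuous Real.continuous_fourierChar (by fun_prop) h1,
    fun x => VectorFourier.norm_fourierIntegral_le_integral_norm _ _ _ h x⟩

lemma integral_fourierInv_mul_schwartz {h : ℝ → ℂ} (h1 : Integrable h) (ψ : 𝓢(ℝ, ℂ)) :
    ∫ x, 𝓕⁻ h x * ψ x = ∫ ξ, h ξ * 𝓕⁻ (ψ : ℝ → ℂ) ξ := by
  have := VectorFourier.integral_bilin_fourierIntegral_eq_flip (L := -innerₗ ℝ) (μ := volume)
    (ν := volume) (f := h) (g := ψ) (ContinuousLinearMap.mul ℂ ℂ) Real.continuous_fourierChar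
    (by simp; fun_prop) h1 ψ.integrable
  have hflip : (-innerₗ ℝ : ℝ →ₗ[ℝ] ℝ →ₗ[ℝ] ℝ).flip = -innerₗ ℝ := by
    ext; simp
  rw [hflip] at this
  exact this

/-- On `L¹ ∩ L²` the integral and the Plancherel inverse transform define the same tempered
distribution. Both are locally integrable, so testing against smooth functions of compact support
shows that they agree almost everywhere. -/
lemma L2FourierPair.fourierInv {h : ℝ → ℂ} (h1 : Integrable h) (h2 : MemLp h 2 volume) :
    L2FourierPair (𝓕⁻ h) h := by
  set v : Lp ℂ 2 (volume : Measure ℝ) := 𝓕⁻ (h2.toLp h) with hv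
  have hb := fourierInv_bounded_continuous h1
  have key : ∀ ψ : 𝓢(ℝ, ℂ), ∫ x, ψ x * v x = ∫ x, ψ x * 𝓕⁻ h x := by
    intro ψ
    have e := congrArg (fun T : 𝓢'(ℝ, ℂ) => T ψ)
      (Lp.fourierInv_toTemperedDistribution_eq (h2.toLp h))
    simp only [TemperedDistribution.fourierInv_apply, Lp.toTemperedDistribution_apply,
      smul_eq_mul, ← hv] at e
    rw [← e]
    simp_rw [mul_comm (ψ _)]
    rw [integral_fourierInv_mul_schwartz h1]
    refine integral_congr_ae ?_
    filter_upwards [h2.coeFn_toLp] with x hx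
    rw [hx, mul_comm, SchwartzMap.fourierInv_coe]
  have hloc : LocallyIntegrable (fun x => v x - 𝓕⁻ h x) :=
    ((Lp.memLp v).locallyIntegrable (by norm_num)).sub hb.1.locallyIntegrable
  have hz := ae_eq_zero_of_integral_contDiff_smul_eq_zero hloc fun g hg hgc => by
    have hg₁ : HasCompactSupport (Complex.ofRealCLM ∘ g) := hgc.comp_left rfl
    have hg₂ : ContDiff ℝ ∞ (Complex.ofRealCLM ∘ g) := by fun_prop
    have := key (hg₁.toSchwartzMap hg₂)
    have i1 : Integrable (fun x => (g x : ℂ) * v x) := by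
      have := ((Lp.memLp v).locallyIntegrable
        (by norm_num)).integrable_smul_left_of_hasCompactSupport hg.continuous hgc
      simpa using this
    have i2 : Integrable (fun x => (g x : ℂ) * 𝓕⁻ h x) := by
      have := (hb.1.locallyIntegrable (μ := volume)).integrable_smul_left_of_hasCompactSupport
        hg.continuous hgc
      simpa using this
    simp only [HasCompactSupport.toSchwartzMap_toFun, Function.comp_apply,
      Complex.ofRealCLM_apply] at this
    simp only [Complex.real_smul, mul_sub]
    rw [integral_sub i1 i2, this, sub_self]
  have hae : (v : ℝ → ℂ) =ᵐ[volume] 𝓕⁻ h := by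
    filter_upwards [hz] with x hx using sub_eq_zero.1 hx
  have hm : MemLp (𝓕⁻ h) 2 volume := (memLp_congr_ae hae).1 (Lp.memLp v)
  refine ⟨hm, h2, ?_⟩
  have : hm.toLp (𝓕⁻ h) = v := by
    rw [← Lp.toLp_coeFn v (Lp.memLp v)]
    exact (MemLp.toLp_eq_toLp_iff _ _).2 hae.symm
  rw [this, hv, FourierTransform.fourier_fourierInv_eq]

lemma MeasureTheory.MemLp.exists_fourier {u : ℝ → ℂ} (hu : MemLp u 2 volume) :
    ∃ G, L2FourierPair u G := by
  refine ⟨(𝓕 (hu.toLp u) : Lp ℂ 2 (volume : Measure ℝ)), hu, Lp.memLp _, ?_⟩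
  simp

lemma MeasureTheory.MemLp.exists_fourierInv {G : ℝ → ℂ} (hG : MemLp G 2 volume) :
    ∃ u, L2FourierPair u G := by
  refine ⟨(𝓕⁻ (hG.toLp G) : Lp ℂ 2 (volume : Measure ℝ)), Lp.memLp _, hG, ?_⟩
  simp

lemma L2FourierPair.sub {u v G H : ℝ → ℂ} (h : L2FourierPair u G) (h' : L2FourierPair v H) :
    L2FourierPair (fun x => u x - v x) (fun x => G x - H x) := by
  obtain ⟨hu, hG, e⟩ := h
  obtain ⟨hv, hH, e'⟩ := h'
  refine ⟨hu.sub hv, hG.sub hH, ?_⟩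
  have e1 : (hu.sub hv).toLp (fun x => u x - v x) = hu.toLp u - hv.toLp v := MemLp.toLp_sub hu hv
  have e2 : (hG.sub hH).toLp (fun x => G x - H x) = hG.toLp G - hH.toLp H := MemLp.toLp_sub hG hH
  rw [e1, e2, ← e, ← e']
  exact (Lp.fourierTransformₗᵢ ℝ ℂ).map_sub _ _

lemma L2FourierPair.eLpNorm_eq {u G : ℝ → ℂ} (h : L2FourierPair u G) :
    eLpNorm u 2 volume = eLpNorm G 2 volume := by
  obtain ⟨hu, hG, e⟩ := h
  have := Lp.norm_fourier_eq (hu.toLp u)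
  rw [e, Lp.norm_toLp, Lp.norm_toLp] at this
  exact ((ENNReal.toReal_eq_toReal_iff' hG.2.ne hu.2.ne).1 this).symm

lemma L2FourierPair.integral_conj_mul {u v G H : ℝ → ℂ} (h : L2FourierPair u G)
    (h' : L2FourierPair v H) :
    ∫ x, (starRingEnd ℂ) (u x) * v x = ∫ ξ, (starRingEnd ℂ) (G ξ) * H ξ := by
  obtain ⟨hu, hG, e⟩ := h
  obtain ⟨hv, hH, e'⟩ := h'
  have := Lp.inner_fourier_eq (hu.toLp u) (hv.toLp v)
  rw [e, e', L2.inner_def, L2.inner_def] at this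
  refine Eq.trans ?_ (this.symm.trans ?_)
  · refine integral_congr_ae ?_
    filter_upwards [hu.coeFn_toLp, hv.coeFn_toLp] with x h1 h2
    rw [h1, h2, RCLike.inner_apply, mul_comm]
  · refine integral_congr_ae ?_
    filter_upwards [hG.coeFn_toLp, hH.coeFn_toLp] with x h1 h2
    rw [h1, h2, RCLike.inner_apply, mul_comm]

lemma L2FourierPair.ae_eq_left {u v G : ℝ → ℂ} (h : L2FourierPair u G)
    (h' : L2FourierPair v G) : u =ᵐ[volume] v := by
  have := (h.sub h').eLpNorm_eq
  simp only [sub_self, eLpNorm_zero'] at this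
  rw [eLpNorm_eq_zero_iff (h.sub h').1.1 (by norm_num)] at this
  filter_upwards [this] with x hx using sub_eq_zero.1 hx

lemma L2FourierPair.congr_right {u G H : ℝ → ℂ} (h : L2FourierPair u G)
    (e : G =ᵐ[volume] H) : L2FourierPair u H := by
  obtain ⟨hu, hG, e'⟩ := h
  refine ⟨hu, (memLp_congr_ae e).1 hG, e'.trans ?_⟩
  exact (MemLp.toLp_eq_toLp_iff _ _).2 e

lemma L2FourierPair.congr_left {u v G : ℝ → ℂ} (h : L2FourierPair u G)
    (e : u =ᵐ[volume] v) : L2FourierPair v G := by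
  obtain ⟨hu, hG, e'⟩ := h
  refine ⟨(memLp_congr_ae e).1 hu, hG, e'.symm ▸ ?_⟩
  congr 1
  exact (MemLp.toLp_eq_toLp_iff _ _).2 e.symm

/-! ### Cauchy–Schwarz and limits of `L²` pairings -/

lemma enorm_integral_mul_le {α : Type*} [MeasurableSpace α] {μ : Measure α} {f g : α → ℂ}
    (hf : AEStronglyMeasurable f μ) (hg : AEStronglyMeasurable g μ) :
    ‖∫ x, f x * g x ∂μ‖ₑ ≤ eLpNorm f 2 μ * eLpNorm g 2 μ := by
  refine (enorm_integral_le_lintegral_enorm _).trans ?_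
  have := eLpNorm_smul_le_mul_eLpNorm (p := 2) (q := 2) (r := 1) hg hf
  rw [eLpNorm_one_eq_lintegral_enorm] at this
  exact this

lemma norm_integral_mul_le {α : Type*} [MeasurableSpace α] {μ : Measure α} {f g : α → ℂ}
    (hf : MemLp f 2 μ) (hg : MemLp g 2 μ) :
    ‖∫ x, f x * g x ∂μ‖ ≤ (eLpNorm f 2 μ).toReal * (eLpNorm g 2 μ).toReal := by
  rw [← ENNReal.toReal_mul, ← toReal_enorm]
  exact ENNReal.toReal_mono (ENNReal.mul_ne_top hf.2.ne hg.2.ne) (enorm_integral_mul_le hf.1 hg.1)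

lemma tendsto_integral_mul_of_tendsto_eLpNorm {α : Type*} [MeasurableSpace α] {μ : Measure α}
    {h : ℕ → α → ℂ} {G w : α → ℂ} (hh : ∀ n, MemLp (h n) 2 μ) (hG : MemLp G 2 μ)
    (hw : MemLp w 2 μ)
    (hlim : Tendsto (fun n => eLpNorm (fun x => h n x - G x) 2 μ) atTop (𝓝 0)) :
    Tendsto (fun n => ∫ x, h n x * w x ∂μ) atTop (𝓝 (∫ x, G x * w x ∂μ)) := by
  rw [tendsto_iff_edist_tendsto_0]
  have h0 : Tendsto (fun n => eLpNorm (fun x => h n x - G x) 2 μ * eLpNorm w 2 μ) atTop (𝓝 0) := by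
    simpa using ENNReal.Tendsto.mul_const hlim (Or.inr hw.2.ne)
  refine tendsto_of_tendsto_of_tendsto_of_le_of_le tendsto_const_nhds h0 (fun _ => zero_le)
    fun n => ?_
  rw [edist_eq_enorm_sub, ← integral_sub (f := fun x => h n x * w x) (g := fun x => G x * w x)
    ((hh n).integrable_mul hw) (hG.integrable_mul hw)]
  simp_rw [← sub_mul]
  exact enorm_integral_mul_le ((hh n).sub hG).1 hw.1

/-! ### Taylor remainders of the exponential and the singular weight -/

/-- The remainder of the exponential series of order `M`. -/
noncomputable def expRem (M : ℕ) (w : ℂ) : ℂ :=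
  Complex.exp w - ∑ j ∈ Finset.range M, w ^ j / (j.factorial : ℂ)

lemma norm_expRem_le (M : ℕ) (w : ℂ) : ‖expRem M w‖ ≤ ‖w‖ ^ M * Real.exp ‖w‖ :=
  Complex.norm_exp_sub_sum_le_norm_mul_exp w M

/-- On the imaginary axis the exponential has modulus one, so there is no exponential growth. The
constant `4` is `1 + 3`, where `3` bounds both `e` and the partial sums of its series. The resulting
polynomial growth on the real line is what permits pairing with Schwartz functions. -/
lemma norm_expRem_le_of_re_eq_zero (M : ℕ) {w : ℂ} (hw : w.re = 0) :
    ‖expRem M w‖ ≤ 4 * ‖w‖ ^ M := by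
  have he : Real.exp 1 ≤ 3 := by linarith [Real.exp_one_lt_d9]
  rcases le_total ‖w‖ 1 with h | h
  · refine (norm_expRem_le M w).trans ?_
    have : Real.exp ‖w‖ ≤ Real.exp 1 := Real.exp_le_exp.2 h
    rw [mul_comm]
    gcongr
    linarith
  · refine (norm_sub_le _ _).trans ?_
    have h1 : ‖Complex.exp w‖ = 1 := by rw [Complex.norm_exp, hw, Real.exp_zero]
    have h2 : ‖∑ j ∈ Finset.range M, w ^ j / (j.factorial : ℂ)‖ ≤ 3 * ‖w‖ ^ M := by
      refine (norm_sum_le _ _).trans ?_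
      have : ∀ j ∈ Finset.range M, ‖w ^ j / (j.factorial : ℂ)‖
          ≤ ‖w‖ ^ M * (1 ^ j / (j.factorial : ℝ)) := fun j hj => by
        rw [norm_div, norm_pow, Complex.norm_natCast, one_pow, mul_one_div]
        gcongr
        exact (Finset.mem_range.1 hj).le
      refine (Finset.sum_le_sum this).trans ?_
      rw [← Finset.mul_sum, mul_comm]
      gcongr
      exact (Real.sum_le_exp_of_nonneg zero_le_one M).trans he
    have h3 : 1 ≤ ‖w‖ ^ M := one_le_pow₀ h
    rw [h1]
    linarith

lemma continuous_expRem (M : ℕ) : Continuous (expRem M) := by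
  unfold expRem; fun_prop

/-- Equivalent to `2 (M - s) > -1`, that is, to the local integrability of `|ξ|^{2(M-s)}`. -/
lemma lt_taylorCount (s : ℝ) : s - 1 / 2 < taylorCount s := by
  have := Nat.lt_floor_add_one (s + 1 / 2)
  unfold taylorCount
  linarith

lemma integrableOn_abs_rpow {r : ℝ} (hr : -1 < r) (b : ℝ) :
    IntegrableOn (fun ξ : ℝ => |ξ| ^ r) (Set.Ioc (-b) b) := by
  refine IntegrableOn.mono_set (t := Metric.ball 0 (|b| + 1)) ?_ fun x hx => ?_
  · refine integrableOn_ball_of_norm_le_rpow (by simp) (C := 1) (α := -r) (by simp; linarith)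
      (Eventually.of_forall fun x => ?_) ?_
    · rw [neg_neg, one_mul, Real.norm_eq_abs, Real.norm_eq_abs, abs_of_nonneg (by positivity)]
    · exact (measurable_id.abs.pow_const r).aestronglyMeasurable
  · simp only [mem_ball_zero_iff, Real.norm_eq_abs]
    have := abs_le.2 ⟨hx.1.le, hx.2⟩
    linarith [le_abs_self b]

lemma measurable_abs_mul_rpow (c r : ℝ) : Measurable fun ξ : ℝ => ((|c * ξ| ^ r : ℝ) : ℂ) :=
  Complex.measurable_ofReal.comp ((measurable_id.const_mul c).abs.pow_const r)

/-- The subtracted Taylor polynomial of the kernel integrates to a combination of moments of `ψ`,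
all of them zero. -/
lemma fourierInv_eq_integral_expRem {s : ℝ} {ψ : 𝓢(ℝ, ℂ)} (hψ : VanishingMoments s ψ) (ξ : ℝ) :
    𝓕⁻ (ψ : ℝ → ℂ) ξ = ∫ x : ℝ, expRem (taylorCount s) (2 * Real.pi * Complex.I * x * ξ) * ψ x := by
  have hint : ∀ k : ℕ, Integrable fun x : ℝ => (x : ℂ) ^ k * ψ x := fun k => by
    refine (ψ.integrable_pow_mul volume k).mono' (by fun_prop) (Eventually.of_forall fun x => ?_)
    simp
  have h1 : Integrable fun x : ℝ => Complex.exp (2 * Real.pi * Complex.I * x * ξ) * ψ x := by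
    refine ψ.integrable.bdd_mul (c := 1) (by fun_prop) (Eventually.of_forall fun x => ?_)
    rw [Complex.norm_exp]
    simp
  have h2 : ∀ j ∈ Finset.range (taylorCount s), Integrable fun x : ℝ =>
      (2 * Real.pi * Complex.I * x * ξ) ^ j / (j.factorial : ℂ) * ψ x := fun j _ => by
    refine ((hint j).const_mul ((2 * Real.pi * Complex.I * ξ) ^ j / (j.factorial : ℂ))).congr
      (Eventually.of_forall fun x => ?_)
    simp only [mul_pow]
    ring
  have h3 : ∀ j ∈ Finset.range (taylorCount s), ∫ x : ℝ,
      (2 * Real.pi * Complex.I * x * ξ) ^ j / (j.factorial : ℂ) * ψ x = 0 := fun j hj => by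
    have := hψ j (Finset.mem_range.1 hj)
    calc _ = ∫ x : ℝ, (2 * Real.pi * Complex.I * ξ) ^ j / (j.factorial : ℂ) * ((x : ℂ) ^ j * ψ x) := by
          congr 1; funext x; simp only [mul_pow]; ring
      _ = 0 := by rw [integral_const_mul, this, mul_zero]
  simp only [expRem, sub_mul, Finset.sum_mul]
  rw [integral_sub h1 (integrable_finsetSum _ h2), integral_finsetSum _ h2,
    Finset.sum_eq_zero h3, sub_zero, Real.fourierInv_eq']
  congr 1
  funext x
  simp only [smul_eq_mul, RCLike.inner_apply, conj_trivial]
  congr 2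
  push_cast
  ring

lemma norm_fourierInv_le_of_vanishingMoments {s : ℝ} {ψ : 𝓢(ℝ, ℂ)} (hψ : VanishingMoments s ψ) :
    ∃ C, ∀ ξ, ‖𝓕⁻ (ψ : ℝ → ℂ) ξ‖ ≤ C * |ξ| ^ taylorCount s := by
  set M := taylorCount s with hM
  refine ⟨∫ x, 4 * (2 * Real.pi) ^ M * (‖x‖ ^ M * ‖ψ x‖), fun ξ => ?_⟩
  rw [fourierInv_eq_integral_expRem hψ, ← integral_mul_const]
  refine norm_integral_le_of_norm_le
    (((ψ.integrable_pow_mul volume M).const_mul _).mul_const _) (Eventually.of_forall fun x => ?_)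
  rw [norm_mul]
  have := norm_expRem_le_of_re_eq_zero M (w := 2 * Real.pi * Complex.I * x * ξ) (by simp)
  calc _ ≤ 4 * ‖(2 * Real.pi * Complex.I * x * ξ : ℂ)‖ ^ M * ‖ψ x‖ := by gcongr
    _ = _ := by
      simp only [norm_mul, Complex.norm_I, Complex.norm_real, Complex.norm_ofNat,
        Real.norm_eq_abs, abs_of_pos Real.pi_pos, mul_pow]
      ring

/-- Near `0` the zero of order `M` of `𝓕⁻ψ` leaves the square bounded by a multiple of
`|ξ|^{2(M-s)}`, which is integrable; for `|ξ| ≥ 1` the weight is at most one. This makes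
`fracPairing s G ψ` continuous in `G ∈ L²`. -/
lemma memLp_weight_mul_fourierInv {s : ℝ} (hs : 0 < s) {ψ : 𝓢(ℝ, ℂ)}
    (hψ : VanishingMoments s ψ) :
    MemLp (fun ξ : ℝ => ((|2 * Real.pi * ξ| ^ (-s) : ℝ) : ℂ) * 𝓕⁻ (ψ : ℝ → ℂ) ξ) 2 volume := by
  obtain ⟨C, hC⟩ := norm_fourierInv_le_of_vanishingMoments hψ
  set M := taylorCount s with hM
  have hMs := lt_taylorCount s
  have hcont : Continuous (𝓕⁻ (ψ : ℝ → ℂ)) := by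
    rw [← SchwartzMap.fourierInv_coe]; exact SchwartzMap.continuous _
  have hmeas := ((measurable_abs_mul_rpow (2 * Real.pi) (-s)).mul
    hcont.measurable).aestronglyMeasurable (μ := volume)
  have hL2 : Integrable fun ξ => ‖𝓕⁻ (ψ : ℝ → ℂ) ξ‖ ^ 2 := by
    rw [← SchwartzMap.fourierInv_coe]
    exact (memLp_two_iff_integrable_sq_norm ((SchwartzMap.continuous _).aestronglyMeasurable (μ := volume))).1
      (SchwartzMap.memLp _ 2 volume)
  have hsing : Integrable ((Set.Ioc (-1 : ℝ) 1).indicator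
      fun ξ => ((2 * Real.pi) ^ (-s) * C) ^ 2 * |ξ| ^ (2 * (M - s))) := by
    rw [integrable_indicator_iff measurableSet_Ioc]
    exact (integrableOn_abs_rpow (by linarith) 1).const_mul _
  refine (memLp_two_iff_integrable_sq_norm hmeas).2 ?_
  refine (hsing.add hL2).mono' (by fun_prop) (Eventually.of_forall fun ξ => ?_)
  have hw : 0 ≤ |2 * Real.pi * ξ| ^ (-s) := by positivity
  simp only [norm_pow, norm_norm, Pi.mul_apply, norm_mul, Complex.norm_real,
    Real.norm_of_nonneg hw, Pi.add_apply]
  rcases eq_or_ne ξ 0 with rfl | hξ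
  -- At the origin the weight takes the default value `0 ^ (-s) = 0`.
  · rw [mul_zero, abs_zero, Real.zero_rpow (by linarith)]
    have : 0 ≤ (Set.Ioc (-1 : ℝ) 1).indicator
      (fun ξ => ((2 * Real.pi) ^ (-s) * C) ^ 2 * |ξ| ^ (2 * (M - s))) 0 :=
      Set.indicator_nonneg (fun x _ => by positivity) _
    simp only [zero_mul, ne_eq, OfNat.ofNat_ne_zero, not_false_eq_true, zero_pow]
    positivity
  have hξ' : 0 < |ξ| := abs_pos.2 hξ
  have hpi := Real.pi_pos
  by_cases hmem : ξ ∈ Set.Ioc (-1 : ℝ) 1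
  · rw [Set.indicator_of_mem hmem]
    refine le_trans (b := ((2 * Real.pi) ^ (-s) * C) ^ 2 * |ξ| ^ (2 * (M - s))) ?_
      (le_add_of_nonneg_right (by positivity))
    have e : |ξ| ^ (2 * ((M : ℝ) - s)) = (|ξ| ^ (-s) * |ξ| ^ M) ^ 2 := by
      rw [← Real.rpow_natCast |ξ| M, ← Real.rpow_add hξ', ← Real.rpow_natCast, ← Real.rpow_mul hξ'.le]
      congr 1
      push_cast
      ring
    rw [e, ← mul_pow, abs_mul, abs_of_pos (by positivity : 0 < 2 * Real.pi),
      Real.mul_rpow (by positivity) hξ'.le]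
    refine pow_le_pow_left₀ (by positivity) ?_ 2
    calc _ ≤ (2 * Real.pi) ^ (-s) * |ξ| ^ (-s) * (C * |ξ| ^ M) :=
          mul_le_mul_of_nonneg_left (hC ξ) (by positivity)
      _ = _ := by ring
  · rw [Set.indicator_of_notMem hmem, zero_add]
    have h1 : 1 ≤ |ξ| := by
      by_contra! h
      rw [abs_lt] at h
      exact hmem ⟨h.1, h.2.le⟩
    have h2 : |2 * Real.pi * ξ| ^ (-s) ≤ 1 := by
      refine Real.rpow_le_one_of_one_le_of_nonpos ?_ (by linarith)
      rw [abs_mul, abs_of_pos (by positivity : 0 < 2 * Real.pi)]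
      nlinarith [Real.pi_gt_three]
    refine pow_le_pow_left₀ (by positivity) ?_ 2
    exact mul_le_of_le_one_left (norm_nonneg _) h2

/-! ### The fractional Laplacian through its pairing with test functions -/

/-- The pairing `∫ G |2πξ|^{-s} 𝓕⁻ψ`, by which a function with `|2πξ|^s 𝓕f = G` acts on the
Schwartz functions with vanishing moments. -/
noncomputable def fracPairing (s : ℝ) (G : ℝ → ℂ) (ψ : 𝓢(ℝ, ℂ)) : ℂ :=
  ∫ ξ, G ξ * (((|2 * Real.pi * ξ| ^ (-s) : ℝ) : ℂ) * 𝓕⁻ (ψ : ℝ → ℂ) ξ)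

lemma ae_ne_zero_real : ∀ᵐ ξ : ℝ, ξ ≠ 0 := by
  simp [ae_iff]

lemma rpow_mul_rpow_neg_two_pi {ξ : ℝ} (s : ℝ) (hξ : ξ ≠ 0) :
    ((|2 * Real.pi * ξ| ^ s : ℝ) : ℂ) * ((|2 * Real.pi * ξ| ^ (-s) : ℝ) : ℂ) = 1 := by
  have : 0 < |2 * Real.pi * ξ| := abs_pos.2 (by have := Real.pi_ne_zero; positivity)
  rw [← Complex.ofReal_mul, ← Real.rpow_add this, add_neg_cancel, Real.rpow_zero,
    Complex.ofReal_one]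

/-- The square is at most a bound for `𝓕 φ` times `|2πξ|^{2s} |𝓕 φ|`, which is integrable as the
case of exponent `2s`. -/
lemma memLp_rpow_mul_fourier {s : ℝ} (hs : 0 < s) (φ : 𝓢(ℝ, ℂ)) :
    MemLp (fun ξ : ℝ => ((|2 * Real.pi * ξ| ^ s : ℝ) : ℂ) * 𝓕 (φ : ℝ → ℂ) ξ) 2 volume := by
  have h1 := schwartzFracLap_integrable (by positivity : 0 ≤ 2 * s) φ
  have hb : ∀ ξ, ‖𝓕 (φ : ℝ → ℂ) ξ‖ ≤ SchwartzMap.seminorm ℝ 0 0 (𝓕 φ) := fun ξ =>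
    SchwartzMap.norm_le_seminorm ℝ (𝓕 φ) ξ
  have hcont : Continuous (𝓕 (φ : ℝ → ℂ)) := (𝓕 φ).continuous
  refine (memLp_two_iff_integrable_sq_norm ?_).2 ?_
  · exact (schwartzFracLap_integrable hs.le φ).1
  · refine (h1.norm.const_mul (SchwartzMap.seminorm ℝ 0 0 (𝓕 φ))).mono'
      (((schwartzFracLap_integrable hs.le φ).1.norm).pow 2) (Eventually.of_forall fun ξ => ?_)
    have e : |2 * Real.pi * ξ| ^ (2 * s) = (|2 * Real.pi * ξ| ^ s) ^ 2 := by
      rw [mul_comm 2 s, Real.rpow_mul (abs_nonneg _), Real.rpow_two]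
    simp only [norm_pow, norm_mul, Complex.norm_real, Real.norm_eq_abs, e]
    rw [abs_of_nonneg (by positivity : 0 ≤ |2 * Real.pi * ξ| ^ s), abs_norm,
      mul_pow, sq_abs]
    nlinarith [mul_le_mul_of_nonneg_left (hb ξ)
      (by positivity : 0 ≤ (|2 * Real.pi * ξ| ^ s) ^ 2 * ‖𝓕 (φ : ℝ → ℂ) ξ‖)]

lemma schwartzFracLap_pair {s : ℝ} (hs : 0 < s) (φ : 𝓢(ℝ, ℂ)) :
    L2FourierPair (schwartzFracLap s φ)
      (fun ξ : ℝ => ((|2 * Real.pi * ξ| ^ s : ℝ) : ℂ) * 𝓕 (φ : ℝ → ℂ) ξ) :=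
  .fourierInv (schwartzFracLap_integrable hs.le φ) (memLp_rpow_mul_fourier hs φ)

lemma integral_schwartz_mul_eq_fracPairing (s : ℝ) (φ ψ : 𝓢(ℝ, ℂ)) :
    ∫ x, φ x * ψ x
      = fracPairing s (fun ξ => ((|2 * Real.pi * ξ| ^ s : ℝ) : ℂ) * 𝓕 (φ : ℝ → ℂ) ξ) ψ := by
  have h := SchwartzMap.integral_fourier_mul_eq φ (𝓕⁻ ψ)
  rw [FourierTransform.fourier_fourierInv_eq] at h
  rw [← h]
  refine integral_congr_ae ?_
  filter_upwards [ae_ne_zero_real] with ξ hξ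
  rw [SchwartzMap.fourierInv_coe, SchwartzMap.fourier_coe]
  linear_combination (-(𝓕 (φ : ℝ → ℂ) ξ * 𝓕⁻ (ψ : ℝ → ℂ) ξ)) * rpow_mul_rpow_neg_two_pi s hξ

lemma tendsto_fracPairing {s : ℝ} (hs : 0 < s) {h : ℕ → ℝ → ℂ} {G : ℝ → ℂ}
    (hh : ∀ n, MemLp (h n) 2 volume) (hG : MemLp G 2 volume)
    (hlim : Tendsto (fun n => eLpNorm (fun x => h n x - G x) 2 volume) atTop (𝓝 0))
    {ψ : 𝓢(ℝ, ℂ)} (hψ : VanishingMoments s ψ) :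
    Tendsto (fun n => fracPairing s (h n) ψ) atTop (𝓝 (fracPairing s G ψ)) :=
  tendsto_integral_mul_of_tendsto_eLpNorm hh hG (memLp_weight_mul_fourierInv hs hψ) hlim

/-- The identity holds for Schwartz functions, where the two weights cancel off the null set `{0}`.
Plancherel turns the `L²` convergence of `Δ^{s/2} φ_n` into convergence of the weighted transforms,
and the pairing is continuous in these. -/
lemma IsFracLap.integral_mul_eq {s : ℝ} (hs : 0 < s) {f u G : ℝ → ℂ} (h : IsFracLap s f u)
    (hG : L2FourierPair u G) {ψ : 𝓢(ℝ, ℂ)} (hψ : VanishingMoments s ψ) :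
    ∫ x, f x * ψ x = fracPairing s G ψ := by
  obtain ⟨hu, -, φ, hφ, hlim⟩ := h
  refine tendsto_nhds_unique (hφ ψ hψ) ?_
  simp_rw [integral_schwartz_mul_eq_fracPairing s]
  refine tendsto_fracPairing hs (fun n => memLp_rpow_mul_fourier hs _) hG.2.1 ?_ hψ
  refine hlim.congr fun n => ?_
  exact ((schwartzFracLap_pair hs (φ n)).sub hG).eLpNorm_eq

lemma contDiff_weight_mul {s : ℝ} {χ : ℝ → ℂ} (hχ : ContDiff ℝ ∞ χ)
    (h0 : (0 : ℝ) ∉ tsupport χ) :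
    ContDiff ℝ ∞ fun ξ : ℝ => ((|2 * Real.pi * ξ| ^ (-s) : ℝ) : ℂ) * χ ξ := by
  rw [contDiff_iff_contDiffAt]
  intro ξ
  rcases eq_or_ne ξ 0 with rfl | hξ
  · have : (fun ξ : ℝ => ((|2 * Real.pi * ξ| ^ (-s) : ℝ) : ℂ) * χ ξ) =ᶠ[𝓝 0] fun _ => 0 := by
      filter_upwards [(isClosed_tsupport χ).isOpen_compl.mem_nhds h0] with x hx
      rw [image_eq_zero_of_notMem_tsupport hx, mul_zero]
    exact contDiffAt_const.congr_of_eventuallyEq this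
  · have hne : 2 * Real.pi * ξ ≠ 0 := by have := Real.pi_ne_zero; positivity
    refine ContDiffAt.mul ?_ hχ.contDiffAt
    refine Complex.ofRealCLM.contDiff.contDiffAt.comp ξ ?_
    refine ContDiffAt.rpow_const_of_ne ?_ (abs_ne_zero.2 hne)
    exact (contDiffAt_abs hne).comp ξ (by fun_prop)

/-! ### Approximation by spectra away from the origin -/

/-- The `L²` classes of smooth functions with compact support in the complement of `0`. -/
def smoothPuncturedL2 : Submodule ℂ (Lp ℂ 2 (volume : Measure ℝ)) where
  carrier := {v | ∃ χ : ℝ → ℂ, ContDiff ℝ ∞ χ ∧ HasCompactSupport χ ∧ (0 : ℝ) ∉ tsupport χ ∧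
    v =ᵐ[volume] χ}
  zero_mem' := ⟨fun _ => 0, contDiff_const, HasCompactSupport.zero, by
    simp [tsupport], Lp.coeFn_zero _ _ _⟩
  add_mem' := by
    rintro v w ⟨χ, h1, h2, h3, h4⟩ ⟨η, k1, k2, k3, k4⟩
    refine ⟨χ + η, h1.add k1, h2.add k2, fun h => ?_, (Lp.coeFn_add v w).trans (h4.add k4)⟩
    rcases tsupport_add χ η h with h | h
    exacts [h3 h, k3 h]
  smul_mem' := by
    rintro c v ⟨χ, h1, h2, h3, h4⟩
    refine ⟨c • χ, contDiff_const.smul h1, h2.smul_left (f := fun _ => c), fun h => ?_,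
      (Lp.coeFn_smul c v).trans (h4.const_smul c)⟩
    exact h3 (closure_mono (Function.support_const_smul_subset c χ) h)

/-- An element orthogonal to all these functions vanishes almost everywhere on the complement of
`0`, and a point is a null set. -/
lemma topologicalClosure_smoothPuncturedL2 : smoothPuncturedL2.topologicalClosure = ⊤ := by
  rw [Submodule.topologicalClosure_eq_top_iff, Submodule.eq_bot_iff]
  intro v hv
  rw [Submodule.mem_orthogonal] at hv
  have hz := IsOpen.ae_eq_zero_of_integral_contDiff_smul_eq_zero (f := (v : ℝ → ℂ))
    (μ := volume) (isOpen_compl_singleton (x := (0 : ℝ)))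
    (((Lp.memLp v).locallyIntegrable (by norm_num)).locallyIntegrableOn _) fun g hg hgc hgs => by
      have hg₁ : HasCompactSupport (Complex.ofRealCLM ∘ g) := hgc.comp_left rfl
      have hg₂ : ContDiff ℝ ∞ (Complex.ofRealCLM ∘ g) := by fun_prop
      have hL : MemLp (Complex.ofRealCLM ∘ g) 2 volume :=
        hg₂.continuous.memLp_of_hasCompactSupport hg₁
      have hsupp : (0 : ℝ) ∉ tsupport (Complex.ofRealCLM ∘ g) := fun h =>
        hgs (closure_mono (Function.support_comp_subset (by simp) g) h) rfl
      have := hv (hL.toLp _) ⟨_, hg₂, hg₁, hsupp, hL.coeFn_toLp⟩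
      rw [L2.inner_def] at this
      rw [← this]
      refine integral_congr_ae ?_
      filter_upwards [hL.coeFn_toLp] with x hx
      rw [hx, RCLike.inner_apply]
      simp [mul_comm]
  refine (Lp.eq_zero_iff_ae_eq_zero).2 ?_
  filter_upwards [hz, ae_ne_zero_real] with x hx h0 using hx h0

lemma MeasureTheory.MemLp.exists_smooth_punctured_approx {G : ℝ → ℂ} (hG : MemLp G 2 volume) :
    ∃ χ : ℕ → ℝ → ℂ, (∀ n, ContDiff ℝ ∞ (χ n) ∧ HasCompactSupport (χ n) ∧
      (0 : ℝ) ∉ tsupport (χ n)) ∧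
      Tendsto (fun n => eLpNorm (fun x => χ n x - G x) 2 volume) atTop (𝓝 0) := by
  have hmem : hG.toLp G ∈ smoothPuncturedL2.topologicalClosure := by
    rw [topologicalClosure_smoothPuncturedL2]; trivial
  rw [← SetLike.mem_coe, Submodule.topologicalClosure_coe, mem_closure_iff_seq_limit] at hmem
  obtain ⟨v, hv, hlim⟩ := hmem
  choose χ h1 h2 h3 h4 using hv
  refine ⟨χ, fun n => ⟨h1 n, h2 n, h3 n⟩, ?_⟩
  rw [tendsto_iff_edist_tendsto_0] at hlim
  refine hlim.congr fun n => ?_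
  rw [Lp.edist_def]
  refine eLpNorm_congr_ae ?_
  filter_upwards [h4 n, hG.coeFn_toLp] with x hx hx'
  simp [hx, hx']

/-- The approximating Schwartz functions are built on the Fourier side: `G` is approximated in `L²`
by smooth `χ_n` of compact support away from `0`, where division by `|2πξ|^s` keeps them smooth.
Convergence modulo polynomials then follows from continuity of the pairing. -/
lemma isFracLap_of_integral_mul_eq {s : ℝ} (hs : 0 < s) {f u G : ℝ → ℂ} (hG : L2FourierPair u G)
    (hint : ∀ ψ : 𝓢(ℝ, ℂ), Integrable (fun x => f x * ψ x))
    (hf : ∀ ψ : 𝓢(ℝ, ℂ), VanishingMoments s ψ → ∫ x, f x * ψ x = fracPairing s G ψ) :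
    IsFracLap s f u := by
  obtain ⟨χ, hχ, hlim⟩ := hG.2.1.exists_smooth_punctured_approx
  choose c1 c2 c3 using hχ
  let η : ℕ → 𝓢(ℝ, ℂ) := fun n =>
    (HasCompactSupport.mul_left (f := fun ξ : ℝ => ((|2 * Real.pi * ξ| ^ (-s) : ℝ) : ℂ))
      (c2 n)).toSchwartzMap (contDiff_weight_mul (s := s) (c1 n) (c3 n))
  have hη : ∀ n, (fun ξ : ℝ => ((|2 * Real.pi * ξ| ^ s : ℝ) : ℂ)
      * 𝓕 ((𝓕⁻ (η n) : 𝓢(ℝ, ℂ)) : ℝ → ℂ) ξ) =ᵐ[volume] χ n := fun n => by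
    filter_upwards [ae_ne_zero_real] with ξ hξ
    rw [← SchwartzMap.fourier_coe, FourierTransform.fourier_fourierInv_eq]
    change _ * (_ * χ n ξ) = _
    rw [← mul_assoc, rpow_mul_rpow_neg_two_pi s hξ, one_mul]
  have hL : ∀ n, MemLp (χ n) 2 volume := fun n =>
    (c1 n).continuous.memLp_of_hasCompactSupport (c2 n)
  refine ⟨hG.1, hint, fun n => 𝓕⁻ (η n), fun ψ hψ => ?_, ?_⟩
  · rw [hf ψ hψ]
    simp_rw [integral_schwartz_mul_eq_fracPairing s]
    refine tendsto_fracPairing hs (fun n => memLp_rpow_mul_fourier hs _) hG.2.1 ?_ hψ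
    refine hlim.congr fun n => eLpNorm_congr_ae ?_
    filter_upwards [hη n] with x hx
    rw [hx]
  · refine hlim.congr fun n => ?_
    exact ((((schwartzFracLap_pair hs (𝓕⁻ (η n))).congr_right (hη n)).sub hG).eLpNorm_eq).symm

/-! ### Uniqueness of the fractional Laplacian and polynomial ambiguity -/

/-- Up to constants, the moments of `𝓕 χ` are the derivatives of `χ` at `0`. The induction passes
from `χ` to its derivative, whose support is no larger. -/
lemma integral_pow_mul_fourier_eq_zero (k : ℕ) :
    ∀ χ : 𝓢(ℝ, ℂ), (0 : ℝ) ∉ tsupport (χ : ℝ → ℂ) →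
      ∫ x : ℝ, (x : ℂ) ^ k * 𝓕 (χ : ℝ → ℂ) x = 0 := by
  induction k with
  | zero =>
    intro χ h0
    have h : 𝓕⁻ (𝓕 χ) = χ := FourierTransform.fourierInv_fourier_eq χ
    have h' := congrArg (fun η : 𝓢(ℝ, ℂ) => η 0) h
    simp only [SchwartzMap.fourierInv_coe, SchwartzMap.fourier_coe] at h'
    rw [Real.fourierInv_eq', image_eq_zero_of_notMem_tsupport h0] at h'
    simpa using h'
  | succ k ih =>
    intro χ h0
    have h := ih (SchwartzMap.derivCLM ℝ ℂ χ) fun h => h0 (tsupport_deriv_subset h)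
    have e : ((SchwartzMap.derivCLM ℝ ℂ χ : 𝓢(ℝ, ℂ)) : ℝ → ℂ) = deriv χ := by
      funext x; simp
    rw [e, Real.fourier_deriv χ.integrable χ.differentiable
      (by rw [← e]; exact SchwartzMap.integrable _)] at h
    have h2 : (2 * Real.pi * Complex.I : ℂ) ≠ 0 := by
      simp [Real.pi_ne_zero]
    refine (mul_eq_zero.1 ((integral_const_mul (2 * Real.pi * Complex.I : ℂ) _).symm.trans
      (Eq.trans ?_ h))).resolve_left h2
    congr 1
    funext x
    simp only [smul_eq_mul, pow_succ]
    ring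

lemma vanishingMoments_fourier (s : ℝ) {χ : 𝓢(ℝ, ℂ)} (h0 : (0 : ℝ) ∉ tsupport (χ : ℝ → ℂ)) :
    VanishingMoments s (𝓕 χ) := fun k _ => integral_pow_mul_fourier_eq_zero k χ h0

/-- On `ψ = 𝓕 χ` the pairing is `∫ G |2πξ|^{-s} χ`, so it sees `G` locally, and the weight has no
zero on `U`. Used with `U` the complement of `0` for uniqueness, and with half-lines for the
location of the spectrum. -/
lemma ae_eq_zero_of_fracPairing_fourier {s : ℝ} {G : ℝ → ℂ} (hG : MemLp G 2 volume)
    {U : Set ℝ} (hU : IsOpen U) (h0 : (0 : ℝ) ∉ U)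
    (h : ∀ χ : 𝓢(ℝ, ℂ), HasCompactSupport (χ : ℝ → ℂ) → tsupport (χ : ℝ → ℂ) ⊆ U →
      fracPairing s G (𝓕 χ) = 0) :
    ∀ᵐ ξ, ξ ∈ U → G ξ = 0 := by
  have hloc : LocallyIntegrableOn
      (fun ξ : ℝ => ((|2 * Real.pi * ξ| ^ (-s) : ℝ) : ℂ) * G ξ) U volume := by
    refine ((hG.locallyIntegrable (by norm_num)).locallyIntegrableOn U).continuousOn_mul ?_
      hU.isLocallyClosed
    refine Complex.continuous_ofReal.comp_continuousOn (ContinuousOn.rpow_const (by fun_prop) ?_)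
    intro x hx
    have : x ≠ 0 := fun h => h0 (h ▸ hx)
    exact Or.inl (abs_ne_zero.2 (by have := Real.pi_ne_zero; positivity))
  have hz := hU.ae_eq_zero_of_integral_contDiff_smul_eq_zero hloc fun g hg hgc hgs => by
    have hg₁ : HasCompactSupport (Complex.ofRealCLM ∘ g) := hgc.comp_left rfl
    have hg₂ : ContDiff ℝ ∞ (Complex.ofRealCLM ∘ g) := by fun_prop
    have hs : tsupport (Complex.ofRealCLM ∘ g) ⊆ U :=
      (closure_mono (Function.support_comp_subset (by simp) g)).trans hgs
    have := h (hg₁.toSchwartzMap hg₂) hg₁ hs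
    rw [← this, fracPairing]
    congr 1
    funext ξ
    rw [← SchwartzMap.fourierInv_coe, FourierTransform.fourierInv_fourier_eq]
    simp
    ring
  filter_upwards [hz] with ξ hξ hU'
  refine (mul_eq_zero.1 (hξ hU')).resolve_left ?_
  have hne : ξ ≠ 0 := fun h => h0 (h ▸ hU')
  exact right_ne_zero_of_mul (ne_of_eq_of_ne (rpow_mul_rpow_neg_two_pi s hne) one_ne_zero)

lemma fracPairing_sub {s : ℝ} (hs : 0 < s) {G H : ℝ → ℂ} (hG : MemLp G 2 volume)
    (hH : MemLp H 2 volume) {ψ : 𝓢(ℝ, ℂ)} (hψ : VanishingMoments s ψ) :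
    fracPairing s (fun ξ => G ξ - H ξ) ψ = fracPairing s G ψ - fracPairing s H ψ := by
  have hw := memLp_weight_mul_fourierInv hs hψ
  unfold fracPairing
  rw [← integral_sub (f := fun ξ => G ξ * _) (g := fun ξ => H ξ * _)
    (hG.integrable_mul hw) (hH.integrable_mul hw)]
  simp only [sub_mul]

/-- The fractional Laplacian of a function is unique. -/
lemma IsFracLap.fourier_unique {s : ℝ} (hs : 0 < s) {f u v G H : ℝ → ℂ} (hu : IsFracLap s f u)
    (hv : IsFracLap s f v) (hG : L2FourierPair u G) (hH : L2FourierPair v H) :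
    G =ᵐ[volume] H := by
  have := ae_eq_zero_of_fracPairing_fourier (s := s) (hG.2.1.sub hH.2.1)
    (isOpen_compl_singleton (x := (0 : ℝ))) (by simp) fun χ _ hχ => by
      have hψ : VanishingMoments s (𝓕 χ) := vanishingMoments_fourier s fun h => hχ h rfl
      refine (fracPairing_sub hs hG.2.1 hH.2.1 hψ).trans ?_
      rw [← hu.integral_mul_eq hs hG hψ, ← hv.integral_mul_eq hs hH hψ, sub_self]
  filter_upwards [this, ae_ne_zero_real] with ξ h1 h2
  exact sub_eq_zero.1 (h1 h2)

lemma IsFracLap.unique {s : ℝ} (hs : 0 < s) {f u v : ℝ → ℂ} (hu : IsFracLap s f u)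
    (hv : IsFracLap s f v) : u =ᵐ[volume] v := by
  obtain ⟨G, hG⟩ := hu.1.exists_fourier
  obtain ⟨H, hH⟩ := hv.1.exists_fourier
  exact hG.ae_eq_left (hH.congr_right (hu.fourier_unique hs hv hG hH).symm)

/-- A function annihilating all Schwartz functions with vanishing moments is a polynomial. -/
lemma exists_polynomial_of_integral_mul_eq_zero {s : ℝ} {f : ℝ → ℂ} (hf : Continuous f)
    (hint : ∀ ψ : 𝓢(ℝ, ℂ), Integrable (fun x => f x * ψ x))
    (h : ∀ ψ : 𝓢(ℝ, ℂ), VanishingMoments s ψ → ∫ x, f x * ψ x = 0) :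
    ∃ c : ℕ → ℂ, ∀ x, f x = ∑ k ∈ Finset.range (taylorCount s), c k * (x : ℂ) ^ k := by
  have hpow : ∀ (k : ℕ) (ψ : 𝓢(ℝ, ℂ)), Integrable fun x : ℝ => (x : ℂ) ^ k * ψ x := fun k ψ => by
    refine (ψ.integrable_pow_mul volume k).mono' (by fun_prop) (Eventually.of_forall fun x => ?_)
    simp
  let K : 𝓢(ℝ, ℂ) →ₗ[ℂ] ℂ :=
    { toFun := fun ψ => ∫ x, f x * ψ x
      map_add' := fun ψ η => by
        simp only [add_apply, mul_add]
        exact integral_add (hint ψ) (hint η)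
      map_smul' := fun c ψ => by
        simp only [smul_apply, smul_eq_mul, RingHom.id_apply, mul_left_comm _ c]
        exact integral_const_mul c _ }
  let L : Fin (taylorCount s) → 𝓢(ℝ, ℂ) →ₗ[ℂ] ℂ := fun k =>
    { toFun := fun ψ => ∫ x : ℝ, (x : ℂ) ^ (k : ℕ) * ψ x
      map_add' := fun ψ η => by
        simp only [add_apply, mul_add]
        exact integral_add (hpow k ψ) (hpow k η)
      map_smul' := fun c ψ => by
        simp only [smul_apply, smul_eq_mul, RingHom.id_apply, mul_left_comm _ c]
        exact integral_const_mul c _ }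
  -- A linear functional vanishing on the common kernel of finitely many others is a combination of
  -- them; no continuity is needed.
  have hK : K ∈ Submodule.span ℂ (Set.range L) := by
    refine mem_span_of_iInf_ker_le_ker fun ψ hψ => ?_
    rw [Submodule.mem_iInf] at hψ
    exact h ψ fun k hk => hψ ⟨k, hk⟩
  obtain ⟨c, hc⟩ := (Submodule.mem_span_range_iff_exists_fun ℂ).1 hK
  refine ⟨fun k => if hk : k < taylorCount s then c ⟨k, hk⟩ else 0, ?_⟩
  set p : ℝ → ℂ := fun x => ∑ k ∈ Finset.range (taylorCount s),
    (if hk : k < taylorCount s then c ⟨k, hk⟩ else 0) * (x : ℂ) ^ k with hp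
  have hpF : ∀ x, p x = ∑ k : Fin (taylorCount s), c k * (x : ℂ) ^ (k : ℕ) := fun x => by
    rw [hp]
    simp only
    rw [Finset.sum_range]
    exact Finset.sum_congr rfl fun k _ => by rw [dif_pos k.2]
  have hpc : Continuous p := by
    rw [hp]; fun_prop
  have key : ∀ ψ : 𝓢(ℝ, ℂ), ∫ x, (f x - p x) * ψ x = 0 := fun ψ => by
    have e := congrArg (fun T : 𝓢(ℝ, ℂ) →ₗ[ℂ] ℂ => T ψ) hc
    simp only [LinearMap.sum_apply, LinearMap.smul_apply, smul_eq_mul] at e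
    have i1 : ∀ k ∈ Finset.univ, Integrable fun x : ℝ =>
        c k * ((x : ℂ) ^ (k : ℕ) * ψ x) := fun k _ => (hpow k ψ).const_mul _
    have e2 : ∫ x, p x * ψ x = K ψ := by
      rw [← e]
      simp only [hpF, Finset.sum_mul, mul_assoc]
      rw [integral_finsetSum _ i1]
      exact Finset.sum_congr rfl fun k _ => integral_const_mul _ _
    have i2 : Integrable fun x => p x * ψ x := by
      simp only [hpF, Finset.sum_mul, mul_assoc]
      exact integrable_finsetSum _ i1
    simp only [sub_mul]
    rw [integral_sub (hint ψ) i2, e2]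
    exact sub_self _
  have hae := ae_eq_zero_of_integral_contDiff_smul_eq_zero (μ := (volume : Measure ℝ))
    (f := fun x => f x - p x) (hf.sub hpc).locallyIntegrable fun g hg hgc => by
      have hg₁ : HasCompactSupport (Complex.ofRealCLM ∘ g) := hgc.comp_left rfl
      have hg₂ : ContDiff ℝ ∞ (Complex.ofRealCLM ∘ g) := by fun_prop
      rw [← key (hg₁.toSchwartzMap hg₂)]
      simp [mul_comm]
  have := (Continuous.ae_eq_iff_eq volume (hf.sub hpc) continuous_const).1 hae
  exact fun x => sub_eq_zero.1 (congrFun this x)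

/-! ### Fourier integrals whose kernel is a Taylor remainder -/

/-- The subtraction is truncated, so the formula includes `M = 0`: `expRem 0` is the exponential,
its own derivative. -/
lemma hasDerivAt_expRem (M : ℕ) (w : ℂ) : HasDerivAt (expRem M) (expRem (M - 1) w) w := by
  unfold expRem
  refine (Complex.hasDerivAt_exp w).sub ?_
  cases M with
  | zero => simpa using hasDerivAt_const w (0 : ℂ)
  | succ n =>
    have h : ∀ j ∈ Finset.range (n + 1), HasDerivAt (fun w : ℂ => w ^ j / (j.factorial : ℂ))
        (j * w ^ (j - 1) / (j.factorial : ℂ)) w := fun j _ => (hasDerivAt_pow j w).div_const _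
    have h2 := HasDerivAt.fun_sum h
    rw [Finset.sum_range_succ'] at h2
    simp only [Nat.cast_zero, zero_mul, zero_div, add_zero, Nat.add_sub_cancel] at h2
    convert h2 using 1
    refine Finset.sum_congr rfl fun j _ => ?_
    rw [Nat.factorial_succ]
    have : ((j : ℂ) + 1) ≠ 0 := by exact_mod_cast Nat.succ_ne_zero j
    have h3 : (j.factorial : ℂ) ≠ 0 := by exact_mod_cast j.factorial_ne_zero
    push_cast
    field_simp

/-- The inverse Fourier integral of a function `H` on `(-b, b]`, with the kernel replaced by its
Taylor remainder of order `M`. -/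
noncomputable def remTransform (b : ℝ) (M : ℕ) (H : ℝ → ℂ) (z : ℂ) : ℂ :=
  ∫ ξ in Set.Ioc (-b) b, expRem M (2 * Real.pi * Complex.I * z * ξ) * H ξ

section remTransform

lemma norm_two_pi_I_mul (z : ℂ) (ξ : ℝ) :
    ‖(2 * Real.pi * Complex.I * z * ξ : ℂ)‖ = 2 * Real.pi * ‖z‖ * |ξ| := by
  simp [abs_of_pos Real.pi_pos]

/-- The zero of the kernel at `ξ = 0` is kept as a factor `ξ ^ M` on `H`, so that only `ξ ^ M * H ξ`
needs to be integrable, not `H`. -/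
lemma norm_expRem_mul_le (b : ℝ) (M : ℕ) (H : ℝ → ℂ) (z : ℂ) {ξ : ℝ}
    (hξ : ξ ∈ Set.Ioc (-b) b) :
    ‖expRem M (2 * Real.pi * Complex.I * z * ξ) * H ξ‖
      ≤ (2 * Real.pi * ‖z‖) ^ M * Real.exp (2 * Real.pi * b * ‖z‖) * ‖(ξ : ℂ) ^ M * H ξ‖ := by
  have hpi := Real.pi_pos
  have hb : |ξ| ≤ b := abs_le.2 ⟨hξ.1.le, hξ.2⟩
  rw [norm_mul, norm_mul, norm_pow, Complex.norm_real, Real.norm_eq_abs]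
  have := norm_expRem_le M (2 * Real.pi * Complex.I * z * ξ)
  rw [norm_two_pi_I_mul, mul_pow] at this
  have h2 : Real.exp (2 * Real.pi * ‖z‖ * |ξ|) ≤ Real.exp (2 * Real.pi * b * ‖z‖) := by
    refine Real.exp_le_exp.2 ?_
    have : 2 * Real.pi * ‖z‖ * |ξ| ≤ 2 * Real.pi * ‖z‖ * b := by gcongr
    linarith
  calc _ ≤ ((2 * Real.pi * ‖z‖) ^ M * |ξ| ^ M * Real.exp (2 * Real.pi * b * ‖z‖)) * ‖H ξ‖ := by
        refine mul_le_mul_of_nonneg_right (this.trans ?_) (norm_nonneg _)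
        gcongr
    _ = _ := by ring

variable {b : ℝ} {M : ℕ} {H : ℝ → ℂ}
  (hm : AEStronglyMeasurable H (volume.restrict (Set.Ioc (-b) b)))
  (hH : IntegrableOn (fun ξ : ℝ => (ξ : ℂ) ^ M * H ξ) (Set.Ioc (-b) b))

include hm in
lemma aestronglyMeasurable_expRem_mul (N : ℕ) (z : ℂ) :
    AEStronglyMeasurable (fun ξ : ℝ => expRem N (2 * Real.pi * Complex.I * z * ξ) * H ξ)
      (volume.restrict (Set.Ioc (-b) b)) :=
  (((continuous_expRem N).comp (by fun_prop)).aestronglyMeasurable).mul hm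

include hm hH in
lemma integrableOn_expRem_mul (z : ℂ) :
    IntegrableOn (fun ξ : ℝ => expRem M (2 * Real.pi * Complex.I * z * ξ) * H ξ)
      (Set.Ioc (-b) b) := by
  refine (hH.norm.const_mul _).mono' (aestronglyMeasurable_expRem_mul hm M z)
    ((ae_restrict_mem measurableSet_Ioc).mono fun ξ hξ => norm_expRem_mul_le b M H z hξ)

include hH in
lemma norm_remTransform_le (z : ℂ) :
    ‖remTransform b M H z‖ ≤ (2 * Real.pi * ‖z‖) ^ M * Real.exp (2 * Real.pi * b * ‖z‖)
      * ∫ ξ in Set.Ioc (-b) b, ‖(ξ : ℂ) ^ M * H ξ‖ := by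
  rw [← integral_const_mul]
  exact norm_integral_le_of_norm_le (hH.norm.const_mul _)
    ((ae_restrict_mem measurableSet_Ioc).mono fun ξ hξ => norm_expRem_mul_le b M H z hξ)

include hH in
lemma norm_remTransform_ofReal_le (x : ℝ) :
    ‖remTransform b M H x‖ ≤ 4 * (2 * Real.pi * |x|) ^ M
      * ∫ ξ in Set.Ioc (-b) b, ‖(ξ : ℂ) ^ M * H ξ‖ := by
  rw [← integral_const_mul]
  refine norm_integral_le_of_norm_le (hH.norm.const_mul _) (Eventually.of_forall fun ξ => ?_)
  have := norm_expRem_le_of_re_eq_zero M (w := 2 * Real.pi * Complex.I * x * ξ) (by simp)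
  rw [norm_two_pi_I_mul, Complex.norm_real, Real.norm_eq_abs, mul_pow] at this
  rw [norm_mul, norm_mul, norm_pow, Complex.norm_real, Real.norm_eq_abs, ← mul_assoc]
  exact mul_le_mul_of_nonneg_right (by linarith) (norm_nonneg _)

include hH in
lemma integrableOn_pow_pred_mul :
    IntegrableOn (fun ξ : ℝ => (ξ : ℂ) ^ (M - 1) * (2 * Real.pi * Complex.I * ξ * H ξ))
      (Set.Ioc (-b) b) := by
  cases M with
  | succ n =>
    refine (hH.const_mul (2 * Real.pi * Complex.I)).congr (Eventually.of_forall fun ξ => ?_)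
    simp only [Nat.add_sub_cancel, pow_succ]
    ring
  | zero =>
    have : IntegrableOn (fun ξ : ℝ => (2 * Real.pi * Complex.I * ξ : ℂ) * ((ξ : ℂ) ^ 0 * H ξ))
        (Set.Ioc (-b) b) := by
      refine Integrable.bdd_mul hH (c := 2 * Real.pi * b) (by fun_prop) ?_
      filter_upwards [ae_restrict_mem measurableSet_Ioc] with ξ hξ
      have hb : |ξ| ≤ b := abs_le.2 ⟨hξ.1.le, hξ.2⟩
      have := norm_two_pi_I_mul 1 ξ
      simp only [mul_one, norm_one] at this
      rw [this]
      have := Real.pi_pos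
      gcongr
    refine this.congr (Eventually.of_forall fun ξ => ?_)
    simp

include hm hH in
-- Differentiation lowers the order of the remainder by one and multiplies `H` by `2πiξ`, so the
-- integrability of `ξ ^ M * H ξ` is passed on and the class is stable.
lemma hasDerivAt_remTransform (z : ℂ) :
    HasDerivAt (remTransform b M H)
      (remTransform b (M - 1) (fun ξ : ℝ => 2 * Real.pi * Complex.I * ξ * H ξ) z) z := by
  have hm' : AEStronglyMeasurable (fun ξ : ℝ => (2 * Real.pi * Complex.I * ξ * H ξ : ℂ))
      (volume.restrict (Set.Ioc (-b) b)) :=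
    (Continuous.aestronglyMeasurable (by fun_prop)).mul hm
  have hH' := integrableOn_pow_pred_mul hH
  -- The dominating function is uniform over the unit ball around `z`, where `‖w‖ ≤ ‖z‖ + 1`; `|b|`
  -- appears because `b` has no prescribed sign.
  refine (hasDerivAt_integral_of_dominated_loc_of_deriv_le (Metric.ball_mem_nhds z one_pos)
    (bound := fun ξ : ℝ => (2 * Real.pi * (‖z‖ + 1)) ^ (M - 1) *
      Real.exp (2 * Real.pi * |b| * (‖z‖ + 1)) *
        ‖(ξ : ℂ) ^ (M - 1) * (2 * Real.pi * Complex.I * ξ * H ξ)‖)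
    (F' := fun (w : ℂ) (ξ : ℝ) => expRem (M - 1) (2 * Real.pi * Complex.I * w * ξ) *
      (2 * Real.pi * Complex.I * ξ * H ξ))
    (Eventually.of_forall fun w => aestronglyMeasurable_expRem_mul hm M w)
    (integrableOn_expRem_mul hm hH z)
    (aestronglyMeasurable_expRem_mul hm' (M - 1) z) ?_ (hH'.norm.const_mul _) ?_).2
  · filter_upwards [ae_restrict_mem measurableSet_Ioc] with ξ hξ w hw
    refine (norm_expRem_mul_le b (M - 1)
      (fun ξ : ℝ => 2 * Real.pi * Complex.I * ξ * H ξ) w hξ).trans ?_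
    have hw' : ‖w‖ ≤ ‖z‖ + 1 := by
      have := norm_sub_norm_le w z
      rw [mem_ball_iff_norm] at hw
      linarith
    have hpi := Real.pi_pos
    have h2 : 2 * Real.pi * b * ‖w‖ ≤ 2 * Real.pi * |b| * (‖z‖ + 1) := by
      have : b ≤ |b| := le_abs_self b
      gcongr
    gcongr
  · refine Eventually.of_forall fun (ξ : ℝ) (w : ℂ) _ => ?_
    have h1 : HasDerivAt (fun w : ℂ => 2 * Real.pi * Complex.I * w * ξ)
        (2 * Real.pi * Complex.I * ξ) w := by
      simpa using ((hasDerivAt_id w).const_mul (2 * Real.pi * Complex.I)).mul_const (ξ : ℂ)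
    have := (((hasDerivAt_expRem M _).comp w h1).mul_const (H ξ))
    exact HasDerivAt.congr_deriv this (by ring)

include hm hH in
lemma differentiable_remTransform : Differentiable ℂ (remTransform b M H) :=
  fun z => (hasDerivAt_remTransform hm hH z).differentiableAt

include hm hH in
lemma isEntireExpType_remTransform : IsEntireExpType (2 * Real.pi * b) (remTransform b M H) := by
  refine ⟨differentiable_remTransform hm hH, fun ε hε => ?_⟩
  refine ⟨(2 * Real.pi / ε) ^ M * M.factorial * ∫ ξ in Set.Ioc (-b) b, ‖(ξ : ℂ) ^ M * H ξ‖,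
    fun z => (norm_remTransform_le hH z).trans ?_⟩
  -- The polynomial factor is absorbed in `exp (ε ‖z‖)` through `t ^ M / M! ≤ exp t` with `t = ε
  -- ‖z‖`.
  have h1 := Real.pow_div_factorial_le_exp (ε * ‖z‖) (by positivity) M
  rw [div_le_iff₀ (by positivity)] at h1
  have hpi := Real.pi_pos
  have h2 : (2 * Real.pi * ‖z‖) ^ M ≤ (2 * Real.pi / ε) ^ M * M.factorial * Real.exp (ε * ‖z‖) := by
    calc (2 * Real.pi * ‖z‖) ^ M = (2 * Real.pi / ε) ^ M * (ε * ‖z‖) ^ M := by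
          rw [← mul_pow]; congr 1; field_simp
      _ ≤ (2 * Real.pi / ε) ^ M * (Real.exp (ε * ‖z‖) * M.factorial) := by gcongr
      _ = _ := by ring
  have h3 : 0 ≤ ∫ ξ in Set.Ioc (-b) b, ‖(ξ : ℂ) ^ M * H ξ‖ := integral_nonneg fun _ => norm_nonneg _
  rw [show (2 * Real.pi * b + ε) * ‖z‖ = ε * ‖z‖ + 2 * Real.pi * b * ‖z‖ by ring, Real.exp_add]
  calc _ ≤ ((2 * Real.pi / ε) ^ M * M.factorial * Real.exp (ε * ‖z‖))
        * Real.exp (2 * Real.pi * b * ‖z‖) * ∫ ξ in Set.Ioc (-b) b, ‖(ξ : ℂ) ^ M * H ξ‖ := by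
        gcongr
    _ = _ := by ring

lemma iteratedDeriv_remTransform (k : ℕ) : ∀ (M : ℕ) (H : ℝ → ℂ),
    AEStronglyMeasurable H (volume.restrict (Set.Ioc (-b) b)) →
    IntegrableOn (fun ξ : ℝ => (ξ : ℂ) ^ M * H ξ) (Set.Ioc (-b) b) →
    iteratedDeriv k (fun x : ℝ => remTransform b M H x) = fun x : ℝ =>
      remTransform b (M - k) (fun ξ => (2 * Real.pi * Complex.I * ξ) ^ k * H ξ) x := by
  induction k with
  | zero => intro M H _ _; simp
  | succ k ih =>
    intro M H hm hH
    have hd : deriv (fun x : ℝ => remTransform b M H x) = fun x : ℝ =>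
        remTransform b (M - 1) (fun ξ : ℝ => 2 * Real.pi * Complex.I * ξ * H ξ) x := by
      funext x
      exact ((hasDerivAt_remTransform hm hH x).comp_ofReal).deriv
    rw [iteratedDeriv_succ', hd, ih (M - 1) (fun ξ : ℝ => 2 * Real.pi * Complex.I * ξ * H ξ) ((Continuous.aestronglyMeasurable (by fun_prop)).mul hm)
      (integrableOn_pow_pred_mul hH), Nat.sub_sub, add_comm 1 k]
    simp only [pow_succ, mul_assoc]

include hm hH in
lemma integrable_remTransform_mul_schwartz (ψ : 𝓢(ℝ, ℂ)) :
    Integrable fun x : ℝ => remTransform b M H x * ψ x := by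
  set c := ∫ ξ in Set.Ioc (-b) b, ‖(ξ : ℂ) ^ M * H ξ‖
  refine ((ψ.integrable_pow_mul volume M).const_mul (4 * (2 * Real.pi) ^ M * c)).mono' ?_
    (Eventually.of_forall fun x => ?_)
  · refine Continuous.aestronglyMeasurable (Continuous.mul ?_ ψ.continuous)
    exact (differentiable_remTransform hm hH).continuous.comp Complex.continuous_ofReal
  · rw [norm_mul]
    calc _ ≤ 4 * (2 * Real.pi * |x|) ^ M * c * ‖ψ x‖ :=
          mul_le_mul_of_nonneg_right (norm_remTransform_ofReal_le hH x) (norm_nonneg _)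
      _ = _ := by rw [mul_pow, Real.norm_eq_abs]; ring

include hm in
-- Fubini: since the moments of `ψ` vanish, integrating the remainder kernel against `ψ` in `x`
-- yields the full `𝓕⁻ψ`. The growth bound on the imaginary axis gives absolute integrability.
lemma integral_remTransform_mul_schwartz {s : ℝ}
    (hH : IntegrableOn (fun ξ : ℝ => (ξ : ℂ) ^ taylorCount s * H ξ) (Set.Ioc (-b) b))
    {ψ : 𝓢(ℝ, ℂ)} (hψ : VanishingMoments s ψ) :
    ∫ x : ℝ, remTransform b (taylorCount s) H x * ψ x
      = ∫ ξ in Set.Ioc (-b) b, H ξ * 𝓕⁻ (ψ : ℝ → ℂ) ξ := by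
  set M := taylorCount s with hM
  set μ := volume.restrict (Set.Ioc (-b) b) with hμ
  have hint : Integrable (Function.uncurry fun (x ξ : ℝ) =>
      expRem M (2 * Real.pi * Complex.I * x * ξ) * H ξ * ψ x) (volume.prod μ) := by
    have h0 := ((ψ.integrable_pow_mul volume M).const_mul (4 * (2 * Real.pi) ^ M)).mul_prod hH.norm
    refine h0.mono' ?_ (Eventually.of_forall fun p => ?_)
    · refine AEStronglyMeasurable.mul (AEStronglyMeasurable.mul ?_ hm.comp_snd)
        (ψ.continuous.comp continuous_fst).aestronglyMeasurable
      exact ((continuous_expRem M).comp (by fun_prop)).aestronglyMeasurable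
    · obtain ⟨x, ξ⟩ := p
      have := norm_expRem_le_of_re_eq_zero M (w := 2 * Real.pi * Complex.I * x * ξ) (by simp)
      rw [norm_two_pi_I_mul, Complex.norm_real] at this
      simp only [Function.uncurry_apply_pair, norm_mul, norm_pow, Complex.norm_real]
      calc _ ≤ 4 * (2 * Real.pi * ‖x‖ * |ξ|) ^ M * ‖H ξ‖ * ‖ψ x‖ := by gcongr
        _ = _ := by simp only [mul_pow, Real.norm_eq_abs]; ring
  have e1 : ∀ x : ℝ, remTransform b M H x * ψ x
      = ∫ ξ, expRem M (2 * Real.pi * Complex.I * x * ξ) * H ξ * ψ x ∂μ := fun x =>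
    (integral_mul_const _ _).symm
  simp only [e1]
  rw [integral_integral_swap hint]
  congr 1
  funext ξ
  rw [fourierInv_eq_integral_expRem hψ, ← integral_const_mul]
  congr 1
  funext x
  ring

end remTransform

/-! ### Phragmén–Lindelöf and the support of the spectrum -/

section PaleyWienerSupport

lemma one_add_abs_le_norm_add_I (x : ℝ) : 1 + |x| ≤ 2 * ‖(x : ℂ) + Complex.I‖ := by
  have h1 := Complex.abs_re_le_norm ((x : ℂ) + Complex.I)
  have h2 := Complex.abs_im_le_norm ((x : ℂ) + Complex.I)
  simp at h1 h2
  linarith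

/-- Phragmén–Lindelöf: a function of exponential type `a` with polynomial growth on the real
line is of order `(1 + |z|) ^ N exp ((a + ε) Im z)` on the upper half plane. -/
lemma IsEntireExpType.norm_le_upperHalfPlane {a : ℝ} (ha : 0 ≤ a) {f : ℂ → ℂ}
    (hf : IsEntireExpType a f) {C : ℝ} {N : ℕ} (hC : ∀ x : ℝ, ‖f x‖ ≤ C * (1 + |x|) ^ N)
    {ε : ℝ} (hε : 0 < ε) :
    ∃ K, ∀ z : ℂ, 0 ≤ z.im → ‖f z‖ ≤ K * (1 + ‖z‖) ^ N * Real.exp ((a + ε) * z.im) := by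
  obtain ⟨hd, hexp⟩ := hf
  obtain ⟨C₁, hC₁⟩ := hexp ε hε
  have hC0 : 0 ≤ C := by
    have := (norm_nonneg _).trans (hC 0)
    simpa using this
  have hC₁0 : 0 ≤ C₁ := by
    have := (norm_nonneg _).trans (hC₁ 0)
    simpa using this
  -- The exponential compensates the growth of `f` along the positive imaginary axis and the
  -- denominator the growth along the real axis; its zero `-i` lies outside the half plane. Thus `h`
  -- is bounded on the sides of both quadrants and of order at most one inside, as Phragmén–Lindelöf
  -- requires.
  set h : ℂ → ℂ := fun z => f z * Complex.exp (Complex.I * (a + ε) * z) / (z + Complex.I) ^ N with hh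
  have hexpn : ∀ z : ℂ, ‖Complex.exp (Complex.I * (a + ε) * z)‖ = Real.exp (-((a + ε) * z.im)) := by
    intro z
    rw [Complex.norm_exp]
    congr 1
    simp
  have hone : ∀ z : ℂ, 0 ≤ z.im → 1 ≤ ‖z + Complex.I‖ := fun z hz => by
    have := (le_abs_self _).trans (Complex.abs_im_le_norm (z + Complex.I))
    simp at this
    linarith
  have hne : ∀ z : ℂ, 0 ≤ z.im → z + Complex.I ≠ 0 := fun z hz h0 => by
    have := hone z hz
    rw [h0, norm_zero] at this
    linarith
  have hhn : ∀ z : ℂ, ‖h z‖ = ‖f z‖ * Real.exp (-((a + ε) * z.im)) / ‖z + Complex.I‖ ^ N :=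
    fun z => by rw [hh, norm_div, norm_mul, norm_pow, hexpn]
  have hdiff : ∀ s : Set ℂ, (∀ z ∈ closure s, 0 ≤ z.im) → DiffContOnCl ℂ h s := fun s hs => by
    refine DifferentiableOn.diffContOnCl fun z hz => ?_
    refine DifferentiableAt.differentiableWithinAt ?_
    refine ((hd z).mul (by fun_prop)).div (by fun_prop) ?_
    exact pow_ne_zero _ (hne z (hs z hz))
  have hgrowth : ∀ s : Set ℂ, (∀ z ∈ s, 0 ≤ z.im) → ∃ c < (2 : ℝ), ∃ B,
      h =O[Bornology.cobounded ℂ ⊓ 𝓟 s] fun z => Real.exp (B * ‖z‖ ^ c) := fun s hs => by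
    refine ⟨1, by norm_num, a + ε, Asymptotics.IsBigO.of_bound C₁ ?_⟩
    refine (Filter.eventually_inf_principal).2 (Eventually.of_forall fun z hz => ?_)
    have him := hs z hz
    rw [hhn, Real.rpow_one, Real.norm_of_nonneg (Real.exp_pos _).le]
    refine div_le_of_le_mul₀ (by positivity) (by positivity) ?_
    have h1 : Real.exp (-((a + ε) * z.im)) ≤ 1 := by
      rw [Real.exp_le_one_iff]
      have : 0 ≤ (a + ε) * z.im := by positivity
      linarith
    have h2 : 1 ≤ ‖z + Complex.I‖ ^ N := one_le_pow₀ (hone z him)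
    calc _ ≤ (C₁ * Real.exp ((a + ε) * ‖z‖)) * 1 := by gcongr; exact hC₁ z
      _ ≤ _ := by gcongr
  set K := C * 2 ^ N + C₁ with hK
  have hre : ∀ x : ℝ, ‖h x‖ ≤ K := fun x => by
    rw [hhn]
    simp only [Complex.ofReal_im, mul_zero, neg_zero, Real.exp_zero, mul_one]
    have hp : 0 < ‖(x : ℂ) + Complex.I‖ := zero_lt_one.trans_le (hone x (by simp))
    rw [div_le_iff₀ (by positivity)]
    calc _ ≤ C * (1 + |x|) ^ N := hC x
      _ ≤ C * (2 * ‖(x : ℂ) + Complex.I‖) ^ N := by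
        gcongr
        exact one_add_abs_le_norm_add_I x
      _ = (C * 2 ^ N) * ‖(x : ℂ) + Complex.I‖ ^ N := by rw [mul_pow]; ring
      _ ≤ _ := by gcongr; linarith
  have him : ∀ y : ℝ, 0 ≤ y → ‖h (y * Complex.I)‖ ≤ K := fun y hy => by
    rw [hhn]
    have h1 := hC₁ (y * Complex.I)
    have h2 : 1 ≤ ‖(y * Complex.I + Complex.I : ℂ)‖ ^ N := one_le_pow₀ (hone _ (by simpa using hy))
    rw [norm_mul, Complex.norm_I, Complex.norm_real, Real.norm_of_nonneg hy, mul_one] at h1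
    refine div_le_of_le_mul₀ (by positivity) (by positivity) ?_
    have e : (y * Complex.I : ℂ).im = y := by simp
    rw [e]
    calc _ ≤ C₁ * Real.exp ((a + ε) * y) * Real.exp (-((a + ε) * y)) := by gcongr
      _ = C₁ := by rw [mul_assoc, ← Real.exp_add]; simp
      _ ≤ K := by rw [hK]; nlinarith [pow_pos (zero_lt_two' ℝ) N]
      _ ≤ _ := le_mul_of_one_le_right (by positivity) h2
  have hbound : ∀ z : ℂ, 0 ≤ z.im → ‖h z‖ ≤ K := fun z hz => by
    rcases le_total 0 z.re with hr | hr
    · refine PhragmenLindelof.quadrant_I (hdiff _ fun w hw => ?_) (hgrowth _ fun w hw => hw.2.le)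
        (fun x _ => hre x) him hr hz
      rw [Complex.closure_reProdIm, closure_Ioi] at hw
      exact hw.2
    · refine PhragmenLindelof.quadrant_II (hdiff _ fun w hw => ?_) (hgrowth _ fun w hw => hw.2.le)
        (fun x _ => hre x) him hr hz
      rw [Complex.closure_reProdIm, closure_Ioi, closure_Iio] at hw
      exact hw.2
  refine ⟨K, fun z hz => ?_⟩
  have hp : 0 < ‖z + Complex.I‖ := zero_lt_one.trans_le (hone z hz)
  have := hbound z hz
  rw [hhn, div_le_iff₀ (by positivity)] at this
  have h3 : ‖z + Complex.I‖ ≤ 1 + ‖z‖ := by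
    refine (norm_add_le _ _).trans ?_
    rw [Complex.norm_I, add_comm]
  have hK0 : 0 ≤ K := by positivity
  calc ‖f z‖ = ‖f z‖ * Real.exp (-((a + ε) * z.im)) * Real.exp ((a + ε) * z.im) := by
        rw [mul_assoc, ← Real.exp_add]; simp
    _ ≤ K * ‖z + Complex.I‖ ^ N * Real.exp ((a + ε) * z.im) := by gcongr
    _ ≤ _ := by gcongr

lemma integrable_of_one_add_abs_sq_mul_le {F : ℝ → ℂ} (hF : Continuous F) {C : ℝ}
    (hC : ∀ x : ℝ, (1 + |x|) ^ 2 * ‖F x‖ ≤ C) : Integrable F := by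
  refine (integrable_inv_one_add_sq.const_mul C).mono' hF.aestronglyMeasurable
    (Eventually.of_forall fun x => ?_)
  rw [← div_eq_mul_inv, le_div_iff₀ (by positivity), mul_comm]
  refine le_trans ?_ (hC x)
  gcongr
  nlinarith [abs_nonneg x, sq_abs x]

/-- A function with quadratic decay on the closed upper half plane has integral zero over the
real line. -/
lemma integral_eq_zero_of_upperHalfPlane_decay {F : ℂ → ℂ} (hF : Differentiable ℂ F) {C : ℝ}
    (hC : ∀ z : ℂ, 0 ≤ z.im → (1 + ‖z‖) ^ 2 * ‖F z‖ ≤ C) : ∫ x : ℝ, F x = 0 := by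
  have hcont : Continuous fun x : ℝ => F x := hF.continuous.comp Complex.continuous_ofReal
  have hint : Integrable fun x : ℝ => F x :=
    integrable_of_one_add_abs_sq_mul_le hcont (C := C) fun x => by
      have := hC x (by simp)
      rwa [Complex.norm_real, Real.norm_eq_abs] at this
  have hlim := intervalIntegral_tendsto_integral hint tendsto_neg_atTop_atBot tendsto_id
  refine tendsto_nhds_unique hlim ?_
  have hC0 : 0 ≤ C := by
    have := hC 0 (by simp)
    exact le_trans (by positivity) this
  have hz : Tendsto (fun R : ℝ => 4 * C * R⁻¹) atTop (𝓝 0) := by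
    simpa using tendsto_inv_atTop_zero.const_mul (4 * C)
  refine squeeze_zero_norm' ?_ hz
  filter_upwards [eventually_gt_atTop 0] with R hR
  -- Cauchy's theorem on the rectangle `[-R, R] × [0, R]`: the other three sides have total length
  -- `4R`, and `F` is at most `C / R²` on them.
  have key := Complex.integral_boundary_rect_eq_zero_of_differentiableOn F (-R : ℂ) (R + R * Complex.I)
    hF.differentiableOn
  have e1 : (-R : ℂ).re = -R := by simp
  have e2 : (-R : ℂ).im = 0 := by simp
  have e3 : (R + R * Complex.I : ℂ).re = R := by simp
  have e4 : (R + R * Complex.I : ℂ).im = R := by simp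
  rw [e1, e2, e3, e4] at key
  simp only [Complex.ofReal_zero, zero_mul, add_zero, smul_eq_mul] at key
  have hb : ∀ z : ℂ, 0 ≤ z.im → R ≤ ‖z‖ → ‖F z‖ ≤ C / R ^ 2 := fun z hz hRz => by
    rw [le_div_iff₀ (by positivity), mul_comm]
    refine le_trans ?_ (hC z hz)
    gcongr
    linarith
  have b1 : ‖∫ x : ℝ in (-R)..R, F (x + R * Complex.I)‖ ≤ C / R ^ 2 * |R - -R| := by
    refine intervalIntegral.norm_integral_le_of_norm_le_const fun x _ => hb _ (by simp [hR.le]) ?_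
    refine le_trans ?_ (Complex.abs_im_le_norm _)
    simp [le_abs_self]
  have b2 : ‖∫ y : ℝ in (0 : ℝ)..R, F (R + y * Complex.I)‖ ≤ C / R ^ 2 * |R - 0| := by
    refine intervalIntegral.norm_integral_le_of_norm_le_const fun y hy => hb _ ?_ ?_
    · rw [Set.uIoc_of_le hR.le] at hy
      simp [hy.1.le]
    · refine le_trans ?_ (Complex.abs_re_le_norm _)
      simp [le_abs_self]
  have b3 : ‖∫ y : ℝ in (0 : ℝ)..R, F ((-R : ℝ) + y * Complex.I)‖ ≤ C / R ^ 2 * |R - 0| := by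
    refine intervalIntegral.norm_integral_le_of_norm_le_const fun y hy => hb _ ?_ ?_
    · rw [Set.uIoc_of_le hR.le] at hy
      simp [hy.1.le]
    · refine le_trans ?_ (Complex.abs_re_le_norm _)
      simp [le_abs_self]
  have e : (∫ x : ℝ in (-R)..R, F x) = (∫ x : ℝ in (-R)..R, F (x + R * Complex.I))
      - Complex.I * (∫ y : ℝ in (0 : ℝ)..R, F (R + y * Complex.I))
      + Complex.I * (∫ y : ℝ in (0 : ℝ)..R, F ((-R : ℝ) + y * Complex.I)) := by
    linear_combination key
  simp only [id_eq]
  rw [e]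
  refine (norm_add_le _ _).trans ?_
  refine (add_le_add_left (norm_sub_le _ _) _).trans ?_
  rw [norm_mul, norm_mul, Complex.norm_I, one_mul, one_mul]
  have r1 : |R - -R| = 2 * R := by rw [abs_of_pos (by linarith)]; ring
  have r2 : |R - 0| = R := by rw [sub_zero, abs_of_pos hR]
  rw [r1] at b1
  rw [r2] at b2 b3
  have : C / R ^ 2 * (2 * R) + C / R ^ 2 * R + C / R ^ 2 * R = 4 * C * R⁻¹ := by
    field_simp; ring
  linarith

/-- The Fourier transform of a compactly supported function, at a complex argument. -/
noncomputable def complexFourier (χ : ℝ → ℂ) (z : ℂ) : ℂ :=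
  ∫ ξ : ℝ, Complex.exp (-(2 * Real.pi * Complex.I * z * ξ)) * χ ξ

lemma complexFourier_ofReal (χ : ℝ → ℂ) (x : ℝ) : complexFourier χ x = 𝓕 χ x := by
  rw [Real.fourier_eq', complexFourier]
  congr 1
  funext ξ
  simp only [smul_eq_mul, RCLike.inner_apply, conj_trivial]
  congr 2
  push_cast
  ring

lemma differentiable_complexFourier {χ : ℝ → ℂ} (hχ : Continuous χ) (hc : HasCompactSupport χ) :
    Differentiable ℂ (complexFourier χ) := by
  obtain ⟨c, hc0, hcs⟩ := hc.isCompact.isBounded.subset_closedBall_lt 0 (0 : ℝ)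
  have hint : Integrable χ := hχ.integrable_of_hasCompactSupport hc
  have hsub : tsupport χ ⊆ Set.Ioc (-(c + 1)) (c + 1) := fun x hx => by
    have := hcs hx
    rw [mem_closedBall_zero_iff, Real.norm_eq_abs, abs_le] at this
    exact ⟨by linarith, by linarith⟩
  have e : complexFourier χ = fun z => remTransform (c + 1) 0 χ (-z) := by
    funext z
    rw [complexFourier, remTransform, setIntegral_eq_integral_of_forall_compl_eq_zero]
    · congr 1
      funext ξ
      rw [expRem]
      congr 1
      simp
    · intro ξ hξ
      rw [image_eq_zero_of_notMem_tsupport fun h => hξ (hsub h), mul_zero]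
  rw [e]
  exact (differentiable_remTransform (hχ.aestronglyMeasurable)
    (by simpa using hint.integrableOn)).comp differentiable_neg

lemma norm_exp_two_pi_I_mul (z : ℂ) (ξ : ℝ) :
    ‖Complex.exp (-(2 * Real.pi * Complex.I * z * ξ))‖ = Real.exp (2 * Real.pi * z.im * ξ) := by
  rw [Complex.norm_exp]
  congr 1
  simp

/-- For `ξ ≤ -b` and `Im z ≥ 0` the kernel has modulus at most `exp (-2πb Im z)`. Each integration
by parts trades a factor `z` for a derivative of `χ`, without enlarging the support. -/
lemma norm_pow_mul_complexFourier_le {b : ℝ} (n : ℕ) : ∀ χ : ℝ → ℂ, ContDiff ℝ ∞ χ →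
    HasCompactSupport χ → tsupport χ ⊆ Set.Iic (-b) →
    ∃ C, ∀ z : ℂ, 0 ≤ z.im →
      ‖z‖ ^ n * ‖complexFourier χ z‖ ≤ C * Real.exp (-(2 * Real.pi * b * z.im)) := by
  have hpi := Real.pi_pos
  induction n with
  | zero =>
    intro χ h1 h2 h3
    refine ⟨∫ ξ, ‖χ ξ‖, fun z hz => ?_⟩
    rw [pow_zero, one_mul, ← integral_mul_const]
    refine norm_integral_le_of_norm_le
      ((h1.continuous.integrable_of_hasCompactSupport h2).norm.mul_const _)
      (Eventually.of_forall fun ξ => ?_)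
    rw [norm_mul, norm_exp_two_pi_I_mul, mul_comm]
    by_cases hξ : ξ ∈ tsupport χ
    · have h4 : ξ ≤ -b := h3 hξ
      have : 2 * Real.pi * z.im * ξ ≤ 2 * Real.pi * z.im * (-b) := by gcongr
      gcongr
      linarith
    · rw [image_eq_zero_of_notMem_tsupport hξ]
      simp
  | succ n ih =>
    intro χ h1 h2 h3
    have h1' : ContDiff ℝ ∞ (deriv χ) := (contDiff_infty_iff_deriv.1 h1).2
    obtain ⟨C, hC⟩ := ih (deriv χ) h1' h2.deriv ((tsupport_deriv_subset).trans h3)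
    refine ⟨C / (2 * Real.pi), fun z hz => ?_⟩
    have hd : ∀ ξ : ℝ, HasDerivAt (fun ξ : ℝ => Complex.exp (-(2 * Real.pi * Complex.I * z * ξ)))
        (-(2 * Real.pi * Complex.I * z) * Complex.exp (-(2 * Real.pi * Complex.I * z * ξ))) ξ := by
      intro ξ
      have : HasDerivAt (fun w : ℂ => Complex.exp (-(2 * Real.pi * Complex.I * z * w)))
          (Complex.exp (-(2 * Real.pi * Complex.I * z * ξ)) * -(2 * Real.pi * Complex.I * z * 1)) ξ :=
        (((hasDerivAt_id (ξ : ℂ)).const_mul (2 * Real.pi * Complex.I * z)).neg).cexp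
      refine this.comp_ofReal.congr_deriv ?_
      ring
    have hib := integral_mul_deriv_eq_deriv_mul_of_integrable (v := χ) (v' := deriv χ)
      (fun ξ _ => hd ξ)
      (fun ξ _ => ((contDiff_infty_iff_deriv.1 h1).1 ξ).hasDerivAt)
      (Continuous.integrable_of_hasCompactSupport
        (Continuous.mul (by fun_prop) h1'.continuous) (h2.deriv.mul_left))
      (Continuous.integrable_of_hasCompactSupport
        (Continuous.mul (by fun_prop) h1.continuous) (h2.mul_left))
      (Continuous.integrable_of_hasCompactSupport
        (Continuous.mul (by fun_prop) h1.continuous) (h2.mul_left))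
    have e : complexFourier (deriv χ) z = 2 * Real.pi * Complex.I * z * complexFourier χ z := by
      rw [complexFourier, hib, complexFourier, ← integral_neg, ← integral_const_mul]
      congr 1
      funext ξ
      ring
    have := hC z hz
    rw [e, norm_mul, norm_mul, norm_mul, Complex.norm_I, norm_mul, Complex.norm_ofNat,
      Complex.norm_real, Real.norm_of_nonneg hpi.le] at this
    rw [div_mul_eq_mul_div, le_div_iff₀ (by positivity)]
    calc _ = ‖z‖ ^ n * (2 * Real.pi * 1 * ‖z‖ * ‖complexFourier χ z‖) := by ring
      _ ≤ _ := this

lemma one_add_norm_pow_mul_complexFourier_le {b : ℝ} (n : ℕ) {χ : ℝ → ℂ} (h1 : ContDiff ℝ ∞ χ)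
    (h2 : HasCompactSupport χ) (h3 : tsupport χ ⊆ Set.Iic (-b)) :
    ∃ C, ∀ z : ℂ, 0 ≤ z.im →
      (1 + ‖z‖) ^ n * ‖complexFourier χ z‖ ≤ C * Real.exp (-(2 * Real.pi * b * z.im)) := by
  obtain ⟨C, hC⟩ := norm_pow_mul_complexFourier_le 0 χ h1 h2 h3
  obtain ⟨D, hD⟩ := norm_pow_mul_complexFourier_le n χ h1 h2 h3
  refine ⟨2 ^ (n - 1) * (C + D), fun z hz => ?_⟩
  have h4 := add_pow_le (zero_le_one (α := ℝ)) (norm_nonneg z) n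
  have hC' := hC z hz
  have hD' := hD z hz
  rw [pow_zero, one_mul] at hC'
  rw [one_pow] at h4
  calc _ ≤ 2 ^ (n - 1) * (1 + ‖z‖ ^ n) * ‖complexFourier χ z‖ := by gcongr
    _ = 2 ^ (n - 1) * (‖complexFourier χ z‖ + ‖z‖ ^ n * ‖complexFourier χ z‖) := by ring
    _ ≤ 2 ^ (n - 1) * (C * Real.exp (-(2 * Real.pi * b * z.im))
        + D * Real.exp (-(2 * Real.pi * b * z.im))) := by gcongr
    _ = _ := by ring

/-- **Paley–Wiener**: the spectrum of a function of exponential type `2πb` with polynomial growth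
on the real line does not meet `(-∞, -b)`. -/
lemma IsEntireExpType.integral_mul_fourier_eq_zero_left {b : ℝ} (hb : 0 ≤ b) {f : ℂ → ℂ}
    (hf : IsEntireExpType (2 * Real.pi * b) f) {C : ℝ} {N : ℕ}
    (hC : ∀ x : ℝ, ‖f x‖ ≤ C * (1 + |x|) ^ N) {χ : ℝ → ℂ} (h1 : ContDiff ℝ ∞ χ)
    (h2 : HasCompactSupport χ) (h3 : tsupport χ ⊆ Set.Iio (-b)) :
    ∫ x : ℝ, f x * 𝓕 χ x = 0 := by
  have hpi := Real.pi_pos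
  -- Compactness of the support leaves a gap between it and `-b`. The gap pays for the loss `ε =
  -- 2π(b' - b)` in the Phragmén–Lindelöf bound, so the exponentials in the product cancel exactly.
  obtain ⟨b', hb', h3'⟩ : ∃ b', b < b' ∧ tsupport χ ⊆ Set.Iic (-b') := by
    rcases (tsupport χ).eq_empty_or_nonempty with he | hne
    · exact ⟨b + 1, by linarith, by simp [he]⟩
    · obtain ⟨x, hx, hmax⟩ := h2.isCompact.exists_isMaxOn hne continuousOn_id
      refine ⟨-x, ?_, fun y hy => ?_⟩
      · have : x < -b := h3 hx
        linarith
      · have : y ≤ x := hmax hy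
        simpa using this
  have hε : 0 < 2 * Real.pi * (b' - b) := by
    have : 0 < b' - b := by linarith
    positivity
  obtain ⟨K, hK⟩ := hf.norm_le_upperHalfPlane (by positivity) hC hε
  obtain ⟨D, hD⟩ := one_add_norm_pow_mul_complexFourier_le (N + 2) h1 h2 h3'
  have hK0 : 0 ≤ K := by
    have := hK 0 (by simp)
    simp at this
    exact (norm_nonneg _).trans this
  have := integral_eq_zero_of_upperHalfPlane_decay (F := fun z => f z * complexFourier χ z)
    (hf.1.mul (differentiable_complexFourier h1.continuous h2)) (C := K * D) fun z hz => by
      rw [norm_mul]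
      calc _ ≤ (1 + ‖z‖) ^ 2 * (K * (1 + ‖z‖) ^ N *
            Real.exp ((2 * Real.pi * b + 2 * Real.pi * (b' - b)) * z.im) * ‖complexFourier χ z‖) := by
            gcongr
            exact hK z hz
        _ = K * Real.exp (2 * Real.pi * b' * z.im)
            * ((1 + ‖z‖) ^ (N + 2) * ‖complexFourier χ z‖) := by
            rw [show (2 * Real.pi * b + 2 * Real.pi * (b' - b)) = 2 * Real.pi * b' by ring]
            ring
        _ ≤ K * Real.exp (2 * Real.pi * b' * z.im)
            * (D * Real.exp (-(2 * Real.pi * b' * z.im))) := by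
            exact mul_le_mul_of_nonneg_left (hD z hz) (by positivity)
        _ = K * D := by
            have : Real.exp (2 * Real.pi * b' * z.im) * Real.exp (-(2 * Real.pi * b' * z.im)) = 1 := by
              rw [← Real.exp_add]; simp
            linear_combination (K * D) * this
  simpa only [complexFourier_ofReal] using this

lemma IsEntireExpType.comp_neg {a : ℝ} {f : ℂ → ℂ} (hf : IsEntireExpType a f) :
    IsEntireExpType a fun z => f (-z) := by
  refine ⟨hf.1.comp differentiable_neg, fun ε hε => ?_⟩
  obtain ⟨C, hC⟩ := hf.2 ε hε
  exact ⟨C, fun z => by simpa using hC (-z)⟩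

lemma IsEntireExpType.integral_mul_fourier_eq_zero_right {b : ℝ} (hb : 0 ≤ b) {f : ℂ → ℂ}
    (hf : IsEntireExpType (2 * Real.pi * b) f) {C : ℝ} {N : ℕ}
    (hC : ∀ x : ℝ, ‖f x‖ ≤ C * (1 + |x|) ^ N) {χ : ℝ → ℂ} (h1 : ContDiff ℝ ∞ χ)
    (h2 : HasCompactSupport χ) (h3 : tsupport χ ⊆ Set.Ioi b) :
    ∫ x : ℝ, f x * 𝓕 χ x = 0 := by
  have ht : tsupport (fun ξ => χ (-ξ)) = Neg.neg ⁻¹' tsupport χ :=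
    tsupport_comp_eq_preimage χ (Homeomorph.neg ℝ)
  have := hf.comp_neg.integral_mul_fourier_eq_zero_left hb (C := C) (N := N)
    (χ := fun ξ => χ (-ξ)) (fun x => by simpa using hC (-x)) (h1.comp contDiff_neg)
    (h2.comp_homeomorph (Homeomorph.neg ℝ)) (by
      rw [ht]
      intro ξ hξ
      have : b < -ξ := h3 hξ
      simp only [Set.mem_Iio]
      linarith)
  rw [← this, ← integral_neg_eq_self]
  congr 1
  funext x
  have e : 𝓕 χ (-x) = 𝓕 (fun ξ => χ (-ξ)) x := by
    rw [Real.fourier_eq', Real.fourier_eq', ← integral_neg_eq_self]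
    simp
  rw [e]
  simp

end PaleyWienerSupport

/-! ### The spectrum of functions in the realization space -/

/-- Serves the case `s < 1/2`, where `f` is only known to lie in `L^{p*}` on the real line: a
primitive has the same type and grows at most linearly there. -/
lemma IsEntireExpType.exists_primitive {a : ℝ} (ha : 0 ≤ a) {f : ℂ → ℂ}
    (hf : IsEntireExpType a f) :
    ∃ g, IsEntireExpType a g ∧ g 0 = 0 ∧ ∀ z, HasDerivAt g (f z) z := by
  obtain ⟨g, hg0, hg⟩ := (hf.1.isExactOn_univ).with_val_at 0 0
  have hg' : ∀ z, HasDerivAt g (f z) z := fun z => hg z trivial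
  refine ⟨g, ⟨fun z => (hg' z).differentiableAt, fun ε hε => ?_⟩, hg0, hg'⟩
  obtain ⟨C, hC⟩ := hf.2 (ε / 2) (by positivity)
  have hC0 : 0 ≤ C := by
    have := (norm_nonneg _).trans (hC 0)
    simpa using this
  refine ⟨C * (2 / ε), fun z => ?_⟩
  have h1 := (convex_closedBall (0 : ℂ) ‖z‖).norm_image_sub_le_of_norm_hasDerivWithin_le
    (C := C * Real.exp ((a + ε / 2) * ‖z‖)) (fun w _ => (hg' w).hasDerivWithinAt) (fun w hw => by
      refine (hC w).trans ?_
      rw [mem_closedBall_zero_iff] at hw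
      gcongr) (x := 0) (y := z) (by simp) (by simp)
  rw [hg0, sub_zero, sub_zero] at h1
  refine h1.trans ?_
  have h2 : ‖z‖ ≤ 2 / ε * Real.exp (ε / 2 * ‖z‖) := by
    have := Real.add_one_le_exp (ε / 2 * ‖z‖)
    calc ‖z‖ = 2 / ε * (ε / 2 * ‖z‖) := by field_simp
      _ ≤ _ := by gcongr; linarith
  calc _ ≤ C * Real.exp ((a + ε / 2) * ‖z‖) * (2 / ε * Real.exp (ε / 2 * ‖z‖)) := by gcongr
    _ = C * (2 / ε) * (Real.exp ((a + ε / 2) * ‖z‖) * Real.exp (ε / 2 * ‖z‖)) := by ring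
    _ = _ := by rw [← Real.exp_add]; congr 2; ring

/-- Integrate the inequality `‖f‖ ≤ 1 + ‖f‖ ^ p`, valid since `p ≥ 1`. -/
lemma norm_primitive_le_of_memLp {f g : ℝ → ℂ} (hf : Continuous f)
    (hg : ∀ x, HasDerivAt g (f x) x) (hg0 : g 0 = 0) {p : ℝ≥0∞} (hp : 1 ≤ p) (hp' : p ≠ ⊤)
    (hfp : MemLp f p volume) : ∃ C, ∀ x, ‖g x‖ ≤ C * (1 + |x|) ^ 1 := by
  have hp1 : 1 ≤ p.toReal := by
    rw [← ENNReal.toReal_one]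
    exact ENNReal.toReal_mono hp' hp
  have hint : Integrable fun x => ‖f x‖ ^ p.toReal :=
    hfp.integrable_norm_rpow (zero_lt_one.trans_le hp).ne' hp'
  have hnn : 0 ≤ ∫ x, ‖f x‖ ^ p.toReal := integral_nonneg fun x => by positivity
  refine ⟨1 + ∫ x, ‖f x‖ ^ p.toReal, fun x => ?_⟩
  have h1 : g x = ∫ t in (0 : ℝ)..x, f t := by
    rw [intervalIntegral.integral_eq_sub_of_hasDerivAt (fun t _ => hg t)
      (hf.intervalIntegrable _ _), hg0, sub_zero]
  have hfin : volume (Set.uIoc 0 x) < ⊤ := by simp [Set.uIoc]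
  have hb : ∀ t, ‖f t‖ ≤ 1 + ‖f t‖ ^ p.toReal := fun t => by
    rcases le_total ‖f t‖ 1 with h | h
    · have : 0 ≤ ‖f t‖ ^ p.toReal := by positivity
      linarith
    · have := Real.rpow_le_rpow_of_exponent_le h hp1
      rw [Real.rpow_one] at this
      linarith
  have hc : IntegrableOn (fun _ : ℝ => (1 : ℝ)) (Set.uIoc 0 x) := integrableOn_const hfin.ne
  rw [h1]
  calc _ ≤ ∫ t in Set.uIoc 0 x, ‖f t‖ := intervalIntegral.norm_integral_le_integral_norm_uIoc
    _ ≤ ∫ t in Set.uIoc 0 x, (1 + ‖f t‖ ^ p.toReal) :=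
      setIntegral_mono ((hf.intervalIntegrable 0 x).def'.norm) (hc.add hint.integrableOn) hb
    _ = |x| + ∫ t in Set.uIoc 0 x, ‖f t‖ ^ p.toReal := by
      rw [integral_add hc hint.integrableOn]
      congr 1
      simp [Set.uIoc, Measure.real, max_sub_min_eq_abs]
    _ ≤ |x| + ∫ t, ‖f t‖ ^ p.toReal := by
      gcongr
      · exact Eventually.of_forall fun t => by positivity
      · exact Measure.restrict_le_self
    _ ≤ _ := by rw [pow_one]; nlinarith [abs_nonneg x]

/-- Integration by parts moves the statement to the primitive `g`: the derivative of `𝓕 χ` is the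
transform of `-2πiξ χ`, which keeps the support condition. -/
lemma HasCompactSupport.integral_mul_fourier_eq_neg {f g : ℂ → ℂ} (hg : ∀ z, HasDerivAt g (f z) z)
    {C : ℝ} {N : ℕ} (hC : ∀ x : ℝ, ‖g x‖ ≤ C * (1 + |x|) ^ N) {χ : ℝ → ℂ}
    (h2 : HasCompactSupport χ) (h1 : ContDiff ℝ ∞ χ)
    (hint : ∀ ψ : 𝓢(ℝ, ℂ), Integrable (fun x : ℝ => f x * ψ x)) :
    ∫ x : ℝ, f x * 𝓕 χ x
      = -∫ x : ℝ, g x * 𝓕 (fun ξ : ℝ => (-2 * Real.pi * Complex.I * ξ) • χ ξ) x := by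
  set η : ℝ → ℂ := fun ξ : ℝ => (-2 * Real.pi * Complex.I * ξ) • χ ξ with hη
  have k1 : ContDiff ℝ ∞ η := ContDiff.smul
    (contDiff_const.mul Complex.ofRealCLM.contDiff) h1
  have k2 : HasCompactSupport η := h2.smul_left (f := fun ξ : ℝ => (-2 * Real.pi * Complex.I * ξ : ℂ))
  have hgc : Continuous fun x : ℝ => g x :=
    (continuous_iff_continuousAt.2 fun z => (hg z).continuousAt).comp Complex.continuous_ofReal
  have hgi : ∀ ψ : 𝓢(ℝ, ℂ), Integrable (fun x : ℝ => g x * ψ x) := fun ψ => by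
    have hi := ((ψ.integrable_pow_mul volume 0).add (ψ.integrable_pow_mul volume N)).const_mul
      (C * 2 ^ (N - 1))
    refine hi.mono' (hgc.mul ψ.continuous).aestronglyMeasurable (Eventually.of_forall fun x => ?_)
    have h4 := add_pow_le (zero_le_one (α := ℝ)) (abs_nonneg x) N
    rw [one_pow] at h4
    have hC0 : 0 ≤ C := by
      have := (norm_nonneg _).trans (hC 0)
      simpa using this
    rw [norm_mul]
    simp only [Pi.add_apply, pow_zero, one_mul, Real.norm_eq_abs]
    calc _ ≤ C * (1 + |x|) ^ N * ‖ψ x‖ := by gcongr; exact hC x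
      _ ≤ C * (2 ^ (N - 1) * (1 + |x| ^ N)) * ‖ψ x‖ := by gcongr
      _ = _ := by ring
  have hd : ∀ x, HasDerivAt (𝓕 χ) (𝓕 η x) x := fun x =>
    Real.hasDerivAt_fourier (h1.continuous.integrable_of_hasCompactSupport h2)
      (Continuous.integrable_of_hasCompactSupport (by
        exact continuous_id.smul h1.continuous) (h2.smul_left (f := fun x : ℝ => x))) x
  have e1 : 𝓕 χ = 𝓕 (h2.toSchwartzMap h1) := by rw [SchwartzMap.fourier_coe]; rfl
  have e2 : 𝓕 η = 𝓕 (k2.toSchwartzMap k1) := by rw [SchwartzMap.fourier_coe]; rfl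
  have := integral_mul_deriv_eq_deriv_mul_of_integrable (u := fun x : ℝ => g x)
    (u' := fun x : ℝ => f x) (v := 𝓕 χ) (v' := 𝓕 η)
    (fun x _ => (hg x).comp_ofReal) (fun x _ => hd x)
    (by rw [e2]; exact hgi _) (by rw [e1]; exact hint _) (by rw [e1]; exact hgi _)
  rw [this, neg_neg]

/-- The spectrum of an entire function of exponential type `2πb` with a fractional Laplacian in
`L²`, of polynomial growth on the real line, is contained in `[-b, b]`. -/
lemma IsFracLap.fourier_ae_eq_zero {s b : ℝ} (hs : 0 < s) (hb : 0 < b) {f : ℝ → ℂ} {u G : ℝ → ℂ}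
    (hu : IsFracLap s f u) (hG : L2FourierPair u G)
    (hl : ∀ χ : ℝ → ℂ, ContDiff ℝ ∞ χ → HasCompactSupport χ → tsupport χ ⊆ Set.Iio (-b) →
      ∫ x, f x * 𝓕 χ x = 0)
    (hr : ∀ χ : ℝ → ℂ, ContDiff ℝ ∞ χ → HasCompactSupport χ → tsupport χ ⊆ Set.Ioi b →
      ∫ x, f x * 𝓕 χ x = 0) :
    ∀ᵐ ξ, ξ ∉ Set.Ioc (-b) b → G ξ = 0 := by
  have hl0 : (0 : ℝ) ∉ Set.Iio (-b) := by simpa using hb.le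
  have hr0 : (0 : ℝ) ∉ Set.Ioi b := by simpa using hb.le
  have h1 := ae_eq_zero_of_fracPairing_fourier (s := s) hG.2.1 isOpen_Iio hl0 fun χ hc hχ => by
    rw [← hu.integral_mul_eq hs hG (vanishingMoments_fourier s fun h => hl0 (hχ h))]
    exact hl χ (χ.smooth ⊤) hc hχ
  have h2 := ae_eq_zero_of_fracPairing_fourier (s := s) hG.2.1 isOpen_Ioi hr0 fun χ hc hχ => by
    rw [← hu.integral_mul_eq hs hG (vanishingMoments_fourier s fun h => hr0 (hχ h))]
    exact hr χ (χ.smooth ⊤) hc hχ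
  -- The half-lines leave the closed interval, while `Set.Ioc` omits the endpoint `-b`, a null set.
  have h3 : ∀ᵐ ξ : ℝ, ξ ≠ -b := by simp [ae_iff]
  filter_upwards [h1, h2, h3] with ξ k1 k2 k3 hξ
  rcases lt_or_ge ξ (-b) with h | h
  · exact k1 h
  · refine k2 (lt_of_not_ge fun h' => hξ ⟨lt_of_le_of_ne h k3.symm, h'⟩)

/-- Polynomial growth of a function with a bounded Hölder seminorm of its `m`-th derivative. -/
lemma exists_polynomial_growth_of_iteratedDeriv (m : ℕ) : ∀ (N : ℕ) (f : ℝ → ℂ), ContDiff ℝ m f →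
    (∃ C, ∀ x, ‖iteratedDeriv m f x‖ ≤ C * (1 + |x|) ^ N) →
    ∃ C, ∀ x, ‖f x‖ ≤ C * (1 + |x|) ^ (N + m) := by
  induction m with
  | zero => intro N f _ h; simpa using h
  | succ m ih =>
    intro N f hf ⟨C, hC⟩
    have hf' : ContDiff ℝ m (deriv f) := by
      have : ContDiff ℝ (m + 1 : ℕ) f := hf
      push_cast at this
      exact (contDiff_succ_iff_deriv.1 this).2.2
    have hd : Differentiable ℝ f := hf.differentiable (by simp)
    obtain ⟨D, hD⟩ := ih N (deriv f) hf' ⟨C, fun x => by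
      rw [← iteratedDeriv_succ']; exact hC x⟩
    have hD0 : 0 ≤ D := by
      have := (norm_nonneg _).trans (hD 0)
      simpa using this
    refine ⟨‖f 0‖ + D, fun x => ?_⟩
    have h1 := (convex_closedBall (0 : ℝ) |x|).norm_image_sub_le_of_norm_deriv_le (f := f)
      (C := D * (1 + |x|) ^ (N + m)) (fun y _ => hd y) (fun y hy => by
        refine (hD y).trans ?_
        rw [mem_closedBall_zero_iff, Real.norm_eq_abs] at hy
        gcongr) (x := 0) (y := x) (by simp) (by simp)
    rw [sub_zero, Real.norm_eq_abs] at h1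
    have h2 : ‖f x‖ ≤ ‖f x - f 0‖ + ‖f 0‖ := by
      simpa using norm_add_le (f x - f 0) (f 0)
    have h3 : 1 ≤ (1 + |x|) ^ (N + (m + 1)) := one_le_pow₀ (by linarith [abs_nonneg x])
    calc ‖f x‖ ≤ D * (1 + |x|) ^ (N + m) * |x| + ‖f 0‖ := by linarith
      _ ≤ D * (1 + |x|) ^ (N + m) * (1 + |x|) + ‖f 0‖ * (1 + |x|) ^ (N + (m + 1)) := by
        gcongr
        · linarith
        · exact le_mul_of_one_le_right (norm_nonneg _) h3
      _ = _ := by rw [← add_assoc, pow_succ]; ring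

/-- The Hölder exponent `γ - m` is at most one, so the `m`-th derivative grows at most linearly;
integrating `m` times gives the bound. -/
lemma HomLipschitz.exists_polynomial_growth {γ : ℝ} (hγ : 0 ≤ γ) {f : ℝ → ℂ}
    (hf : HomLipschitz γ f) : ∃ (C : ℝ) (N : ℕ), ∀ x, ‖f x‖ ≤ C * (1 + |x|) ^ N := by
  obtain ⟨hc, C, hC⟩ := hf
  set m := ⌊γ⌋₊
  have h0 : 0 ≤ γ - m := by linarith [Nat.floor_le hγ]
  have h1 : γ - m ≤ 1 := by linarith [Nat.lt_floor_add_one γ]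
  obtain ⟨D, hD⟩ := exists_polynomial_growth_of_iteratedDeriv m 1 f hc
    ⟨‖iteratedDeriv m f 0‖ + |C|, fun x => by
      have h2 : ‖iteratedDeriv m f x‖
          ≤ ‖iteratedDeriv m f x - iteratedDeriv m f 0‖ + ‖iteratedDeriv m f 0‖ := by
        simpa using norm_add_le (iteratedDeriv m f x - iteratedDeriv m f 0) (iteratedDeriv m f 0)
      have h3 := hC x 0
      rw [sub_zero] at h3
      have h4 : |x| ^ (γ - m) ≤ 1 + |x| := by
        calc |x| ^ (γ - m) ≤ (1 + |x|) ^ (γ - m) :=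
              Real.rpow_le_rpow (abs_nonneg x) (by linarith) h0
          _ ≤ (1 + |x|) ^ (1 : ℝ) :=
              Real.rpow_le_rpow_of_exponent_le (by linarith [abs_nonneg x]) h1
          _ = _ := Real.rpow_one _
      have h5 : C * |x| ^ (γ - m) ≤ |C| * (1 + |x|) := by
        calc _ ≤ |C| * |x| ^ (γ - m) := by gcongr; exact le_abs_self C
          _ ≤ _ := by gcongr
      rw [pow_one]
      nlinarith [norm_nonneg (iteratedDeriv m f 0), abs_nonneg x]⟩
  exact ⟨D, _, hD⟩

/-- The spectrum of a function in the fractional Paley–Wiener space is contained in `[-b, b]`,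
`a = 2πb`. -/
lemma RealizationSpace.fourier_ae_eq_zero {s b : ℝ} (hs : 0 < s) (hs' : s ≠ 1 / 2) (hb : 0 < b)
    {f : ℂ → ℂ} (hf : IsEntireExpType (2 * Real.pi * b) f)
    (hR : RealizationSpace s fun x : ℝ => f x) {u G : ℝ → ℂ}
    (hu : IsFracLap s (fun x : ℝ => f x) u) (hG : L2FourierPair u G) :
    ∀ᵐ ξ, ξ ∉ Set.Ioc (-b) b → G ξ = 0 := by
  have hpi := Real.pi_pos
  rcases lt_or_gt_of_ne hs' with h | h
  · obtain ⟨g, hg, hg0, hgd⟩ := hf.exists_primitive (by positivity)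
    have hp : (1 : ℝ) ≤ 1 / (1 / 2 - s) := by
      rw [le_div_iff₀ (by linarith)]; linarith
    obtain ⟨C, hC⟩ := norm_primitive_le_of_memLp (f := fun x : ℝ => f x) (g := fun x : ℝ => g x)
      (hf.1.continuous.comp Complex.continuous_ofReal) (fun x => (hgd x).comp_ofReal)
      (by simpa using hg0) (by simpa using hp) ENNReal.ofReal_ne_top (hR.1 h)
    refine hu.fourier_ae_eq_zero hs hb hG (fun χ h1 h2 h3 => ?_) (fun χ h1 h2 h3 => ?_)
    all_goals
      rw [h2.integral_mul_fourier_eq_neg hgd hC h1 hu.2.1, neg_eq_zero]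
      have k1 : ContDiff ℝ ∞ fun ξ : ℝ => (-2 * Real.pi * Complex.I * ξ) • χ ξ := ContDiff.smul
        (contDiff_const.mul Complex.ofRealCLM.contDiff) h1
      have k2 : HasCompactSupport fun ξ : ℝ => (-2 * Real.pi * Complex.I * ξ) • χ ξ :=
        h2.smul_left (f := fun ξ : ℝ => (-2 * Real.pi * Complex.I * ξ : ℂ))
      have k3 : tsupport (fun ξ : ℝ => (-2 * Real.pi * Complex.I * ξ) • χ ξ) ⊆ tsupport χ :=
        tsupport_smul_subset_right (fun ξ : ℝ => (-2 * Real.pi * Complex.I * ξ : ℂ)) χ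
    · exact hg.integral_mul_fourier_eq_zero_left hb.le hC k1 k2 (k3.trans h3)
    · exact hg.integral_mul_fourier_eq_zero_right hb.le hC k1 k2 (k3.trans h3)
  · obtain ⟨C, N, hC⟩ := (hR.2.1 h).1.exists_polynomial_growth (by linarith)
    exact hu.fourier_ae_eq_zero hs hb hG
      (fun χ h1 h2 h3 => hf.integral_mul_fourier_eq_zero_left hb.le hC h1 h2 h3)
      (fun χ h1 h2 h3 => hf.integral_mul_fourier_eq_zero_right hb.le hC h1 h2 h3)

/-! ### Synthesis from the spectrum -/

lemma toReal_eLpNorm_two {α : Type*} [MeasurableSpace α] {μ : Measure α} {f : α → ℂ}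
    (hf : MemLp f 2 μ) : (eLpNorm f 2 μ).toReal ^ 2 = ∫ x, ‖f x‖ ^ 2 ∂μ := by
  rw [hf.eLpNorm_eq_integral_rpow_norm (by norm_num) (by norm_num),
    ENNReal.toReal_ofReal (by positivity)]
  simp only [ENNReal.toReal_ofNat, Real.rpow_two]
  rw [← Real.rpow_natCast, ← Real.rpow_mul (integral_nonneg fun x => by positivity)]
  norm_num

/-- The function whose Fourier transform is `|2πξ|^{-s} G` on `(-b, b]`, normalized by subtracting
its Taylor polynomial at the origin. -/
noncomputable def fracSynth (s b : ℝ) (G : ℝ → ℂ) : ℂ → ℂ :=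
  remTransform b (taylorCount s) fun ξ => ((|2 * Real.pi * ξ| ^ (-s) : ℝ) : ℂ) * G ξ

section fracSynth

variable {s b : ℝ} {G : ℝ → ℂ}

lemma abs_mul_rpow_eq (s : ℝ) (ξ : ℝ) :
    |2 * Real.pi * ξ| ^ s = (2 * Real.pi) ^ s * |ξ| ^ s := by
  have := Real.pi_pos
  rw [abs_mul, abs_of_pos (by positivity : 0 < 2 * Real.pi),
    Real.mul_rpow (by positivity) (abs_nonneg _)]

lemma memLp_pow_mul_weight (s b : ℝ) :
    MemLp (fun ξ : ℝ => (ξ : ℂ) ^ taylorCount s * ((|2 * Real.pi * ξ| ^ (-s) : ℝ) : ℂ)) 2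
      (volume.restrict (Set.Ioc (-b) b)) := by
  set M := taylorCount s with hM
  have hMs := lt_taylorCount s
  have hmeas : AEStronglyMeasurable
      (fun ξ : ℝ => (ξ : ℂ) ^ M * ((|2 * Real.pi * ξ| ^ (-s) : ℝ) : ℂ))
      (volume.restrict (Set.Ioc (-b) b)) :=
    ((by fun_prop : Measurable fun ξ : ℝ => (ξ : ℂ) ^ M).mul
      (measurable_abs_mul_rpow (2 * Real.pi) (-s))).aestronglyMeasurable
  refine (memLp_two_iff_integrable_sq_norm hmeas).2 ?_
  have h := (integrableOn_abs_rpow (r := 2 * (M - s)) (by linarith) b).const_mul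
    (((2 * Real.pi) ^ (-s)) ^ 2)
  refine Integrable.congr h ?_
  filter_upwards [ae_restrict_of_ae ae_ne_zero_real] with ξ hξ
  have hξ' : 0 < |ξ| := abs_pos.2 hξ
  have hpi := Real.pi_pos
  have e : |ξ| ^ (2 * ((M : ℝ) - s)) = (|ξ| ^ M * |ξ| ^ (-s)) ^ 2 := by
    rw [← Real.rpow_natCast |ξ| M, ← Real.rpow_add hξ', ← Real.rpow_natCast, ← Real.rpow_mul hξ'.le]
    congr 1
    push_cast
    ring
  rw [norm_mul, norm_pow, Complex.norm_real, Complex.norm_real, Real.norm_eq_abs ξ,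
    Real.norm_of_nonneg (by positivity : 0 ≤ |2 * Real.pi * ξ| ^ (-s)), abs_mul_rpow_eq, e]
  ring

lemma aestronglyMeasurable_weight_mul
    (hG : MemLp G 2 (volume.restrict (Set.Ioc (-b) b))) :
    AEStronglyMeasurable (fun ξ : ℝ => ((|2 * Real.pi * ξ| ^ (-s) : ℝ) : ℂ) * G ξ)
      (volume.restrict (Set.Ioc (-b) b)) :=
  (measurable_abs_mul_rpow (2 * Real.pi) (-s)).aestronglyMeasurable.mul hG.1

lemma integrableOn_pow_mul_weight_mul (hG : MemLp G 2 (volume.restrict (Set.Ioc (-b) b))) :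
    IntegrableOn (fun ξ : ℝ => (ξ : ℂ) ^ taylorCount s *
      (((|2 * Real.pi * ξ| ^ (-s) : ℝ) : ℂ) * G ξ)) (Set.Ioc (-b) b) := by
  refine ((memLp_pow_mul_weight s b).integrable_mul hG).congr (Eventually.of_forall fun ξ => ?_)
  simp [mul_assoc]

lemma integral_norm_pow_mul_weight_mul_le (hG : MemLp G 2 (volume.restrict (Set.Ioc (-b) b))) :
    ∫ ξ in Set.Ioc (-b) b, ‖(ξ : ℂ) ^ taylorCount s * (((|2 * Real.pi * ξ| ^ (-s) : ℝ) : ℂ) * G ξ)‖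
      ≤ (eLpNorm (fun ξ : ℝ => (ξ : ℂ) ^ taylorCount s * ((|2 * Real.pi * ξ| ^ (-s) : ℝ) : ℂ)) 2
        (volume.restrict (Set.Ioc (-b) b))).toReal
        * (eLpNorm G 2 (volume.restrict (Set.Ioc (-b) b))).toReal := by
  have hw := memLp_pow_mul_weight s b
  set w := fun ξ : ℝ => (ξ : ℂ) ^ taylorCount s * ((|2 * Real.pi * ξ| ^ (-s) : ℝ) : ℂ)
  rw [integral_norm_eq_lintegral_enorm (integrableOn_pow_mul_weight_mul hG).1,
    ← ENNReal.toReal_mul]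
  refine ENNReal.toReal_mono (ENNReal.mul_ne_top hw.2.ne hG.2.ne) ?_
  have := eLpNorm_smul_le_mul_eLpNorm (p := 2) (q := 2) (r := 1) hG.1 hw.1
  rw [eLpNorm_one_eq_lintegral_enorm] at this
  refine le_trans (le_of_eq ?_) this
  congr 1
  funext ξ
  simp [w, mul_assoc]

lemma isEntireExpType_fracSynth (hG : MemLp G 2 (volume.restrict (Set.Ioc (-b) b))) :
    IsEntireExpType (2 * Real.pi * b) (fracSynth s b G) :=
  isEntireExpType_remTransform (aestronglyMeasurable_weight_mul hG)
    (integrableOn_pow_mul_weight_mul hG)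

/-- Point evaluations are bounded on the fractional Paley–Wiener space. -/
lemma norm_fracSynth_le (s b : ℝ) : ∃ C, 0 ≤ C ∧ ∀ (G : ℝ → ℂ),
    MemLp G 2 (volume.restrict (Set.Ioc (-b) b)) → ∀ z,
    ‖fracSynth s b G z‖ ≤ (2 * Real.pi * ‖z‖) ^ taylorCount s * Real.exp (2 * Real.pi * b * ‖z‖)
      * (C * (eLpNorm G 2 (volume.restrict (Set.Ioc (-b) b))).toReal) := by
  refine ⟨(eLpNorm (fun ξ : ℝ => (ξ : ℂ) ^ taylorCount s * ((|2 * Real.pi * ξ| ^ (-s) : ℝ) : ℂ)) 2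
    (volume.restrict (Set.Ioc (-b) b))).toReal, ENNReal.toReal_nonneg, fun G hG z => ?_⟩
  have hpi := Real.pi_pos
  refine (norm_remTransform_le (integrableOn_pow_mul_weight_mul hG) z).trans ?_
  gcongr
  exact integral_norm_pow_mul_weight_mul_le hG

lemma fracSynth_add {G' : ℝ → ℂ} (hG : MemLp G 2 (volume.restrict (Set.Ioc (-b) b)))
    (hG' : MemLp G' 2 (volume.restrict (Set.Ioc (-b) b))) (z : ℂ) :
    fracSynth s b (G + G') z = fracSynth s b G z + fracSynth s b G' z := by
  unfold fracSynth remTransform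
  rw [← integral_add (integrableOn_expRem_mul (aestronglyMeasurable_weight_mul hG)
    (integrableOn_pow_mul_weight_mul hG) z) (integrableOn_expRem_mul
    (aestronglyMeasurable_weight_mul hG') (integrableOn_pow_mul_weight_mul hG') z)]
  congr 1
  funext ξ
  simp only [Pi.add_apply]
  ring

lemma fracSynth_smul (c : ℂ) (z : ℂ) :
    fracSynth s b (c • G) z = c * fracSynth s b G z := by
  unfold fracSynth remTransform
  rw [← integral_const_mul]
  congr 1
  funext ξ
  simp only [Pi.smul_apply, smul_eq_mul]
  ring

lemma fracSynth_congr_ae {G' : ℝ → ℂ} (h : G =ᵐ[volume.restrict (Set.Ioc (-b) b)] G') (z : ℂ) :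
    fracSynth s b G z = fracSynth s b G' z := by
  refine integral_congr_ae ?_
  filter_upwards [h] with ξ hξ
  rw [hξ]

/-- The Fubini formula for the remainder transform is exactly the pairing identity that
characterizes `Δ^{s/2}`. -/
lemma isFracLap_fracSynth (hs : 0 < s) (hG : MemLp G 2 (volume.restrict (Set.Ioc (-b) b)))
    {u : ℝ → ℂ} (hu : L2FourierPair u ((Set.Ioc (-b) b).indicator G)) :
    IsFracLap s (fun x : ℝ => fracSynth s b G x) u := by
  have h1 := aestronglyMeasurable_weight_mul (s := s) hG
  have h2 := integrableOn_pow_mul_weight_mul (s := s) hG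
  refine isFracLap_of_integral_mul_eq hs hu (integrable_remTransform_mul_schwartz h1 h2)
    fun ψ hψ => ?_
  refine (integral_remTransform_mul_schwartz h1 h2 hψ).trans ?_
  rw [← integral_indicator measurableSet_Ioc]
  unfold fracPairing
  congr 1
  funext ξ
  by_cases hξ : ξ ∈ Set.Ioc (-b) b
  · rw [Set.indicator_of_mem hξ, Set.indicator_of_mem hξ]
    ring
  · rw [Set.indicator_of_notMem hξ, Set.indicator_of_notMem hξ, zero_mul]

lemma expRem_zero_right {n : ℕ} (hn : n ≠ 0) : expRem n 0 = 0 := by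
  have := norm_expRem_le n 0
  rw [norm_zero, zero_pow hn, zero_mul] at this
  exact norm_le_zero_iff.1 this

/-- After `k < M` derivatives the kernel is still a remainder of order `M - k ≥ 1`, which is zero at
the origin. -/
lemma iteratedDeriv_fracSynth_zero (hG : MemLp G 2 (volume.restrict (Set.Ioc (-b) b)))
    {k : ℕ} (hk : k < taylorCount s) :
    iteratedDeriv k (fun x : ℝ => fracSynth s b G x) 0 = 0 := by
  unfold fracSynth
  rw [iteratedDeriv_remTransform k _ _ (aestronglyMeasurable_weight_mul hG)
    (integrableOn_pow_mul_weight_mul hG)]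
  simp only [remTransform, Complex.ofReal_zero, mul_zero, zero_mul]
  simp [expRem_zero_right (Nat.sub_ne_zero_of_lt hk)]

lemma taylorCount_eq_floor_add_one (h : 1 / 2 < s) : taylorCount s = ⌊s - 1 / 2⌋₊ + 1 := by
  rw [taylorCount, ← Nat.floor_add_one (by linarith)]
  congr 1
  ring

/-! ### Hölder regularity for `s > 1/2` -/

/-- Near `0` the integrand is of size `|ξ|^{r+2}`, integrable as `r > -3`; at infinity it is bounded
by a multiple of `|ξ|^r`, integrable as `r < -1`. -/
lemma integrable_exp_sub_one_sq_mul_rpow {r : ℝ} (h1 : -3 < r) (h2 : r < -1) :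
    Integrable fun ξ : ℝ => ‖Complex.exp (2 * Real.pi * Complex.I * ξ) - 1‖ ^ 2
      * |2 * Real.pi * ξ| ^ r := by
  have hpi := Real.pi_pos
  have hA : Integrable ((Set.Ioc (-1 : ℝ) 1).indicator fun ξ =>
      (4 * (2 * Real.pi)) ^ 2 * (2 * Real.pi) ^ r * |ξ| ^ (r + 2)) := by
    rw [integrable_indicator_iff measurableSet_Ioc]
    exact (integrableOn_abs_rpow (by linarith) 1).const_mul _
  have hB : Integrable fun ξ : ℝ => 4 * ((2 * Real.pi) ^ r * (2 ^ (-r) * (1 + ‖ξ‖) ^ (-(-r)))) :=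
    (((integrable_one_add_norm (E := ℝ) (μ := volume) (r := -r) (by simp; linarith)).const_mul
      _).const_mul _).const_mul _
  refine (hA.add hB).mono' ?_ ?_
  · refine Measurable.aestronglyMeasurable ?_
    exact (Continuous.measurable (by fun_prop)).mul
      ((measurable_id.const_mul _).abs.pow_const r)
  · filter_upwards [ae_ne_zero_real] with ξ hξ
    have hξ' : 0 < |ξ| := abs_pos.2 hξ
    rw [Real.norm_of_nonneg (by positivity), Pi.add_apply, abs_mul_rpow_eq]
    have hB0 : 0 ≤ 4 * ((2 * Real.pi) ^ r * (2 ^ (-r) * (1 + ‖ξ‖) ^ (-(-r)))) := by positivity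
    by_cases hmem : ξ ∈ Set.Ioc (-1 : ℝ) 1
    · rw [Set.indicator_of_mem hmem]
      refine le_trans ?_ (le_add_of_nonneg_right hB0)
      have := norm_expRem_le_of_re_eq_zero 1 (w := 2 * Real.pi * Complex.I * ξ) (by simp)
      have e := norm_two_pi_I_mul 1 ξ
      rw [mul_one, norm_one, mul_one] at e
      rw [e, pow_one] at this
      simp only [expRem, Finset.range_one, Finset.sum_singleton, pow_zero, Nat.factorial_zero,
        Nat.cast_one, div_one] at this
      rw [Real.rpow_add hξ', Real.rpow_two]
      calc _ ≤ (4 * (2 * Real.pi * |ξ|)) ^ 2 * ((2 * Real.pi) ^ r * |ξ| ^ r) := by gcongr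
        _ = _ := by ring
    · rw [Set.indicator_of_notMem hmem, zero_add]
      have h3 : 1 ≤ |ξ| := by
        by_contra! h
        rw [abs_lt] at h
        exact hmem ⟨h.1, h.2.le⟩
      have h4 : ‖Complex.exp (2 * Real.pi * Complex.I * ξ) - 1‖ ≤ 2 := by
        refine (norm_sub_le _ _).trans ?_
        rw [Complex.norm_exp]
        simp
        norm_num
      have h5 : |ξ| ^ r ≤ 2 ^ (-r) * (1 + ‖ξ‖) ^ (-(-r)) := by
        rw [neg_neg, Real.rpow_neg (by norm_num), ← Real.inv_rpow (by norm_num),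
          ← Real.mul_rpow (by norm_num) (by positivity)]
        refine Real.rpow_le_rpow_of_nonpos (by positivity) ?_ (by linarith)
        rw [Real.norm_eq_abs]
        linarith
      calc _ ≤ 2 ^ 2 * ((2 * Real.pi) ^ r * |ξ| ^ r) := by gcongr
        _ ≤ 2 ^ 2 * ((2 * Real.pi) ^ r * (2 ^ (-r) * (1 + ‖ξ‖) ^ (-(-r)))) := by gcongr
        _ = _ := by norm_num

lemma integral_exp_sub_one_sq_mul_rpow_scale (r : ℝ) {h : ℝ} (hh : h ≠ 0) :
    ∫ ξ : ℝ, ‖Complex.exp (2 * Real.pi * Complex.I * h * ξ) - 1‖ ^ 2 * |2 * Real.pi * ξ| ^ r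
      = |h| ^ (-r - 1) * ∫ ξ : ℝ, ‖Complex.exp (2 * Real.pi * Complex.I * ξ) - 1‖ ^ 2
        * |2 * Real.pi * ξ| ^ r := by
  have hh' : 0 < |h| := abs_pos.2 hh
  have := Measure.integral_comp_mul_left (fun ξ : ℝ =>
    ‖Complex.exp (2 * Real.pi * Complex.I * ξ) - 1‖ ^ 2 * |2 * Real.pi * ξ| ^ r) h
  have e : ∀ ξ : ℝ, ‖Complex.exp (2 * Real.pi * Complex.I * h * ξ) - 1‖ ^ 2 * |2 * Real.pi * ξ| ^ r
      = |h| ^ (-r) * (‖Complex.exp (2 * Real.pi * Complex.I * (h * ξ : ℝ)) - 1‖ ^ 2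
        * |2 * Real.pi * (h * ξ)| ^ r) := fun ξ => by
    rw [show 2 * Real.pi * (h * ξ) = h * (2 * Real.pi * ξ) by ring, abs_mul h,
      Real.mul_rpow hh'.le (abs_nonneg _), Real.rpow_neg hh'.le]
    have : |h| ^ r ≠ 0 := (Real.rpow_pos_of_pos hh' _).ne'
    rw [show (2 * Real.pi * Complex.I * (h * ξ : ℝ) : ℂ) = 2 * Real.pi * Complex.I * h * ξ by
      push_cast; ring]
    field_simp
  simp_rw [e]
  rw [integral_const_mul, this, smul_eq_mul, ← mul_assoc, Real.rpow_sub hh', Real.rpow_one, abs_inv]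
  rfl

/-- In the `m`-th derivative the kernel is `exp - 1`, and the constant cancels in a difference.
Cauchy–Schwarz bounds the difference by the norm of `G` times the `L²` norm of the kernel
difference, and the substitution `ξ ↦ (x - y) ξ` shows that norm to be `√K |x - y|^{s-1/2-m}`. As `s
- 1/2` is not an integer, `r = 2m - 2s` lies strictly between `-3` and `-1`, so `K` is finite. -/
lemma homLipschitz_fracSynth (h : 1 / 2 < s) (hs' : ∀ k : ℕ, s - 1 / 2 ≠ k)
    (hG : MemLp G 2 (volume.restrict (Set.Ioc (-b) b))) :
    HomLipschitz (s - 1 / 2) fun x : ℝ => fracSynth s b G x := by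
  have hpi := Real.pi_pos
  set m := ⌊s - 1 / 2⌋₊ with hm
  have hm1 : (m : ℝ) < s - 1 / 2 :=
    lt_of_le_of_ne (Nat.floor_le (by linarith)) (hs' m).symm
  have hm2 : s - 1 / 2 < m + 1 := Nat.lt_floor_add_one _
  have hM := taylorCount_eq_floor_add_one h
  rw [← hm] at hM
  have hd := (isEntireExpType_fracSynth (s := s) hG).1
  refine ⟨?_, ?_⟩
  · have h1 : ContDiff ℝ m (fracSynth s b G) := (hd.contDiff (n := m)).restrict_scalars ℝ
    exact h1.comp Complex.ofRealCLM.contDiff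
  set r : ℝ := 2 * m - 2 * s with hr
  set K := ∫ ξ : ℝ, ‖Complex.exp (2 * Real.pi * Complex.I * ξ) - 1‖ ^ 2 * |2 * Real.pi * ξ| ^ r
  have hKi := integrable_exp_sub_one_sq_mul_rpow (r := r) (by linarith) (by linarith)
  refine ⟨√K * (eLpNorm G 2 (volume.restrict (Set.Ioc (-b) b))).toReal, fun x y => ?_⟩
  rw [← hm]
  rcases eq_or_ne x y with rfl | hxy
  · rw [sub_self, norm_zero]; positivity
  have hh : x - y ≠ 0 := sub_ne_zero.2 hxy
  have hD : iteratedDeriv m (fun x : ℝ => fracSynth s b G x) = fun x : ℝ => remTransform b 1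
      (fun ξ : ℝ => (2 * Real.pi * Complex.I * ξ) ^ m *
        (((|2 * Real.pi * ξ| ^ (-s) : ℝ) : ℂ) * G ξ)) x := by
    unfold fracSynth
    rw [iteratedDeriv_remTransform m _ _ (aestronglyMeasurable_weight_mul hG)
      (integrableOn_pow_mul_weight_mul hG), hM, Nat.add_sub_cancel_left]
  set H : ℝ → ℂ := fun ξ : ℝ => (2 * Real.pi * Complex.I * ξ) ^ m *
        (((|2 * Real.pi * ξ| ^ (-s) : ℝ) : ℂ) * G ξ) with hHdef
  have hHm : AEStronglyMeasurable H (volume.restrict (Set.Ioc (-b) b)) :=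
    (Continuous.aestronglyMeasurable (by fun_prop)).mul (aestronglyMeasurable_weight_mul hG)
  have hHi : IntegrableOn (fun ξ : ℝ => (ξ : ℂ) ^ 1 * H ξ) (Set.Ioc (-b) b) := by
    have := (integrableOn_pow_mul_weight_mul (s := s) hG).const_mul
      ((2 * Real.pi * Complex.I) ^ m)
    refine this.congr (Eventually.of_forall fun ξ => ?_)
    simp only [hHdef, hM, mul_pow, pow_succ]
    ring
  set w : ℝ → ℂ := fun ξ => (Complex.exp (2 * Real.pi * Complex.I * x * ξ)
    - Complex.exp (2 * Real.pi * Complex.I * y * ξ)) *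
      ((2 * Real.pi * Complex.I * ξ) ^ m * ((|2 * Real.pi * ξ| ^ (-s) : ℝ) : ℂ)) with hw
  have hwn : ∀ ξ : ℝ, ξ ≠ 0 → ‖w ξ‖ ^ 2 = ‖Complex.exp (2 * Real.pi * Complex.I * (x - y : ℝ) * ξ) - 1‖ ^ 2
      * |2 * Real.pi * ξ| ^ r := fun ξ hξ => by
    have hne : 0 < |2 * Real.pi * ξ| := abs_pos.2 (by positivity)
    have e1 : Complex.exp (2 * Real.pi * Complex.I * x * ξ)
        - Complex.exp (2 * Real.pi * Complex.I * y * ξ)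
        = Complex.exp (2 * Real.pi * Complex.I * y * ξ)
          * (Complex.exp (2 * Real.pi * Complex.I * (x - y : ℝ) * ξ) - 1) := by
      rw [mul_sub, mul_one, ← Complex.exp_add]
      congr 2
      push_cast
      ring
    have e2 : ‖Complex.exp (2 * Real.pi * Complex.I * y * ξ)‖ = 1 := by
      rw [Complex.norm_exp]; simp
    have e3 : ‖(2 * Real.pi * Complex.I * ξ : ℂ)‖ = |2 * Real.pi * ξ| := by
      have e := norm_two_pi_I_mul 1 ξ
      rw [mul_one, norm_one, mul_one] at e
      rw [e, abs_mul, abs_of_pos (by positivity : 0 < 2 * Real.pi)]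
    simp only [hw]
    rw [e1, norm_mul, norm_mul, e2, one_mul, mul_pow, norm_mul, norm_pow, e3, Complex.norm_real,
      Real.norm_of_nonneg (by positivity), ← Real.rpow_natCast |2 * Real.pi * ξ| m,
      ← Real.rpow_add hne, ← Real.rpow_natCast (|2 * Real.pi * ξ| ^ _), ← Real.rpow_mul hne.le]
    congr 2
    rw [hr]
    push_cast
    ring
  have hwm : AEStronglyMeasurable w volume :=
    (Continuous.aestronglyMeasurable (by fun_prop)).mul
      ((Continuous.aestronglyMeasurable (by fun_prop)).mul
        (measurable_abs_mul_rpow (2 * Real.pi) (-s)).aestronglyMeasurable)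
  have hint : Integrable fun ξ : ℝ => ‖Complex.exp (2 * Real.pi * Complex.I * (x - y : ℝ) * ξ) - 1‖ ^ 2
      * |2 * Real.pi * ξ| ^ r := by
    have hx' : 0 < |x - y| := abs_pos.2 hh
    refine ((hKi.comp_mul_left' hh).const_mul (|x - y| ^ (-r))).congr
      (Eventually.of_forall fun ξ => ?_)
    simp only
    rw [show 2 * Real.pi * ((x - y) * ξ) = (x - y) * (2 * Real.pi * ξ) by ring, abs_mul (x - y),
      Real.mul_rpow hx'.le (abs_nonneg _), Real.rpow_neg hx'.le]
    have : |x - y| ^ r ≠ 0 := (Real.rpow_pos_of_pos hx' _).ne'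
    rw [show (2 * Real.pi * Complex.I * ((x - y) * ξ : ℝ) : ℂ)
      = 2 * Real.pi * Complex.I * (x - y : ℝ) * ξ by push_cast; ring]
    field_simp
  have hwL : MemLp w 2 volume := by
    refine (memLp_two_iff_integrable_sq_norm hwm).2 (hint.congr ?_)
    filter_upwards [ae_ne_zero_real] with ξ hξ using (hwn ξ hξ).symm
  have hwv : (eLpNorm w 2 volume).toReal = √K * |x - y| ^ (s - 1 / 2 - m) := by
    have hK0 : 0 ≤ K := integral_nonneg fun ξ => by positivity
    have hx' : 0 < |x - y| := abs_pos.2 hh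
    refine (sq_eq_sq₀ ENNReal.toReal_nonneg (by positivity)).1 ?_
    rw [toReal_eLpNorm_two hwL, mul_pow, Real.sq_sqrt hK0]
    have : ∫ ξ, ‖w ξ‖ ^ 2 = ∫ ξ : ℝ, ‖Complex.exp (2 * Real.pi * Complex.I * (x - y : ℝ) * ξ) - 1‖ ^ 2
      * |2 * Real.pi * ξ| ^ r := by
      refine integral_congr_ae ?_
      filter_upwards [ae_ne_zero_real] with ξ hξ using hwn ξ hξ
    rw [this, integral_exp_sub_one_sq_mul_rpow_scale r hh, mul_comm K,
      ← Real.rpow_natCast (|x - y| ^ _), ← Real.rpow_mul hx'.le]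
    congr 2
    rw [hr]
    push_cast
    ring
  have e : remTransform b 1 H x - remTransform b 1 H y = ∫ ξ in Set.Ioc (-b) b, w ξ * G ξ := by
    unfold remTransform
    rw [← integral_sub (integrableOn_expRem_mul hHm hHi x) (integrableOn_expRem_mul hHm hHi y)]
    congr 1
    funext ξ
    simp only [hHdef, hw, expRem, Finset.range_one, Finset.sum_singleton, pow_zero]
    ring
  rw [hD]
  simp only
  rw [e]
  refine (norm_integral_mul_le (hwL.restrict _) hG).trans ?_
  have hmono : (eLpNorm w 2 (volume.restrict (Set.Ioc (-b) b))).toReal ≤ (eLpNorm w 2 volume).toReal :=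
    ENNReal.toReal_mono hwL.2.ne (eLpNorm_mono_measure w Measure.restrict_le_self)
  rw [hwv] at hmono
  calc _ ≤ (√K * |x - y| ^ (s - 1 / 2 - m))
        * (eLpNorm G 2 (volume.restrict (Set.Ioc (-b) b))).toReal := by gcongr
    _ = _ := by ring

end fracSynth

/-! ### Sobolev embedding for `s < 1/2` -/

section SobolevEmbedding

variable {s b : ℝ} {G : ℝ → ℂ}

lemma integral_abs_rpow {r A : ℝ} (hr : -1 < r) (hA : 0 < A) :
    ∫ ξ in Set.Ioc (-A) A, |ξ| ^ r = 2 * (A ^ (r + 1) / (r + 1)) := by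
  have hi := (intervalIntegrable_iff_integrableOn_Ioc_of_le (by linarith : -A ≤ A)).2
    (integrableOn_abs_rpow hr A)
  have h0 : (0 : ℝ) ∈ Set.uIcc (-A) A := by
    rw [Set.uIcc_of_le (by linarith)]; exact ⟨by linarith, hA.le⟩
  have i1 : IntervalIntegrable (fun ξ : ℝ => |ξ| ^ r) volume (-A) 0 :=
    hi.mono_set (Set.uIcc_subset_uIcc_left h0)
  have i2 : IntervalIntegrable (fun ξ : ℝ => |ξ| ^ r) volume 0 A :=
    hi.mono_set (Set.uIcc_subset_uIcc_right h0)
  rw [← intervalIntegral.integral_of_le (by linarith),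
    ← intervalIntegral.integral_add_adjacent_intervals i1 i2]
  have e2 : ∫ ξ in (0 : ℝ)..A, |ξ| ^ r = A ^ (r + 1) / (r + 1) := by
    have : ∫ ξ in (0 : ℝ)..A, |ξ| ^ r = ∫ ξ in (0 : ℝ)..A, ξ ^ r := by
      refine intervalIntegral.integral_congr fun ξ hξ => ?_
      rw [Set.uIcc_of_le hA.le] at hξ
      simp only [abs_of_nonneg hξ.1]
    rw [this, integral_rpow (Or.inl hr), Real.zero_rpow (by linarith), sub_zero]
  have e1 : ∫ ξ in (-A)..0, |ξ| ^ r = ∫ ξ in (0 : ℝ)..A, |ξ| ^ r := by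
    have := intervalIntegral.integral_comp_neg (f := fun ξ : ℝ => |ξ| ^ r) (a := 0) (b := A)
    simp only [abs_neg, neg_zero] at this
    exact this.symm
  rw [e1, e2]
  ring

lemma memLp_weight (hs : s < 1 / 2) (A : ℝ) :
    MemLp (fun ξ : ℝ => ((|2 * Real.pi * ξ| ^ (-s) : ℝ) : ℂ)) 2
      (volume.restrict (Set.Ioc (-A) A)) := by
  refine (memLp_two_iff_integrable_sq_norm
    (measurable_abs_mul_rpow (2 * Real.pi) (-s)).aestronglyMeasurable).2 ?_
  refine ((integrableOn_abs_rpow (r := -(2 * s)) (by linarith) A).const_mul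
    ((2 * Real.pi) ^ (-(2 * s)))).congr (Eventually.of_forall fun ξ => ?_)
  simp only
  rw [Complex.norm_real, Real.norm_of_nonneg (by positivity), ← Real.rpow_natCast,
    ← Real.rpow_mul (abs_nonneg _), ← abs_mul_rpow_eq]
  congr 1
  push_cast
  ring

lemma toReal_eLpNorm_weight_sq (hs : s < 1 / 2) {A : ℝ} (hA : 0 < A) :
    (eLpNorm (fun ξ : ℝ => ((|2 * Real.pi * ξ| ^ (-s) : ℝ) : ℂ)) 2
      (volume.restrict (Set.Ioc (-A) A))).toReal ^ 2
      = (2 * Real.pi) ^ (-(2 * s)) * (2 / (1 - 2 * s)) * A ^ (1 - 2 * s) := by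
  rw [toReal_eLpNorm_two (memLp_weight hs A)]
  have : ∀ ξ : ℝ, ‖((|2 * Real.pi * ξ| ^ (-s) : ℝ) : ℂ)‖ ^ 2
      = (2 * Real.pi) ^ (-(2 * s)) * |ξ| ^ (-(2 * s)) := fun ξ => by
    rw [Complex.norm_real, Real.norm_of_nonneg (by positivity), ← Real.rpow_natCast,
      ← Real.rpow_mul (abs_nonneg _), ← abs_mul_rpow_eq]
    congr 1
    push_cast
    ring
  simp_rw [this]
  rw [integral_const_mul, integral_abs_rpow (by linarith) hA,
    show -(2 * s) + 1 = 1 - 2 * s by ring]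
  ring

lemma lintegral_Ioc_rpow {q c : ℝ} (hq : -1 < q) (hc : 0 ≤ c) :
    ∫⁻ t in Set.Ioc 0 c, ENNReal.ofReal (t ^ q) = ENNReal.ofReal (c ^ (q + 1) / (q + 1)) := by
  have hi : IntegrableOn (fun t : ℝ => t ^ q) (Set.Ioc 0 c) :=
    (intervalIntegrable_iff_integrableOn_Ioc_of_le hc).1
      (intervalIntegral.intervalIntegrable_rpow' hq)
  rw [← ofReal_integral_eq_lintegral_ofReal hi, ← intervalIntegral.integral_of_le hc,
    integral_rpow (Or.inl hq), Real.zero_rpow (by linarith), sub_zero]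
  filter_upwards [ae_restrict_mem measurableSet_Ioc] with t ht
  exact Real.rpow_nonneg ht.1.le q

lemma taylorCount_eq_zero (hs : s < 1 / 2) : taylorCount s = 0 := by
  rw [taylorCount, Nat.floor_eq_zero]
  linarith

lemma integrable_indicator_weight_mul (hs : s < 1 / 2)
    (hG : MemLp G 2 (volume.restrict (Set.Ioc (-b) b))) (A : ℝ) :
    Integrable (fun ξ => (Set.Ioc (-A) A).indicator
      (fun ξ => ((|2 * Real.pi * ξ| ^ (-s) : ℝ) : ℂ)) ξ * G ξ)
      (volume.restrict (Set.Ioc (-b) b)) :=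
  (((memLp_indicator_iff_restrict measurableSet_Ioc).2 (memLp_weight hs A)).restrict
    _).integrable_mul hG

lemma integral_norm_indicator_weight_mul_le (hs : s < 1 / 2)
    (hG : MemLp G 2 (volume.restrict (Set.Ioc (-b) b))) {A : ℝ} (hA : 0 < A) :
    ∫ ξ in Set.Ioc (-b) b, ‖(Set.Ioc (-A) A).indicator
        (fun ξ => ((|2 * Real.pi * ξ| ^ (-s) : ℝ) : ℂ)) ξ * G ξ‖ ≤
      √((2 * Real.pi) ^ (-(2 * s)) * (2 / (1 - 2 * s))) * A ^ (1 / 2 - s)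
        * (eLpNorm G 2 (volume.restrict (Set.Ioc (-b) b))).toReal := by
  have hpi := Real.pi_pos
  set w : ℝ → ℂ := fun ξ => ((|2 * Real.pi * ξ| ^ (-s) : ℝ) : ℂ) with hw
  set μ := volume.restrict (Set.Ioc (-b) b)
  have hwA : MemLp ((Set.Ioc (-A) A).indicator w) 2 volume :=
    (memLp_indicator_iff_restrict measurableSet_Ioc).2 (memLp_weight hs A)
  have hcs : ∫ ξ, ‖(Set.Ioc (-A) A).indicator w ξ * G ξ‖ ∂μ ≤
      (eLpNorm ((Set.Ioc (-A) A).indicator w) 2 μ).toReal * (eLpNorm G 2 μ).toReal := by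
    rw [integral_norm_eq_lintegral_enorm (integrable_indicator_weight_mul hs hG A).1,
      ← ENNReal.toReal_mul]
    refine ENNReal.toReal_mono (ENNReal.mul_ne_top (hwA.restrict _).2.ne hG.2.ne) ?_
    have := eLpNorm_smul_le_mul_eLpNorm (p := 2) (q := 2) (r := 1) hG.1
      (hwA.restrict (Set.Ioc (-b) b)).1
    rw [eLpNorm_one_eq_lintegral_enorm] at this
    exact this
  refine hcs.trans ?_
  gcongr
  have h1 : (eLpNorm ((Set.Ioc (-A) A).indicator w) 2 μ).toReal
      ≤ (eLpNorm w 2 (volume.restrict (Set.Ioc (-A) A))).toReal := by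
    have e := eLpNorm_indicator_eq_eLpNorm_restrict (f := w) (p := 2) (μ := volume)
      (measurableSet_Ioc (a := -A) (b := A))
    rw [← e]
    exact ENNReal.toReal_mono hwA.2.ne (eLpNorm_mono_measure _ Measure.restrict_le_self)
  refine h1.trans ?_
  have h12 : 0 < 1 - 2 * s := by linarith
  refine (sq_le_sq₀ ENNReal.toReal_nonneg (by positivity)).1 ?_
  rw [toReal_eLpNorm_weight_sq hs hA, mul_pow, Real.sq_sqrt (by positivity),
    ← Real.rpow_natCast (A ^ _), ← Real.rpow_mul hA.le]
  refine le_of_eq ?_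
  congr 2
  push_cast
  ring

/-- The low frequencies of `f = 𝓕⁻ (|2πξ|^{-s} G)` are bounded by `t / 2`; the rest is controlled
by Plancherel and Chebyshev. -/
lemma volume_lt_norm_fracSynth_le (hs : s < 1 / 2)
    (hG : MemLp G 2 (volume.restrict (Set.Ioc (-b) b))) {K : ℝ} (hK0 : 0 < K)
    (hK : √((2 * Real.pi) ^ (-(2 * s)) * (2 / (1 - 2 * s)))
      * (eLpNorm G 2 (volume.restrict (Set.Ioc (-b) b))).toReal ≤ K) {t : ℝ} (ht : 0 < t) :
    ENNReal.ofReal (t / 2) ^ 2 * volume {x : ℝ | t < ‖fracSynth s b G x‖}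
      ≤ ∫⁻ ξ in Set.Ioc (-b) b, {ξ : ℝ | t ≤ 2 * K * |ξ| ^ (1 / 2 - s)}.indicator
        (fun ξ => ‖((|2 * Real.pi * ξ| ^ (-s) : ℝ) : ℂ) * G ξ‖ₑ ^ 2) ξ := by
  have hpi := Real.pi_pos
  set μ := volume.restrict (Set.Ioc (-b) b) with hμ
  set H : ℝ → ℂ := fun ξ => ((|2 * Real.pi * ξ| ^ (-s) : ℝ) : ℂ) * G ξ with hH
  set S : Set ℝ := {ξ : ℝ | t ≤ 2 * K * |ξ| ^ (1 / 2 - s)} with hS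
  have hSm : MeasurableSet S := measurableSet_le measurable_const
    ((measurable_id.abs.pow_const _).const_mul _)
  have hHi : Integrable H μ := (memLp_weight hs b).integrable_mul hG
  -- The cutoff frequency solves `K A^{1/2-s} = t / 2`, so that the frequencies below `A` contribute
  -- at most `t / 2` pointwise.
  set A : ℝ := (t / (2 * K)) ^ (1 / (1 / 2 - s)) with hA
  have hA0 : 0 < A := by positivity
  have hσ : 0 < 1 / 2 - s := by linarith
  have hSc : ∀ ξ ∉ S, ξ ∈ Set.Ioc (-A) A := fun ξ hξ => by
    have h1 : |ξ| ^ (1 / 2 - s) < t / (2 * K) := by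
      rw [lt_div_iff₀ (by positivity), mul_comm]
      exact not_le.1 hξ
    have h2 : |ξ| < A := by
      rw [hA, one_div (1 / 2 - s)]
      exact (Real.lt_rpow_inv_iff_of_pos (abs_nonneg _) (by positivity) hσ).2 h1
    rw [abs_lt] at h2
    exact ⟨h2.1, h2.2.le⟩
  have hSA : ∀ ξ ∈ S, A ≤ |ξ| := fun ξ hξ => by
    have h1 : t / (2 * K) ≤ |ξ| ^ (1 / 2 - s) := by
      rw [div_le_iff₀ (by positivity), mul_comm]
      exact hξ
    rw [hA, one_div (1 / 2 - s)]
    exact (Real.rpow_inv_le_iff_of_pos (by positivity) (abs_nonneg _) hσ).2 h1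
  -- the high frequency part
  set Hh : ℝ → ℂ := (Set.Ioc (-b) b).indicator (S.indicator H) with hHh
  have hHh1 : Integrable Hh := (integrable_indicator_iff measurableSet_Ioc).2 (hHi.indicator hSm)
  have hHh2 : MemLp Hh 2 volume := by
    rw [memLp_indicator_iff_restrict measurableSet_Ioc]
    refine (hG.const_mul ((|2 * Real.pi * A| ^ (-s) + |2 * Real.pi * b| ^ (-s) : ℝ) : ℂ)).mono
      (hHi.1.indicator hSm) ?_
    filter_upwards [ae_restrict_mem measurableSet_Ioc] with ξ hξ
    have hξb : |ξ| ≤ b := abs_le.2 ⟨hξ.1.le, hξ.2⟩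
    by_cases hξS : ξ ∈ S
    · rw [Set.indicator_of_mem hξS, norm_mul, norm_mul, Complex.norm_real, Complex.norm_real,
        Real.norm_of_nonneg (by positivity), Real.norm_of_nonneg (by positivity)]
      refine mul_le_mul_of_nonneg_right ?_ (norm_nonneg _)
      have hξA := hSA ξ hξS
      have hξ0 : 0 < |ξ| := hA0.trans_le hξA
      -- On `A ≤ |ξ| ≤ b` the weight is monotone in `|ξ|`, hence bounded by its value at one of the
      -- ends; the sum of both values covers either sign of `s`.
      rcases le_total 0 s with h0 | h0
      · refine le_trans ?_ (le_add_of_nonneg_right (by positivity))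
        refine Real.rpow_le_rpow_of_nonpos (by positivity) ?_ (by linarith)
        rw [abs_mul, abs_mul _ ξ, abs_of_pos hA0]
        gcongr
      · refine le_trans ?_ (le_add_of_nonneg_left (by positivity))
        refine Real.rpow_le_rpow (by positivity) ?_ (by linarith)
        rw [abs_mul, abs_mul _ b]
        exact mul_le_mul_of_nonneg_left (hξb.trans (le_abs_self b)) (abs_nonneg _)
    · rw [Set.indicator_of_notMem hξS, norm_zero]
      positivity
  have hpair := L2FourierPair.fourierInv hHh1 hHh2
  -- the low frequency part
  have hlow : ∀ x : ℝ, ‖fracSynth s b G x - 𝓕⁻ Hh x‖ ≤ t / 2 := fun x => by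
    have e1 : 𝓕⁻ Hh x = ∫ ξ, Complex.exp (2 * Real.pi * Complex.I * x * ξ) * S.indicator H ξ ∂μ := by
      rw [Real.fourierInv_eq', hμ, ← integral_indicator measurableSet_Ioc]
      congr 1
      funext ξ
      rw [hHh]
      by_cases hξ : ξ ∈ Set.Ioc (-b) b
      · rw [Set.indicator_of_mem hξ, Set.indicator_of_mem hξ, smul_eq_mul]
        congr 2
        simp only [RCLike.inner_apply, conj_trivial]
        push_cast
        ring
      · rw [Set.indicator_of_notMem hξ, Set.indicator_of_notMem hξ, smul_zero]
    have hb1 : ∀ (F : ℝ → ℂ), Integrable F μ →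
        Integrable (fun ξ : ℝ => Complex.exp (2 * Real.pi * Complex.I * x * ξ) * F ξ) μ :=
      fun F hF => by
        refine hF.bdd_mul (c := 1) (Continuous.aestronglyMeasurable (by fun_prop))
          (Eventually.of_forall fun ξ => ?_)
        rw [Complex.norm_exp]
        simp
    have e2 : fracSynth s b G x = ∫ ξ, Complex.exp (2 * Real.pi * Complex.I * x * ξ) * H ξ ∂μ := by
      unfold fracSynth remTransform
      simp only [taylorCount_eq_zero hs, expRem, Finset.range_zero, Finset.sum_empty, sub_zero]
      rfl
    rw [e1, e2, ← integral_sub (hb1 _ hHi) (hb1 _ (hHi.indicator hSm))]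
    have e3 : ∀ ξ : ℝ, ‖Complex.exp (2 * Real.pi * Complex.I * x * ξ) * H ξ
        - Complex.exp (2 * Real.pi * Complex.I * x * ξ) * S.indicator H ξ‖ ≤
        ‖(Set.Ioc (-A) A).indicator (fun ξ => ((|2 * Real.pi * ξ| ^ (-s) : ℝ) : ℂ)) ξ * G ξ‖ :=
      fun ξ => by
        by_cases hξ : ξ ∈ S
        · rw [Set.indicator_of_mem hξ, sub_self, norm_zero]
          exact norm_nonneg _
        · rw [Set.indicator_of_notMem hξ, mul_zero, sub_zero, norm_mul, Complex.norm_exp,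
            Set.indicator_of_mem (hSc ξ hξ)]
          simp [hH]
    refine (norm_integral_le_of_norm_le (integrable_indicator_weight_mul hs hG A).norm
      (Eventually.of_forall e3)).trans ?_
    refine (integral_norm_indicator_weight_mul_le hs hG hA0).trans ?_
    have : A ^ (1 / 2 - s) = t / (2 * K) := by
      rw [hA, one_div (1 / 2 - s), Real.rpow_inv_rpow (by positivity) hσ.ne']
    rw [this]
    calc _ = (√((2 * Real.pi) ^ (-(2 * s)) * (2 / (1 - 2 * s))) * (eLpNorm G 2 μ).toReal)
          * (t / (2 * K)) := by ring
      _ ≤ K * (t / (2 * K)) := by gcongr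
      _ = t / 2 := by field_simp
  have hsub : {x : ℝ | t < ‖fracSynth s b G x‖} ⊆ {x : ℝ | ENNReal.ofReal (t / 2) ≤ ‖𝓕⁻ Hh x‖ₑ} :=
    fun x hx => by
      have h1 : t < ‖fracSynth s b G x‖ := hx
      have h2 := hlow x
      have h3 := norm_sub_norm_le (fracSynth s b G x) (𝓕⁻ Hh x)
      change ENNReal.ofReal (t / 2) ≤ ‖𝓕⁻ Hh x‖ₑ
      rw [← ofReal_norm]
      exact ENNReal.ofReal_le_ofReal (by linarith)
  have hcheb := mul_meas_ge_le_pow_eLpNorm' volume (p := 2) (by norm_num) (by norm_num)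
    hpair.1.1 (ENNReal.ofReal (t / 2))
  rw [hpair.eLpNorm_eq] at hcheb
  calc _ ≤ ENNReal.ofReal (t / 2) ^ 2 * volume {x : ℝ | ENNReal.ofReal (t / 2) ≤ ‖𝓕⁻ Hh x‖ₑ} := by
        gcongr
    _ ≤ eLpNorm Hh 2 volume ^ 2 := by
        simpa using hcheb
    _ = ∫⁻ ξ in Set.Ioc (-b) b, ‖S.indicator H ξ‖ₑ ^ 2 := by
        rw [hHh, eLpNorm_indicator_eq_eLpNorm_restrict measurableSet_Ioc,
          eLpNorm_eq_lintegral_rpow_enorm_toReal (by norm_num) (by norm_num), ENNReal.toReal_ofNat,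
          ← ENNReal.rpow_natCast, ← ENNReal.rpow_mul]
        norm_num
    _ = _ := by
        congr 1
        funext ξ
        by_cases hξ : ξ ∈ S
        · rw [Set.indicator_of_mem hξ, Set.indicator_of_mem hξ]
        · rw [Set.indicator_of_notMem hξ, Set.indicator_of_notMem hξ]
          simp

/-- The Sobolev embedding `Ḣ^s ⊆ L^p`, `1/p = 1/2 - s`, for band-limited functions. -/
lemma memLp_fracSynth (hs0 : 0 < s) (hs : s < 1 / 2)
    (hG : MemLp G 2 (volume.restrict (Set.Ioc (-b) b))) :
    MemLp (fun x : ℝ => fracSynth s b G x) (ENNReal.ofReal (1 / (1 / 2 - s))) volume := by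
  have hpi := Real.pi_pos
  set p : ℝ := 1 / (1 / 2 - s) with hp
  have hσ : 0 < 1 / 2 - s := by linarith
  have hp0 : 0 < p := by positivity
  have hp2 : 2 < p := by
    rw [hp, lt_div_iff₀ hσ]; linarith
  set μ := volume.restrict (Set.Ioc (-b) b) with hμ
  set H : ℝ → ℂ := fun ξ => ((|2 * Real.pi * ξ| ^ (-s) : ℝ) : ℂ) * G ξ with hH
  have hHm : AEStronglyMeasurable H μ := aestronglyMeasurable_weight_mul hG
  set c := √((2 * Real.pi) ^ (-(2 * s)) * (2 / (1 - 2 * s)))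
  -- The summand `1` keeps `K` positive when `G` vanishes.
  set K := c * (eLpNorm G 2 μ).toReal + 1 with hK
  have hK0 : 0 < K := by positivity
  have hfc : Continuous fun x : ℝ => fracSynth s b G x :=
    (isEntireExpType_fracSynth (s := s) hG).1.continuous.comp Complex.continuous_ofReal
  refine ⟨hfc.aestronglyMeasurable, ?_⟩
  rw [eLpNorm_lt_top_iff_lintegral_rpow_enorm_lt_top (by simpa using hp0) ENNReal.ofReal_ne_top,
    ENNReal.toReal_ofReal hp0.le]
  have e0 : ∀ x : ℝ, ‖fracSynth s b G x‖ₑ ^ p = ENNReal.ofReal (‖fracSynth s b G x‖ ^ p) :=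
    fun x => by
      rw [← ofReal_norm, ENNReal.ofReal_rpow_of_nonneg (norm_nonneg _) hp0.le]
  simp_rw [e0]
  -- Layer-cake formula. The estimate of the level sets turns it into a double integral in `(t, ξ)`,
  -- and the `t`-integral is then carried out first.
  rw [lintegral_rpow_eq_lintegral_meas_lt_mul volume (Eventually.of_forall fun x => norm_nonneg _)
    hfc.norm.aemeasurable hp0]
  refine ENNReal.mul_lt_top ENNReal.ofReal_lt_top ?_
  set Φ : ℝ → ℝ → ℝ≥0∞ := fun t ξ => {q : ℝ × ℝ | q.1 ≤ 2 * K * |q.2| ^ (1 / 2 - s)}.indicator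
    (fun q => ENNReal.ofReal (4 * q.1 ^ (p - 3)) * ‖H q.2‖ₑ ^ 2) (t, ξ) with hΦ
  have hstep : ∀ t ∈ Set.Ioi (0 : ℝ), volume {x : ℝ | t < ‖fracSynth s b G x‖}
      * ENNReal.ofReal (t ^ (p - 1)) ≤ ∫⁻ ξ, Φ t ξ ∂μ := fun t ht => by
    have ht' : 0 < t := ht
    have h1 := volume_lt_norm_fracSynth_le hs hG hK0 (by linarith) ht'
    have e1 : t ^ (p - 1) = (t / 2) ^ 2 * (4 * t ^ (p - 3)) := by
      have : t ^ (p - 1) = t ^ (p - 3) * t ^ 2 := by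
        rw [← Real.rpow_natCast, ← Real.rpow_add ht']
        congr 1
        push_cast
        ring
      rw [this]; ring
    have e2 : ENNReal.ofReal (t ^ (p - 1))
        = ENNReal.ofReal (t / 2) ^ 2 * ENNReal.ofReal (4 * t ^ (p - 3)) := by
      rw [e1, ENNReal.ofReal_mul (by positivity), ENNReal.ofReal_pow (by positivity)]
    calc _ = ENNReal.ofReal (4 * t ^ (p - 3)) *
          (ENNReal.ofReal (t / 2) ^ 2 * volume {x : ℝ | t < ‖fracSynth s b G x‖}) := by
          rw [e2]; ring
      _ ≤ ENNReal.ofReal (4 * t ^ (p - 3)) * _ := mul_le_mul_right h1 _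
      _ = _ := by
        rw [← lintegral_const_mul' _ _ ENNReal.ofReal_ne_top]
        congr 1
        funext ξ
        simp only [hΦ]
        by_cases hξ : t ≤ 2 * K * |ξ| ^ (1 / 2 - s)
        · rw [Set.indicator_of_mem (by exact hξ), Set.indicator_of_mem (by exact hξ)]
        · rw [Set.indicator_of_notMem (by exact hξ), Set.indicator_of_notMem (by exact hξ), mul_zero]
  have hΦm : AEMeasurable (Function.uncurry Φ) ((volume.restrict (Set.Ioi 0)).prod μ) := by
    have e : Function.uncurry Φ = {q : ℝ × ℝ | q.1 ≤ 2 * K * |q.2| ^ (1 / 2 - s)}.indicator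
        (fun q => ENNReal.ofReal (4 * q.1 ^ (p - 3)) * ‖H q.2‖ₑ ^ 2) := rfl
    rw [e]
    refine AEMeasurable.indicator ?_ ?_
    · have h1 : Measurable fun q : ℝ × ℝ => ENNReal.ofReal (4 * q.1 ^ (p - 3)) := by fun_prop
      exact h1.aemeasurable.mul ((hHm.comp_snd).enorm.pow_const 2)
    · exact measurableSet_le (f := fun q : ℝ × ℝ => q.1)
        (g := fun q : ℝ × ℝ => 2 * K * |q.2| ^ (1 / 2 - s)) (by fun_prop)
        (((measurable_snd (α := ℝ) (β := ℝ)).abs.pow_const _).const_mul _)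
  -- For fixed `ξ` the variable `t` runs up to `2K |ξ|^{1/2-s}`, and `t^{p-3}` is integrable at `0`
  -- because `p > 2`. As `(1/2 - s) p = 1`, the result carries `|ξ|^{(1/2-s)(p-2)} = |ξ|^{2s}`,
  -- which cancels the squared weight and leaves a constant times `‖G‖²`.
  have hinner : ∀ᵐ ξ ∂μ, ∫⁻ t in Set.Ioi (0 : ℝ), Φ t ξ
      = ENNReal.ofReal (4 * ((2 * K) ^ (p - 2) / (p - 2)) * (2 * Real.pi) ^ (-(2 * s)))
        * ‖G ξ‖ₑ ^ 2 := by
    filter_upwards [ae_restrict_of_ae ae_ne_zero_real] with ξ hξ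
    have hξ' : 0 < |ξ| := abs_pos.2 hξ
    set B := 2 * K * |ξ| ^ (1 / 2 - s) with hB
    have hB0 : 0 < B := by positivity
    have e1 : ∀ t, Φ t ξ = (Set.Iic B).indicator
        (fun t => ‖H ξ‖ₑ ^ 2 * ENNReal.ofReal 4 * ENNReal.ofReal (t ^ (p - 3))) t := fun t => by
      simp only [hΦ]
      by_cases h : t ≤ B
      · rw [Set.indicator_of_mem (by exact h), Set.indicator_of_mem (by exact h),
          ENNReal.ofReal_mul (by norm_num)]
        ring
      · rw [Set.indicator_of_notMem (by exact h), Set.indicator_of_notMem (by exact h)]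
    simp_rw [e1]
    rw [lintegral_indicator measurableSet_Iic, Measure.restrict_restrict measurableSet_Iic,
      Set.inter_comm, Set.Ioi_inter_Iic, lintegral_const_mul' _ _ (ENNReal.mul_ne_top
        (ENNReal.pow_ne_top enorm_ne_top) ENNReal.ofReal_ne_top),
      lintegral_Ioc_rpow (by linarith) hB0.le]
    have e2 : ‖H ξ‖ₑ ^ 2 = ENNReal.ofReal ((2 * Real.pi) ^ (-(2 * s)) * |ξ| ^ (-(2 * s)))
        * ‖G ξ‖ₑ ^ 2 := by
      rw [hH]
      simp only [enorm_mul, mul_pow]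
      congr 1
      rw [← ofReal_norm, Complex.norm_real, Real.norm_of_nonneg (by positivity),
        ← ENNReal.ofReal_pow (by positivity), ← abs_mul_rpow_eq, ← Real.rpow_natCast,
        ← Real.rpow_mul (abs_nonneg _)]
      congr 2
      push_cast
      ring
    have e3 : B ^ (p - 3 + 1) = (2 * K) ^ (p - 2) * |ξ| ^ (2 * s) := by
      rw [hB, Real.mul_rpow (by positivity) (by positivity), ← Real.rpow_mul hξ'.le]
      congr 2
      · ring
      · have hpσ : (1 / 2 - s) * p = 1 := by
          rw [hp, mul_one_div_cancel hσ.ne']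
        linear_combination hpσ
    have e4 : |ξ| ^ (-(2 * s)) * |ξ| ^ (2 * s) = 1 := by
      rw [← Real.rpow_add hξ', neg_add_cancel, Real.rpow_zero]
    have hcomm : ∀ x y z w : ℝ≥0∞, x * y * z * w = x * z * w * y := fun x y z w => by ring
    rw [e2, e3, hcomm, ← ENNReal.ofReal_mul (by positivity), ← ENNReal.ofReal_mul (by positivity)]
    congr 2
    rw [show p - 3 + 1 = p - 2 by ring]
    linear_combination ((2 * Real.pi) ^ (-(2 * s)) * 4 * ((2 * K) ^ (p - 2) / (p - 2))) * e4
  calc ∫⁻ t in Set.Ioi (0 : ℝ), volume {x : ℝ | t < ‖fracSynth s b G x‖} * ENNReal.ofReal (t ^ (p - 1))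
      ≤ ∫⁻ t in Set.Ioi (0 : ℝ), ∫⁻ ξ, Φ t ξ ∂μ := setLIntegral_mono' measurableSet_Ioi hstep
    _ = ∫⁻ ξ, (∫⁻ t in Set.Ioi (0 : ℝ), Φ t ξ) ∂μ := lintegral_lintegral_swap hΦm
    _ = ∫⁻ ξ, ENNReal.ofReal (4 * ((2 * K) ^ (p - 2) / (p - 2)) * (2 * Real.pi) ^ (-(2 * s)))
        * ‖G ξ‖ₑ ^ 2 ∂μ := lintegral_congr_ae hinner
    _ < ⊤ := by
      rw [lintegral_const_mul' _ _ ENNReal.ofReal_ne_top]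
      refine ENNReal.mul_lt_top ENNReal.ofReal_lt_top ?_
      have := (eLpNorm_lt_top_iff_lintegral_rpow_enorm_lt_top (by norm_num) (by norm_num)).1 hG.2
      simpa using this

end SobolevEmbedding

/-! ### Transport of Hilbert space structure -/

section Pullback

variable {E F : Type*} [AddCommGroup E] [Module ℂ E] [NormedAddCommGroup F]
  [InnerProductSpace ℂ F]

/-- The inner product transported along a linear equivalence. -/
@[reducible]
noncomputable def pullbackCore (e : E ≃ₗ[ℂ] F) : InnerProductSpace.Core ℂ E where
  inner x y := inner ℂ (e x) (e y)
  conj_inner_symm x y := inner_conj_symm _ _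
  re_inner_nonneg x := inner_self_nonneg
  add_left x y z := by rw [map_add, inner_add_left]
  smul_left x y r := by rw [map_smul, inner_smul_left]
  definite x hx := by
    rw [inner_self_eq_zero] at hx
    exact (LinearEquiv.map_eq_zero_iff e).1 hx

/-- For the transported norm `e` is an isometry, so composing with `B.repr` identifies `E` with
`ℓ²`. This gives completeness and the basis at once, and the coefficients of `x` are those of `e x`.
-/
lemma exists_hilbertBasis_pullback {ι : Type*} (e : E ≃ₗ[ℂ] F) (B : HilbertBasis ι ℂ F) :
    letI : NormedAddCommGroup E := (pullbackCore e).toNormedAddCommGroup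
    letI : InnerProductSpace ℂ E := InnerProductSpace.ofCore (pullbackCore e).toCore
    ∃ b : HilbertBasis ι ℂ E, (∀ i, b i = e.symm (B i)) ∧ (∀ x : E, ‖x‖ = ‖e x‖) ∧
      ∀ x, Tendsto (fun S : Finset ι => ‖x - ∑ i ∈ S, B.repr (e x) i • b i‖) atTop (𝓝 0) ∧
        HasSum (fun i => ‖B.repr (e x) i‖ ^ 2) (‖x‖ ^ 2) := by
  let _ : NormedAddCommGroup E := (pullbackCore e).toNormedAddCommGroup
  let _ : InnerProductSpace ℂ E := InnerProductSpace.ofCore (pullbackCore e).toCore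
  have hnorm : ∀ x : E, ‖x‖ = ‖e x‖ := fun x => by
    have h1 : ‖x‖ = √(RCLike.re (inner ℂ x x)) := norm_eq_sqrt_re_inner x
    have h2 : ‖e x‖ = √(RCLike.re (inner ℂ (e x) (e x))) := norm_eq_sqrt_re_inner (e x)
    rw [h1, h2]
    rfl
  let L : E ≃ₗᵢ[ℂ] F := ⟨e, fun x => (hnorm x).symm⟩
  let b : HilbertBasis ι ℂ E := HilbertBasis.ofRepr (L.trans B.repr)
  have hb : ∀ i, b i = e.symm (B i) := fun i => by
    classical
    rw [← b.repr_symm_single i, ← B.repr_symm_single i]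
    rfl
  refine ⟨b, hb, hnorm, fun x => ⟨?_, ?_⟩⟩
  · have h : HasSum (fun i => B.repr (e x) i • b i) x := b.hasSum_repr x
    have := (tendsto_const_nhds (x := x)).sub h
    simpa using this.norm
  · have h := lp.hasSum_norm (p := 2) (by norm_num) (B.repr (e x))
    simp only [ENNReal.toReal_ofNat, Real.rpow_two] at h
    rw [LinearIsometryEquiv.norm_map, ← hnorm] at h
    exact h

end Pullback

/-! ### The exponential basis of `L²(-b, b)` -/

section TrigonometricBasis

/-- The exponentials of the orthonormal basis of `L²` of an interval of length `2b`. -/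
noncomputable def trigFun (b : ℝ) (n : ℤ) (ξ : ℝ) : ℂ :=
  ((√(2 * b))⁻¹ : ℝ) * Complex.exp (-(Real.pi * Complex.I * n * ξ / b))

lemma continuous_trigFun (b : ℝ) (n : ℤ) : Continuous (trigFun b n) := by
  unfold trigFun; fun_prop

lemma memLp_trigFun (b : ℝ) (n : ℤ) :
    MemLp (trigFun b n) 2 (volume.restrict (Set.Ioc (-b) b)) := by
  refine MemLp.of_bound (continuous_trigFun b n).aestronglyMeasurable ((√(2 * b))⁻¹)
    (Eventually.of_forall fun ξ => ?_)
  rw [trigFun, norm_mul, Complex.norm_real, Real.norm_of_nonneg (by positivity), Complex.norm_exp]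
  have : (-(Real.pi * Complex.I * n * ξ / b) : ℂ).re = 0 := by
    rw [show (-(Real.pi * Complex.I * n * ξ / b) : ℂ) = ((-(Real.pi * n * ξ / b) : ℝ) : ℂ) * Complex.I by
      push_cast; ring]
    simp
  rw [this]
  simp

lemma conj_trigFun (b : ℝ) (n : ℤ) (ξ : ℝ) :
    (starRingEnd ℂ) (trigFun b n ξ)
      = ((√(2 * b))⁻¹ : ℝ) * Complex.exp (Real.pi * Complex.I * n * ξ / b) := by
  rw [trigFun, map_mul, Complex.conj_ofReal, ← Complex.exp_conj]
  congr 2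
  simp
  ring

lemma integral_exp_int_mul {b : ℝ} (hb : 0 < b) {k : ℤ} (hk : k ≠ 0) :
    ∫ ξ in (-b)..b, Complex.exp (Real.pi * Complex.I * k / b * ξ) = 0 := by
  have hb' : (b : ℂ) ≠ 0 := by exact_mod_cast hb.ne'
  have hk' : (k : ℂ) ≠ 0 := by exact_mod_cast hk
  have hpi : (Real.pi : ℂ) ≠ 0 := by exact_mod_cast Real.pi_ne_zero
  have hc : (Real.pi * Complex.I * k / b : ℂ) ≠ 0 :=
    div_ne_zero (mul_ne_zero (mul_ne_zero hpi Complex.I_ne_zero) hk') hb'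
  rw [integral_exp_mul_complex hc]
  -- The exponents at the two endpoints differ by `k` times `2πi`.
  have e1 : (Real.pi * Complex.I * k / b * b : ℂ)
      = Real.pi * Complex.I * k / b * ((-b : ℝ) : ℂ) + k * (2 * Real.pi * Complex.I) := by
    push_cast
    field_simp
    ring
  rw [e1, Complex.exp_add, Complex.exp_int_mul_two_pi_mul_I, mul_one, sub_self, zero_div]

variable {b : ℝ}

lemma inner_trigFun_toLp (n : ℤ) (v : Lp ℂ 2 (volume.restrict (Set.Ioc (-b) b))) :
    inner ℂ ((memLp_trigFun b n).toLp (trigFun b n)) v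
      = ∫ ξ in Set.Ioc (-b) b, ((√(2 * b))⁻¹ : ℝ) *
        Complex.exp (Real.pi * Complex.I * n * ξ / b) * v ξ := by
  rw [L2.inner_def]
  refine integral_congr_ae ?_
  filter_upwards [(memLp_trigFun b n).coeFn_toLp] with ξ hξ
  rw [hξ, RCLike.inner_apply, conj_trigFun, mul_comm]

lemma orthonormal_trigFun (hb : 0 < b) :
    Orthonormal ℂ fun n : ℤ => (memLp_trigFun b n).toLp (trigFun b n) := by
  classical
  rw [orthonormal_iff_ite]
  intro n m
  have hb' : (b : ℂ) ≠ 0 := by exact_mod_cast hb.ne'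
  have e : inner ℂ ((memLp_trigFun b n).toLp (trigFun b n)) ((memLp_trigFun b m).toLp (trigFun b m))
      = ((2 * b)⁻¹ : ℝ) * ∫ ξ in (-b)..b, Complex.exp (Real.pi * Complex.I * (n - m : ℤ) / b * ξ) := by
    rw [inner_trigFun_toLp, intervalIntegral.integral_of_le (by linarith), ← integral_const_mul]
    refine integral_congr_ae ?_
    filter_upwards [(memLp_trigFun b m).coeFn_toLp] with ξ hξ
    rw [hξ, trigFun]
    have h1 : (((√(2 * b))⁻¹ : ℝ) : ℂ) * ((√(2 * b))⁻¹ : ℝ) = ((2 * b)⁻¹ : ℝ) := by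
      rw [← Complex.ofReal_mul, ← mul_inv, Real.mul_self_sqrt (by positivity)]
    rw [← h1, show (Real.pi * Complex.I * (n - m : ℤ) / b * ξ : ℂ)
      = Real.pi * Complex.I * n * ξ / b + -(Real.pi * Complex.I * m * ξ / b) by
        push_cast; ring, Complex.exp_add]
    ring
  rw [e]
  split_ifs with h
  · subst h
    simp only [sub_self, Int.cast_zero, mul_zero, zero_div, zero_mul, Complex.exp_zero]
    rw [intervalIntegral.integral_const]
    push_cast
    rw [Complex.real_smul]
    push_cast
    field_simp
    ring
  · rw [integral_exp_int_mul hb (sub_ne_zero.2 h), mul_zero]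

/-- The orthonormal basis of exponentials of `L²(-b, b)`. -/
noncomputable def trigBasis (hb : 0 < b) :
    HilbertBasis ℤ ℂ (Lp ℂ 2 (volume.restrict (Set.Ioc (-b) b))) :=
  HilbertBasis.mkOfOrthogonalEqBot (orthonormal_trigFun hb) (by
    rw [Submodule.eq_bot_iff]
    intro v hv
    rw [Submodule.mem_orthogonal] at hv
    have hlt : -b < b := by linarith
    -- The exponentials in `trigFun` carry a minus sign, so orthogonality to the one of index `-n`
    -- kills the `n`-th Fourier coefficient. Parseval then forces `v = 0`.
    have hc : ∀ n : ℤ, fourierCoeffOn hlt v n = 0 := fun n => by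
      have h := hv _ (Submodule.subset_span ⟨-n, rfl⟩)
      rw [inner_trigFun_toLp] at h
      rw [fourierCoeffOn_eq_integral, intervalIntegral.integral_of_le hlt.le]
      simp only [mul_assoc] at h
      rw [integral_const_mul] at h
      have hne : (((√(2 * b))⁻¹ : ℝ) : ℂ) ≠ 0 := by
        have : 0 < √(2 * b) := by positivity
        exact_mod_cast (inv_pos.2 this).ne'
      have h' := (mul_eq_zero.1 h).resolve_left hne
      have e : ∀ ξ : ℝ, (fourier (-n) (ξ : AddCircle (b - -b)) : ℂ) • (v ξ : ℂ)
          = Complex.exp (Real.pi * (Complex.I * ((-n : ℤ) * ξ)) / b) * v ξ := fun ξ => by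
        rw [fourier_coe_apply, smul_eq_mul]
        congr 2
        have hb' : (b : ℂ) ≠ 0 := by exact_mod_cast hb.ne'
        push_cast
        field_simp
        ring
      simp_rw [e]
      have e2 : ∫ ξ in Set.Ioc (-b) b,
          Complex.exp (Real.pi * (Complex.I * ((-n : ℤ) * ξ)) / b) * v ξ = 0 := h'
      rw [e2, smul_zero]
    have hs := hasSum_sq_fourierCoeffOn hlt (Lp.memLp v)
    simp only [hc, norm_zero, ne_eq, OfNat.ofNat_ne_zero, not_false_eq_true, zero_pow] at hs
    have h0 := hs.unique hasSum_zero
    rw [smul_eq_mul, intervalIntegral.integral_of_le hlt.le] at h0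
    have h1 := (mul_eq_zero.1 h0).resolve_left (inv_ne_zero (by linarith))
    rw [← toReal_eLpNorm_two (Lp.memLp v)] at h1
    have h2 : ‖v‖ = 0 := by
      rw [Lp.norm_def]
      exact pow_eq_zero_iff (two_ne_zero) |>.1 h1
    exact norm_eq_zero.1 h2)

lemma trigBasis_apply (hb : 0 < b) (n : ℤ) :
    trigBasis hb n = (memLp_trigFun b n).toLp (trigFun b n) := by
  rw [trigBasis, HilbertBasis.coe_mkOfOrthogonalEqBot]

lemma trigBasis_repr (hb : 0 < b) (v : Lp ℂ 2 (volume.restrict (Set.Ioc (-b) b))) (n : ℤ) :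
    (trigBasis hb).repr v n = ((√(2 * b))⁻¹ : ℝ) *
      ∫ ξ in Set.Ioc (-b) b, Complex.exp (Real.pi * Complex.I * n * ξ / b) * v ξ := by
  rw [HilbertBasis.repr_apply_apply, trigBasis_apply, inner_trigFun_toLp, ← integral_const_mul]
  simp only [mul_assoc]

end TrigonometricBasis

/-! ### The bijection between `L²(-b, b)` and `PW^s_a` -/

lemma Differentiable.eq_of_eq_ofReal {f g : ℂ → ℂ} (hf : Differentiable ℂ f)
    (hg : Differentiable ℂ g) (h : ∀ x : ℝ, f x = g x) : f = g := by
  refine AnalyticOnNhd.eq_of_frequently_eq (z₀ := 0) (fun z _ => hf.analyticAt z)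
    (fun z _ => hg.analyticAt z) ?_
  have ht : Tendsto (fun x : ℝ => (x : ℂ)) (𝓝[≠] 0) (𝓝[≠] 0) := by
    refine tendsto_nhdsWithin_iff.2 ⟨?_, ?_⟩
    · simpa using (Complex.continuous_ofReal.tendsto 0).mono_left nhdsWithin_le_nhds
    · filter_upwards [self_mem_nhdsWithin] with x hx
      simpa using hx
  exact ht.frequently (Eventually.of_forall h).frequently

lemma iteratedDeriv_polynomial_eval_ofReal (P : Polynomial ℂ) (k : ℕ) :
    iteratedDeriv k (fun x : ℝ => P.eval (x : ℂ))
      = fun x : ℝ => (Polynomial.derivative^[k] P).eval (x : ℂ) := by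
  induction k with
  | zero => simp
  | succ k ih =>
    rw [iteratedDeriv_succ, ih]
    funext x
    rw [Function.iterate_succ_apply']
    exact ((Polynomial.derivative^[k] P).hasDerivAt (x : ℂ)).comp_ofReal.deriv

lemma eq_zero_of_polynomial_of_iteratedDeriv_eq_zero {d : ℝ → ℂ} {c : ℕ → ℂ} {n : ℕ}
    (hd : ∀ x, d x = ∑ k ∈ Finset.range n, c k * (x : ℂ) ^ k)
    (h0 : ∀ k < n, iteratedDeriv k d 0 = 0) (x : ℝ) : d x = 0 := by
  set P : Polynomial ℂ := ∑ k ∈ Finset.range n, Polynomial.C (c k) * Polynomial.X ^ k with hP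
  have hdP : d = fun x : ℝ => P.eval (x : ℂ) := by
    funext x
    rw [hd, hP, Polynomial.eval_finsetSum]
    simp
  have hc : ∀ k < n, c k = 0 := fun k hk => by
    have h := h0 k hk
    have hk' : P.coeff k = c k := by
      rw [hP, Polynomial.finsetSum_coeff]
      simp [Polynomial.coeff_X_pow, hk]
    rw [hdP, iteratedDeriv_polynomial_eval_ofReal] at h
    simp only [Complex.ofReal_zero] at h
    rw [← Polynomial.coeff_zero_eq_eval_zero, Polynomial.coeff_iterate_derivative, zero_add,
      Nat.descFactorial_self, hk', nsmul_eq_mul] at h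
    exact (mul_eq_zero.1 h).resolve_left (by exact_mod_cast k.factorial_ne_zero)
  rw [hd]
  exact Finset.sum_eq_zero fun k hk => by rw [hc k (Finset.mem_range.1 hk), zero_mul]

section

variable {s b : ℝ} {G : ℝ → ℂ}

lemma MeasureTheory.MemLp.indicator_Ioc (hG : MemLp G 2 (volume.restrict (Set.Ioc (-b) b))) :
    MemLp ((Set.Ioc (-b) b).indicator G) 2 volume :=
  (memLp_indicator_iff_restrict measurableSet_Ioc).2 hG

lemma fracSynth_mem_fracPaleyWiener (hs : 0 < s) (hs' : ∀ k : ℕ, s - 1 / 2 ≠ k)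
    (hG : MemLp G 2 (volume.restrict (Set.Ioc (-b) b))) :
    fracSynth s b G ∈ fracPaleyWiener s (2 * Real.pi * b) hs := by
  refine ⟨isEntireExpType_fracSynth hG, fun h => memLp_fracSynth hs h hG, fun h =>
    ⟨homLipschitz_fracSynth h hs' hG, fun k hk => iteratedDeriv_fracSynth_zero hG ?_⟩, ?_⟩
  · rw [taylorCount_eq_floor_add_one h]
    omega
  · obtain ⟨u, hu⟩ := hG.indicator_Ioc.exists_fourierInv
    exact ⟨u, isFracLap_fracSynth hs hG hu⟩

/-- By uniqueness of the fractional Laplacian, the transform of `Δ^{s/2} 0 = 0` is the extension of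
`G` by zero. -/
lemma ae_eq_zero_of_fracSynth_eq_zero (hs : 0 < s)
    (hG : MemLp G 2 (volume.restrict (Set.Ioc (-b) b))) (h0 : ∀ x : ℝ, fracSynth s b G x = 0) :
    G =ᵐ[volume.restrict (Set.Ioc (-b) b)] 0 := by
  obtain ⟨u, hu⟩ := hG.indicator_Ioc.exists_fourierInv
  have h1 := isFracLap_fracSynth hs hG hu
  simp only [h0] at h1
  obtain ⟨H, hH⟩ := (MemLp.zero : MemLp (fun _ : ℝ => (0 : ℂ)) 2 volume).exists_fourier
  have hH0 : H =ᵐ[volume] 0 := by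
    rw [← eLpNorm_eq_zero_iff hH.2.1.1 two_ne_zero, ← hH.eLpNorm_eq]
    exact eLpNorm_zero
  have h2 := (h1.fourier_unique hs (isFracLap_zero s) hu hH).trans hH0
  refine (ae_restrict_iff' measurableSet_Ioc).2 ?_
  filter_upwards [h2] with ξ hξ hm
  rwa [Set.indicator_of_mem hm] at hξ

/-- Synthesis from the Fourier transform, as a linear map onto the fractional Paley--Wiener
space. -/
noncomputable def fracSynthLinear (hs : 0 < s) (hs' : ∀ k : ℕ, s - 1 / 2 ≠ k) (b : ℝ) :
    Lp ℂ 2 (volume.restrict (Set.Ioc (-b) b)) →ₗ[ℂ] fracPaleyWiener s (2 * Real.pi * b) hs where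
  toFun g := ⟨fracSynth s b g, fracSynth_mem_fracPaleyWiener hs hs' (Lp.memLp g)⟩
  map_add' g h := by
    refine Subtype.ext (funext fun z => ?_)
    change fracSynth s b _ z = fracSynth s b g z + fracSynth s b h z
    rw [fracSynth_congr_ae (Lp.coeFn_add g h), fracSynth_add (Lp.memLp g) (Lp.memLp h)]
  map_smul' c g := by
    refine Subtype.ext (funext fun z => ?_)
    change fracSynth s b _ z = c * fracSynth s b g z
    rw [fracSynth_congr_ae (Lp.coeFn_smul c g), fracSynth_smul]

lemma fracSynthLinear_injective (hs : 0 < s) (hs' : ∀ k : ℕ, s - 1 / 2 ≠ k) :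
    Function.Injective (fracSynthLinear hs hs' b) := by
  rw [injective_iff_map_eq_zero]
  intro g hg
  have h0 : ∀ z, fracSynth s b g z = 0 := fun z => congrFun (congrArg Subtype.val hg) z
  exact (Lp.eq_zero_iff_ae_eq_zero).2 (ae_eq_zero_of_fracSynth_eq_zero hs (Lp.memLp g) fun x => h0 x)

/-- The candidate `G` is the transform of `Δ^{s/2} f`, which lives on `[-b, b]` by Paley–Wiener.
Then `f` and its candidate have equal pairings with all `ψ` of vanishing moments, so on the real
line they differ by a polynomial of degree less than `M`. Both have zero Taylor polynomial at the
origin, so the difference is zero there, and the identity theorem extends this to the plane. -/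
lemma exists_eq_fracSynth (hs : 0 < s) (hs' : ∀ k : ℕ, s - 1 / 2 ≠ k) (hb : 0 < b) {f : ℂ → ℂ}
    (hf : f ∈ fracPaleyWiener s (2 * Real.pi * b) hs) :
    ∃ G, MemLp G 2 (volume.restrict (Set.Ioc (-b) b)) ∧ fracSynth s b G = f := by
  obtain ⟨hE, hR⟩ := hf
  obtain ⟨u, hu⟩ := hR.2.2
  obtain ⟨G, hG⟩ := hu.1.exists_fourier
  have hne : s ≠ 1 / 2 := fun h => hs' 0 (by simp [h])
  have hG0 := RealizationSpace.fourier_ae_eq_zero hs hne hb hE hR hu hG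
  have hGr : MemLp G 2 (volume.restrict (Set.Ioc (-b) b)) := hG.2.1.restrict _
  have hGi : L2FourierPair u ((Set.Ioc (-b) b).indicator G) := by
    refine hG.congr_right ?_
    filter_upwards [hG0] with ξ hξ
    by_cases hm : ξ ∈ Set.Ioc (-b) b
    · rw [Set.indicator_of_mem hm]
    · rw [Set.indicator_of_notMem hm, hξ hm]
  have h1 := isFracLap_fracSynth hs hGr hGi
  have hE1 := isEntireExpType_fracSynth (s := s) hGr
  refine ⟨G, hGr, hE1.1.eq_of_eq_ofReal hE.1 fun x => ?_⟩
  obtain ⟨c, hc⟩ := exists_polynomial_of_integral_mul_eq_zero (s := s)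
    (f := fun x : ℝ => fracSynth s b G x - f x)
    ((hE1.1.continuous.comp Complex.continuous_ofReal).sub
      (hE.1.continuous.comp Complex.continuous_ofReal))
    (fun ψ => by
      simp only [sub_mul]
      exact (h1.2.1 ψ).sub (hu.2.1 ψ))
    (fun ψ hψ => by
      simp only [sub_mul]
      rw [integral_sub (h1.2.1 ψ) (hu.2.1 ψ), h1.integral_mul_eq hs hGi hψ,
        hu.integral_mul_eq hs hGi hψ, sub_self])
  refine sub_eq_zero.1 (eq_zero_of_polynomial_of_iteratedDeriv_eq_zero hc (fun k hk => ?_) x)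
  -- For `s < 1/2` there is no Taylor coefficient to check: `M = 0` and the polynomial is the empty
  -- sum.
  rcases lt_or_gt_of_ne hne with h | h
  · rw [taylorCount_eq_zero h] at hk
    omega
  · have hk2 : k ≤ ⌊s - 1 / 2⌋₊ := by
      rw [taylorCount_eq_floor_add_one h] at hk
      omega
    have hk' : ((k : ℕ) : WithTop ℕ∞) ≤ (⌊s - 1 / 2⌋₊ : ℕ) := by exact_mod_cast hk2
    have c1 := ((homLipschitz_fracSynth h hs' hGr).1.of_le hk').contDiffAt (x := 0)
    have c2 := ((hR.2.1 h).1.1.of_le hk').contDiffAt (x := 0)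
    rw [iteratedDeriv_fun_sub c1 c2, iteratedDeriv_fracSynth_zero hGr hk, (hR.2.1 h).2 k hk2,
      sub_self]

lemma fracSynthLinear_surjective (hs : 0 < s) (hs' : ∀ k : ℕ, s - 1 / 2 ≠ k) (hb : 0 < b) :
    Function.Surjective (fracSynthLinear hs hs' b) := by
  rintro ⟨f, hf⟩
  obtain ⟨G, hG, rfl⟩ := exists_eq_fracSynth hs hs' hb hf
  exact ⟨hG.toLp G, Subtype.ext (funext fun z => fracSynth_congr_ae hG.coeFn_toLp z)⟩

/-- A function of the fractional Paley--Wiener space is determined by the Fourier transform of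
its fractional Laplacian, an arbitrary element of `L²(-b, b)`. -/
noncomputable def fracAnalysis (hs : 0 < s) (hs' : ∀ k : ℕ, s - 1 / 2 ≠ k) (hb : 0 < b) :
    fracPaleyWiener s (2 * Real.pi * b) hs ≃ₗ[ℂ] Lp ℂ 2 (volume.restrict (Set.Ioc (-b) b)) :=
  (LinearEquiv.ofBijective (fracSynthLinear hs hs' b)
    ⟨fracSynthLinear_injective hs hs', fracSynthLinear_surjective hs hs' hb⟩).symm

lemma fracSynth_fracAnalysis (hs : 0 < s) (hs' : ∀ k : ℕ, s - 1 / 2 ≠ k) (hb : 0 < b)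
    (f : fracPaleyWiener s (2 * Real.pi * b) hs) :
    (f : ℂ → ℂ) = fracSynth s b (fracAnalysis hs hs' hb f) :=
  (congrArg Subtype.val ((fracAnalysis hs hs' hb).symm_apply_apply f)).symm

lemma fracAnalysis_symm_apply (hs : 0 < s) (hs' : ∀ k : ℕ, s - 1 / 2 ≠ k) (hb : 0 < b)
    (g : Lp ℂ 2 (volume.restrict (Set.Ioc (-b) b))) :
    ((fracAnalysis hs hs' hb).symm g : ℂ → ℂ) = fracSynth s b g := rfl

lemma IsFracLap.pair_of_fracSynth (hs : 0 < s)
    (hG : MemLp G 2 (volume.restrict (Set.Ioc (-b) b))) {u : ℝ → ℂ}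
    (hu : IsFracLap s (fun x : ℝ => fracSynth s b G x) u) :
    L2FourierPair u ((Set.Ioc (-b) b).indicator G) := by
  obtain ⟨v, hv⟩ := hG.indicator_Ioc.exists_fourierInv
  exact hv.congr_left ((isFracLap_fracSynth hs hG hv).unique hs hu)

lemma remTransform_zero_ofReal (x : ℝ) :
    remTransform b 0 G x = 𝓕⁻ ((Set.Ioc (-b) b).indicator G) x := by
  rw [Real.fourierInv_eq', remTransform, ← integral_indicator measurableSet_Ioc]
  refine integral_congr_ae (Eventually.of_forall fun ξ => ?_)
  by_cases hm : ξ ∈ Set.Ioc (-b) b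
  · simp only [Set.indicator_of_mem hm, expRem, Finset.range_zero, Finset.sum_empty, sub_zero,
      smul_eq_mul, RCLike.inner_apply, conj_trivial]
    congr 2
    push_cast
    ring
  · simp only [Set.indicator_of_notMem hm, smul_zero]

/-- The inverse Fourier integral of `G` is itself of exponential type `2πb` and represents `Δ^{s/2}
f`. Another representative in `PW_a` agrees with it almost everywhere, by continuity on the real
line, and by the identity theorem everywhere. -/
lemma isFracLapExt_fracSynth_iff (hs : 0 < s)
    (hG : MemLp G 2 (volume.restrict (Set.Ioc (-b) b))) {F : ℂ → ℂ} :
    IsFracLapExt s (2 * Real.pi * b) (fracSynth s b G) F ↔ F = remTransform b 0 G := by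
  have hI : IntegrableOn G (Set.Ioc (-b) b) := hG.integrable one_le_two
  have hI0 : IntegrableOn (fun ξ : ℝ => (ξ : ℂ) ^ 0 * G ξ) (Set.Ioc (-b) b) := by simpa using hI
  have hR : IsEntireExpType (2 * Real.pi * b) (remTransform b 0 G) :=
    isEntireExpType_remTransform hG.1 hI0
  have hp : L2FourierPair (fun x : ℝ => remTransform b 0 G x) ((Set.Ioc (-b) b).indicator G) := by
    rw [show (fun x : ℝ => remTransform b 0 G x) = 𝓕⁻ ((Set.Ioc (-b) b).indicator G) from
      funext remTransform_zero_ofReal]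
    exact L2FourierPair.fourierInv ((integrable_indicator_iff measurableSet_Ioc).2 hI)
      hG.indicator_Ioc
  refine ⟨fun hF => ?_, ?_⟩
  · refine hF.1.1.1.eq_of_eq_ofReal hR.1 fun x => ?_
    have h := (hF.2.pair_of_fracSynth hs hG).ae_eq_left hp
    have := (Continuous.ae_eq_iff_eq volume (hF.1.1.1.continuous.comp Complex.continuous_ofReal)
      (hR.1.continuous.comp Complex.continuous_ofReal)).1 h
    exact congrFun this x
  · rintro rfl
    exact ⟨⟨hR, hp.1⟩, isFracLap_fracSynth hs hG hp⟩

lemma sqrt_pi_div (hb : 0 < b) : √(Real.pi / (2 * Real.pi * b)) = (√(2 * b))⁻¹ := by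
  rw [← Real.sqrt_inv]
  congr 1
  have := Real.pi_pos
  field_simp

/-- At the sampling point `nπ/a = n/(2b)` the Fourier kernel is the `n`-th exponential up to
conjugation and normalization, so the sample is a Fourier coefficient of `g`. -/
lemma sqrt_mul_remTransform_zero (hb : 0 < b)
    (g : Lp ℂ 2 (volume.restrict (Set.Ioc (-b) b))) (n : ℤ) :
    (√(Real.pi / (2 * Real.pi * b)) : ℂ)
        * remTransform b 0 g (n * (Real.pi / ((2 * Real.pi * b : ℝ) : ℂ)))
      = (trigBasis hb).repr g n := by
  rw [trigBasis_repr, sqrt_pi_div hb, remTransform]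
  congr 1
  refine integral_congr_ae (Eventually.of_forall fun ξ => ?_)
  simp only [expRem, Finset.range_zero, Finset.sum_empty, sub_zero]
  congr 2
  have h1 : (b : ℂ) ≠ 0 := by exact_mod_cast hb.ne'
  have h2 : (Real.pi : ℂ) ≠ 0 := by exact_mod_cast Real.pi_ne_zero
  push_cast
  field_simp

/-- The substitution `ξ ↦ 2πξ` passes between ordinary and angular frequency; its Jacobian accounts
for the change of normalizing constant. -/
lemma fracSynth_trigFun (hb : 0 < b) (n : ℤ) (z : ℂ) :
    fracSynth s b (trigFun b n) z = shannonFun s (2 * Real.pi * b) n z := by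
  have hpi := Real.pi_pos
  have hc : (2 * Real.pi : ℝ) • ((1 / (2 * √(2 * Real.pi * b * Real.pi)) : ℝ) : ℂ)
      = ((√(2 * b))⁻¹ : ℝ) := by
    rw [show 2 * Real.pi * b * Real.pi = Real.pi ^ 2 * (2 * b) by ring,
      Real.sqrt_mul (by positivity), Real.sqrt_sq hpi.le, Complex.real_smul, ← Complex.ofReal_mul]
    congr 1
    have : 0 < √(2 * b) := by positivity
    field_simp
  rw [shannonFun, show -(2 * Real.pi * b) = 2 * Real.pi * (-b) by ring,
    ← intervalIntegral.smul_integral_comp_mul_left, mul_smul_comm, ← smul_mul_assoc, hc,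
    intervalIntegral.integral_of_le (by linarith), ← integral_const_mul, fracSynth, remTransform]
  refine integral_congr_ae (Eventually.of_forall fun ξ => ?_)
  simp only [trigFun, expRem, taylorExp]
  have h1 : (b : ℂ) ≠ 0 := by exact_mod_cast hb.ne'
  have h2 : (Real.pi : ℂ) ≠ 0 := by exact_mod_cast Real.pi_ne_zero
  rw [show (2 * Real.pi * Complex.I * z * ξ : ℂ) = Complex.I * z * ((2 * Real.pi * ξ : ℝ) : ℂ) by
    push_cast; ring,
    show (-(Real.pi * Complex.I * n * ξ / b) : ℂ) = -(Complex.I * n *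
      (Real.pi / ((2 * Real.pi * b : ℝ) : ℂ)) * ((2 * Real.pi * ξ : ℝ) : ℂ)) by
    push_cast; field_simp]
  ring

lemma shannonFun_eq_translate (hs : s < 1 / 2) (a : ℝ) (n : ℤ) (z : ℂ) :
    shannonFun s a n z = shannonFun s a 0 (z - n * (Real.pi / a)) := by
  unfold shannonFun
  congr 1
  refine intervalIntegral.integral_congr fun ξ _ => ?_
  simp only [taylorExp, taylorCount_eq_zero hs, Finset.range_zero, Finset.sum_empty, sub_zero]
  rw [← Complex.exp_add, ← Complex.exp_add]
  congr 2
  push_cast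
  ring

end

/-! ### The sampling theorem -/

theorem proposition5p1 (s a : ℝ) (hs : 0 < s) (hs' : ∀ k : ℕ, s - 1 / 2 ≠ k) (ha : 0 < a) :
    -- for `s < 1/2` the functions `ψ_n` are the translates of `ψ = ψ_0`
    (s < 1 / 2 → ∀ (n : ℤ) (z : ℂ),
      shannonFun s a n z = shannonFun s a 0 (z - n * (Real.pi / a))) ∧
    -- `⟨f, g⟩ = ∫ conj (Δ^{s/2} f) Δ^{s/2} g` is an inner product on `PW^s_a`
    ∃ c : InnerProductSpace.Core ℂ (fracPaleyWiener s a hs),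
      (∀ (f g : fracPaleyWiener s a hs) (u v : ℝ → ℂ),
        IsFracLap s (fun x : ℝ => (f : ℂ → ℂ) x) u → IsFracLap s (fun x : ℝ => (g : ℂ → ℂ) x) v →
          c.inner f g = ∫ x, (starRingEnd ℂ) (u x) * v x) ∧
      letI : NormedAddCommGroup (fracPaleyWiener s a hs) := c.toNormedAddCommGroup
      letI : InnerProductSpace ℂ (fracPaleyWiener s a hs) := InnerProductSpace.ofCore c.toCore
      -- with this inner product, `(ψ_n)` is an orthonormal (Hilbert) basis of `PW^s_a`
      ∃ b : HilbertBasis ℤ ℂ (fracPaleyWiener s a hs),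
        (∀ (n : ℤ) (z : ℂ), (b n : ℂ → ℂ) z = shannonFun s a n z) ∧
        ∀ f : fracPaleyWiener s a hs,
          -- `Δ^{s/2} f` extends to a unique function `F` in `PW_a`
          (∃! F : ℂ → ℂ, IsFracLapExt s a f F) ∧
          ∀ F : ℂ → ℂ, IsFracLapExt s a f F →
            -- the expansion of `f`, in norm and uniformly on compact sets
            Tendsto (fun S : Finset ℤ =>
              ‖f - ∑ n ∈ S, ((√(Real.pi / a) : ℂ) * F (n * (Real.pi / a))) • b n‖) atTop (𝓝 0) ∧
            (∀ K : Set ℂ, IsCompact K →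
              TendstoUniformlyOn (fun (S : Finset ℤ) (z : ℂ) =>
                ∑ n ∈ S, (√(Real.pi / a) : ℂ) * F (n * (Real.pi / a)) * shannonFun s a n z)
                (f : ℂ → ℂ) atTop K) ∧
            -- the norm identity
            HasSum (fun n : ℤ => Real.pi / a * ‖F (n * (Real.pi / a))‖ ^ 2) (‖f‖ ^ 2) := by
  refine ⟨fun h n z => shannonFun_eq_translate h a n z, ?_⟩
  obtain ⟨b, rfl⟩ : ∃ b, a = 2 * Real.pi * b :=
    ⟨a / (2 * Real.pi), by field_simp⟩
  have hb : 0 < b := pos_of_mul_pos_right ha (by positivity)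
  set e := fracAnalysis hs hs' hb with he
  refine ⟨pullbackCore e, fun f g u v hu hv => ?_, ?_⟩
  · rw [fracSynth_fracAnalysis hs hs' hb] at hu hv
    rw [(hu.pair_of_fracSynth hs (Lp.memLp _)).integral_conj_mul
      (hv.pair_of_fracSynth hs (Lp.memLp _))]
    change inner ℂ (e f) (e g) = _
    rw [L2.inner_def, ← integral_indicator measurableSet_Ioc]
    refine integral_congr_ae (Eventually.of_forall fun ξ => ?_)
    by_cases hm : ξ ∈ Set.Ioc (-b) b
    · simp only [Set.indicator_of_mem hm, RCLike.inner_apply, mul_comm, he]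
    · simp only [Set.indicator_of_notMem hm, mul_zero]
  · let _ : NormedAddCommGroup (fracPaleyWiener s (2 * Real.pi * b) hs) :=
      (pullbackCore e).toNormedAddCommGroup
    let _ : InnerProductSpace ℂ (fracPaleyWiener s (2 * Real.pi * b) hs) :=
      InnerProductSpace.ofCore (pullbackCore e).toCore
    obtain ⟨B, hB, hnorm, hexp⟩ := exists_hilbertBasis_pullback e (trigBasis hb)
    have hBz : ∀ (n : ℤ) (z : ℂ), (B n : ℂ → ℂ) z = shannonFun s (2 * Real.pi * b) n z :=
      fun n z => by
        rw [hB, fracAnalysis_symm_apply, trigBasis_apply,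
          fracSynth_congr_ae (memLp_trigFun b n).coeFn_toLp, fracSynth_trigFun hb]
    refine ⟨B, hBz, fun f => ?_⟩
    have hf : ∀ F, IsFracLapExt s (2 * Real.pi * b) f F ↔ F = remTransform b 0 (e f) := fun F => by
      rw [fracSynth_fracAnalysis hs hs' hb f]
      exact isFracLapExt_fracSynth_iff hs (Lp.memLp _)
    refine ⟨⟨_, (hf _).2 rfl, fun F hF => (hf F).1 hF⟩, fun F hF => ?_⟩
    obtain rfl := (hf F).1 hF
    obtain ⟨h1, h2⟩ := hexp f
    have hcoef := sqrt_mul_remTransform_zero hb (e f)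
    simp only [hcoef]
    refine ⟨h1, fun K hK => ?_, ?_⟩
    · obtain ⟨R, hR⟩ := hK.isBounded.exists_norm_le
      obtain ⟨C, hC0, hC⟩ := norm_fracSynth_le s b
      -- `W` bounds the norms of all point evaluations at points of `K`; applied to the tail of the
      -- series it turns norm convergence into uniform convergence.
      set W := (2 * Real.pi * |R|) ^ taylorCount s * Real.exp (2 * Real.pi * b * |R|) * C with hW
      have hbound : ∀ x : fracPaleyWiener s (2 * Real.pi * b) hs, ∀ z ∈ K,
          ‖(x : ℂ → ℂ) z‖ ≤ W * ‖x‖ := fun x z hz => by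
        have hz' : ‖z‖ ≤ |R| := (hR z hz).trans (le_abs_self R)
        have hx := hC (e x) (Lp.memLp _) z
        rw [← Lp.norm_def, ← hnorm, ← mul_assoc] at hx
        rw [fracSynth_fracAnalysis hs hs' hb x]
        refine hx.trans ?_
        have := Real.pi_pos
        rw [hW]
        gcongr
      rw [Metric.tendstoUniformlyOn_iff]
      intro ε hε
      have h3 := h1.const_mul W
      rw [mul_zero] at h3
      filter_upwards [h3.eventually_lt_const hε] with S hS z hz
      refine lt_of_le_of_lt ?_ hS
      refine le_trans (le_of_eq ?_) (hbound _ z hz)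
      rw [dist_eq_norm]
      congr 1
      simp only [Submodule.coe_sub, Submodule.coe_sum, Submodule.coe_smul, Pi.sub_apply,
        Finset.sum_apply, Pi.smul_apply, smul_eq_mul, hBz]
    · convert h2 using 2 with n
      rw [← hcoef, norm_mul, mul_pow, Complex.norm_real, Real.norm_of_nonneg (Real.sqrt_nonneg _),
        Real.sq_sqrt (by positivity)]
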